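/- Let $x$ be a real random variable with zero mean and infinite variance which is in the domain of attraction of the Gaussian distribution, i.e. for i.i.d. copies $x_1,x_2,\dots$ of $x$ there is a sequence $(c_n)$ such that the laws of $(x_1+\dots+x_n)/c_n$ converge weakly to $\mathcal N(0,1)$. Put \[ l(t)=\mathbb{E}\,x^2\mathbf 1_{\{|x|\le t\}},\qquad b=\inf\{t>0:\ l(t)>0\},\qquad b_n=\inf\{t>b+1:\ n\,l(t)\le t^2\}. \] For every $n\ge 1$ let $X_n$ be a random $n\times n$ Hermitian matrix, each of whose entries has the same distribution as $x$. Assume that there are numbers $d_n=O(n)$ such that, for every $n$, the index set $\{1,\dots,n\}^2$ has a partition $\{P_1,\dots,P_k\}$ with $|P_r|\le d_n$ for all $r$, for which the random vectors $\{(X_n)_{ij}\}_{(i,j)\in P_r}$, $r=1,\dots,k$, are independent. For an $n\times n$ Hermitian matrix $A$ with eigenvalues $\lambda_1\le\dots\le\lambda_n$ let $L_n^{A}=\frac1n\sum_{i=1}^n\delta_{\lambda_i}$ be its empirical spectral distribution, and for random $A$ let $\mathbb{E}L_n^{A}$ be the probability measure with $(\mathbb{E}L_n^{A})(B)=\mathbb{E}(L_n^{A}(B))$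 for every Borel set $B\subset\mathbb{R}$. Then for any metric $d$ on the set of Borel probability measures on $\mathbb{R}$ that metrizes weak convergence, \[ d\bigl(L_n^{X_n/b_n},\ \mathbb{E}L_n^{X_n/b_n}\bigr)\longrightarrow 0\quad\text{in probability as } n\to\infty . \] -/

import Mathlib

open MeasureTheory ProbabilityTheory Filter Topology
open scoped ENNReal NNReal

noncomputable section

namespace HeavyTails

/-- The space of `n × n` complex Hermitian matrices. -/
abbrev Herm (n : ℕ) : Type := selfAdjoint (Matrix (Fin n) (Fin n) ℂ)

theorem Herm.isHermitian {n : ℕ} (A : Herm n) : (A : Matrix (Fin n) (Fin n) ℂ).IsHermitian := A.2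

/-- The eigenvalues of a Hermitian matrix, with multiplicity. -/
def eigs {n : ℕ} (A : Herm n) : Fin n → ℝ := A.isHermitian.eigenvalues

/-- The empirical spectral distribution `(1/n) ∑ᵢ δ_{λᵢ}` of a Hermitian matrix of size `n ≥ 1`. -/
def esd {n : ℕ} [NeZero n] (A : Herm n) : ProbabilityMeasure ℝ :=
  ⟨(n : ℝ≥0∞)⁻¹ • ∑ i, Measure.dirac (eigs A i), ⟨by
    simp only [Measure.smul_apply, Measure.finsetSum_apply, measure_univ, Finset.sum_const,
      Finset.card_univ, Fintype.card_fin, nsmul_eq_mul, mul_one, smul_eq_mul]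
    exact ENNReal.inv_mul_cancel (by simp [NeZero.ne n]) (by simp)⟩⟩

/-- A random Hermitian matrix: a map all of whose entries are measurable. -/
def IsRandomHerm {Ω : Type*} [MeasurableSpace Ω] {n : ℕ} (X : Ω → Herm n) : Prop :=
  ∀ i j, Measurable fun ω => (X ω : Matrix (Fin n) (Fin n) ℂ) i j

theorem IsRandomHerm.const_smul {Ω : Type*} [MeasurableSpace Ω] {n : ℕ} {X : Ω → Herm n}
    (hX : IsRandomHerm X) (r : ℝ) : IsRandomHerm fun ω => r • X ω := fun i j => by
  have h : (fun ω => ((r • X ω : Herm n) : Matrix (Fin n) (Fin n) ℂ) i j) =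
      fun ω => r • (X ω : Matrix (Fin n) (Fin n) ℂ) i j := rfl
  rw [h]
  exact (hX i j).const_smul r

theorem trace_pow_eq {n : ℕ} (A : Herm n) (k : ℕ) :
    ((A : Matrix (Fin n) (Fin n) ℂ) ^ k).trace = ∑ i, ((eigs A i ^ k : ℝ) : ℂ) := by
  conv_lhs => rw [A.isHermitian.spectral_theorem, ← map_pow, Matrix.diagonal_pow,
    Unitary.conjStarAlgAut_apply, Matrix.trace_mul_comm, ← mul_assoc]
  simp [Matrix.trace_diagonal, eigs]

theorem IsRandomHerm.measurable_sum_pow {Ω : Type*} [MeasurableSpace Ω] {n : ℕ} {X : Ω → Herm n}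
    (hX : IsRandomHerm X) (k : ℕ) : Measurable fun ω => ∑ i, eigs (X ω) i ^ k := by
  have hpow : ∀ k : ℕ, ∀ i j,
      Measurable fun ω => ((X ω : Matrix (Fin n) (Fin n) ℂ) ^ k) i j := by
    intro k
    induction k with
    | zero => intro i j; simp only [pow_zero]; exact measurable_const
    | succ k ih =>
      intro i j
      simp only [pow_succ, Matrix.mul_apply]
      exact Finset.measurable_sum _ fun l _ => (ih i l).mul (hX l j)
  have h : (fun ω => ∑ i, eigs (X ω) i ^ k) =
      fun ω => (((X ω : Matrix (Fin n) (Fin n) ℂ) ^ k).trace).re := by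
    funext ω
    rw [trace_pow_eq, ← Complex.ofReal_sum, Complex.ofReal_re]
  rw [h]
  exact Complex.measurable_re.comp (Finset.measurable_sum _ fun i _ => hpow k i i)

theorem IsRandomHerm.measurable_sum_polynomial {Ω : Type*} [MeasurableSpace Ω] {n : ℕ}
    {X : Ω → Herm n} (hX : IsRandomHerm X) (p : Polynomial ℝ) :
    Measurable fun ω => ∑ i, p.eval (eigs (X ω) i) := by
  have h : (fun ω => ∑ i, p.eval (eigs (X ω) i)) = fun ω =>
      ∑ k ∈ Finset.range (p.natDegree + 1), p.coeff k * ∑ i, eigs (X ω) i ^ k := by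
    funext ω
    simp only [Polynomial.eval_eq_sum_range, Finset.mul_sum]
    exact Finset.sum_comm
  rw [h]
  exact Finset.measurable_sum _ fun k _ => (hX.measurable_sum_pow k).const_mul _

theorem IsRandomHerm.measurable_sum_continuous {Ω : Type*} [MeasurableSpace Ω] {n : ℕ}
    {X : Ω → Herm n} (hX : IsRandomHerm X) {f : ℝ → ℝ} (hf : Continuous f) :
    Measurable fun ω => ∑ i, f (eigs (X ω) i) := by
  choose p hp using fun k : ℕ => exists_polynomial_near_of_continuousOn (-(k : ℝ)) k f
    hf.continuousOn (1 / ((k : ℝ) + 1)) (by positivity)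
  refine measurable_of_tendsto_metrizable (fun k => hX.measurable_sum_polynomial (p k)) ?_
  rw [tendsto_pi_nhds]
  intro ω
  refine tendsto_finsetSum _ fun i _ => ?_
  rw [tendsto_iff_dist_tendsto_zero]
  refine squeeze_zero' (Eventually.of_forall fun _ => dist_nonneg) ?_
    tendsto_one_div_add_atTop_nhds_zero_nat
  filter_upwards [eventually_ge_atTop ⌈|eigs (X ω) i|⌉₊] with k hk
  rw [Real.dist_eq]
  exact (hp k _ (abs_le.mp ((Nat.le_ceil _).trans (by exact_mod_cast hk)))).le

/-- The empirical spectral distribution of a random Hermitian matrix is a random measure. -/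
theorem IsRandomHerm.measurable_esd {Ω : Type*} [MeasurableSpace Ω] {n : ℕ} [NeZero n]
    {X : Ω → Herm n} (hX : IsRandomHerm X) :
    Measurable fun ω => (esd (X ω) : Measure ℝ) := by
  refine Measurable.measure_of_isPiSystem_of_isProbabilityMeasure
    (borel_eq_generateFrom_Iic ℝ) isPiSystem_Iic ?_
  rintro s ⟨t, rfl⟩
  have hcont : ∀ k : ℕ, Continuous fun x : ℝ => max 0 (1 - ((k : ℝ) + 1) * max 0 (x - t)) := by
    intro k; fun_prop
  have hlim : Measurable fun ω => ∑ i, (Set.Iic t).indicator (fun _ => (1 : ℝ)) (eigs (X ω) i) := by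
    refine measurable_of_tendsto_metrizable
      (fun k : ℕ => hX.measurable_sum_continuous (hcont k)) ?_
    rw [tendsto_pi_nhds]
    intro ω
    refine tendsto_finsetSum _ fun i _ => ?_
    generalize eigs (X ω) i = x
    by_cases hx : x ≤ t
    · simp [hx]
    · push Not at hx
      have h0 : max 0 (x - t) = x - t := max_eq_right (by linarith)
      have h1 : (Set.Iic t).indicator (fun _ => (1 : ℝ)) x = 0 := by simp [hx]
      rw [h0, h1]
      refine tendsto_const_nhds.congr' ?_
      filter_upwards [eventually_ge_atTop ⌈1 / (x - t)⌉₊] with k hk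
      have hpos : 0 < x - t := by linarith
      have h2 : 1 / (x - t) ≤ (k : ℝ) + 1 :=
        (Nat.le_ceil _).trans (by exact_mod_cast hk.trans (Nat.le_succ k))
      rw [div_le_iff₀ hpos] at h2
      exact (max_eq_left (by linarith)).symm
  have heq : (fun ω => (esd (X ω) : Measure ℝ) (Set.Iic t)) = fun ω => (n : ℝ≥0∞)⁻¹ *
      ENNReal.ofReal (∑ i, (Set.Iic t).indicator (fun _ => (1 : ℝ)) (eigs (X ω) i)) := by
    funext ω
    simp only [esd, ProbabilityMeasure.coe_mk, Measure.smul_apply, Measure.finsetSum_apply,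
      smul_eq_mul]
    rw [ENNReal.ofReal_sum_of_nonneg
      (fun i _ => Set.indicator_nonneg (fun _ _ => zero_le_one) _)]
    congr 1
    refine Finset.sum_congr rfl fun i _ => ?_
    rw [Measure.dirac_apply' _ measurableSet_Iic]
    by_cases hx : eigs (X ω) i ≤ t <;> simp [Set.indicator, hx]
  rw [heq]
  exact (ENNReal.measurable_ofReal.comp hlim).const_mul _

/-- The mean `𝔼 L` of the empirical spectral distribution of a random Hermitian matrix,
the probability measure with `(𝔼 L)(A) = 𝔼 (L(A))` for every Borel set `A`. -/
def meanEsd {Ω : Type*} [MeasurableSpace Ω] (P : Measure Ω) [IsProbabilityMeasure P]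
    {n : ℕ} [NeZero n] (X : Ω → Herm n) (hX : IsRandomHerm X) : ProbabilityMeasure ℝ :=
  ⟨P.bind fun ω => (esd (X ω) : Measure ℝ), ⟨by
    rw [Measure.bind_apply MeasurableSet.univ hX.measurable_esd.aemeasurable]
    simp⟩⟩

theorem meanEsd_apply {Ω : Type*} [MeasurableSpace Ω] (P : Measure Ω) [IsProbabilityMeasure P]
    {n : ℕ} [NeZero n] (X : Ω → Herm n) (hX : IsRandomHerm X) {A : Set ℝ} (hA : MeasurableSet A) :
    (meanEsd P X hX : Measure ℝ) A = ∫⁻ ω, (esd (X ω) : Measure ℝ) A ∂P :=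
  Measure.bind_apply hA hX.measurable_esd.aemeasurable

/-- The property `S(d)`: the index set of the entries of the random matrix `X` has a partition
into sets of cardinality at most `d` such that the corresponding subfamilies of the entries are
independent random vectors. -/
def BlockIndep {Ω : Type*} [MeasurableSpace Ω] (P : Measure Ω) {n m : ℕ}
    (X : Ω → Matrix (Fin n) (Fin m) ℂ) (d : ℕ) : Prop :=
  ∃ Q : Finpartition (Finset.univ : Finset (Fin n × Fin m)),
    (∀ B ∈ Q.parts, B.card ≤ d) ∧
    iIndepFun (fun (B : Q.parts) (ω : Ω) (p : B.1) => X ω p.1.1 p.1.2) P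

/-- The random variable `x` is in the domain of attraction of the Gaussian distribution:
for some sequence `c`, the laws of `(x₁ + ⋯ + xₙ) / cₙ` converge weakly to `N(0, 1)`, where
`x₁, x₂, …` are i.i.d. copies of `x` (realized as the copies of `x` on the coordinates of the
countable power of the probability space). -/
def InGaussianDomain {Ω : Type*} [MeasurableSpace Ω] (P : Measure Ω) [IsProbabilityMeasure P]
    (x : Ω → ℝ) : Prop :=
  ∃ c : ℕ → ℝ, TendstoInDistribution
    (fun (n : ℕ) (ω : ℕ → Ω) => (∑ i ∈ Finset.range n, x (ω i)) / c n) atTop (id : ℝ → ℝ)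
    (fun _ => Measure.infinitePi fun _ : ℕ => P) (gaussianReal 0 1)

/-- The truncated second moment `l(t) = 𝔼 x² 1{|x| ≤ t}`. -/
def truncMoment {Ω : Type*} [MeasurableSpace Ω] (P : Measure Ω) (x : Ω → ℝ) (t : ℝ) : ℝ :=
  ∫ ω, {ω | |x ω| ≤ t}.indicator (fun ω => x ω ^ 2) ω ∂P

/-- `b = inf {t > 0 : l(t) > 0}`. -/
def lowerEdge {Ω : Type*} [MeasurableSpace Ω] (P : Measure Ω) (x : Ω → ℝ) : ℝ :=
  sInf {t : ℝ | 0 < t ∧ 0 < truncMoment P x t}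

/-- `bₙ = inf {t > b + 1 : n l(t) ≤ t²}`. -/
def normSeq {Ω : Type*} [MeasurableSpace Ω] (P : Measure Ω) (x : Ω → ℝ) (n : ℕ) : ℝ :=
  sInf {t : ℝ | lowerEdge P x + 1 < t ∧ n * truncMoment P x t ≤ t ^ 2}

/-- `d` is a metric on the set of Borel probability measures on `ℝ` which metrizes
weak convergence. -/
structure MetrizesWeakConvergence
    (d : ProbabilityMeasure ℝ → ProbabilityMeasure ℝ → ℝ) : Prop where
  eq_zero_iff : ∀ μ ν, d μ ν = 0 ↔ μ = ν
  symm : ∀ μ ν, d μ ν = d ν μ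
  triangle : ∀ μ ν ρ, d μ ρ ≤ d μ ν + d ν ρ
  tendsto_iff : ∀ (μs : ℕ → ProbabilityMeasure ℝ) (μ : ProbabilityMeasure ℝ),
    Tendsto (fun k => d (μs k) μ) atTop (𝓝 0) ↔ Tendsto μs atTop (𝓝 μ)

end HeavyTails

end

/-! Weak convergence on ℝ is tested on ramps with rational ends, and a ramp is a difference of two
hinges `(s - a)⁺`, which are convex. By Klein's inequality the trace of a hinge has at every
Hermitian matrix a subgradient of Frobenius norm at most √n. If all entries are truncated at level
T, resampling one block lowers the normalized trace by at most `2T/n` times the ℓ¹ norm of the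
subgradient on that block. One subgradient serves all blocks, so Cauchy–Schwarz and the one-sided
Efron–Stein inequality bound the variance by `4T²d/n`. For `d = O(n)` and T = δ this is O(δ²): it
does not vanish as n grows, but it is small with δ.

Truncating `X/b_n` at δ changes few entries. Altering k entries is a perturbation of rank at most k,
so by interlacing it moves a ramp mean by at most k/n; the expected cost is `n P(|x| > δ b_n)`. This
tends to 0 because `n l(b_n) ≤ b_n²` and, in the Gaussian domain of attraction, `t² P(|x| > t) =
o(l(t))`.

The latter relation is extracted from characteristic functions. Put V(u) = 𝔼(1 - cos ux). Infinite
variance gives `1 - |φ|² ~ 2V` at 0, hence `n V(u/c_n) → u²/2`. A quadratic limit is annihilated by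
`4V(u) - V(2u) = 2 𝔼(1 - cos ux)²`, and the integral of this quantity over u dominates the tail of x
at `c_n`, whereas `n l(c_n)/c_n²` stays bounded below.

The mean spectral distributions are tight, by Chebyshev for the matrix truncated at level 1 and the
same rank argument. On a tight family finitely many ramps control the metric, and Markov's
inequality concludes. The carrying lemmas are `InGaussianDomain.eventually_sq_mul_tail_le`,
`efronStein`, `exists_trace_subgradient`, `card_eigs_gt_le` and
`MetrizesWeakConvergence.exists_ramp_control`. -/

set_option linter.unusedSectionVars false

noncomputable section

namespace HeavyTails

/-! ### Characteristic function near the origin under infinite variance -/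

section Charfun

variable {Ω : Type*} [MeasurableSpace Ω] {P : Measure Ω} [IsProbabilityMeasure P] {x : Ω → ℝ}

/-- The quantity `𝔼 (1 - cos (u x))`. -/
def cosDefect (P : Measure Ω) (x : Ω → ℝ) (u : ℝ) : ℝ := ∫ ω, (1 - Real.cos (u * x ω)) ∂P

/-- The quantity `𝔼 sin (u x)`. -/
def sinMean (P : Measure Ω) (x : Ω → ℝ) (u : ℝ) : ℝ := ∫ ω, Real.sin (u * x ω) ∂P

theorem integrable_of_abs_le {f : Ω → ℝ} (hf : Measurable f) (C : ℝ) (h : ∀ ω, |f ω| ≤ C) :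
    Integrable f P :=
  Integrable.of_bound hf.aestronglyMeasurable C (ae_of_all _ h)

/-- Cauchy–Schwarz, from the discriminant of the nonnegative quadratic `t ↦ ∫ (f - t g)²`. -/
theorem integral_mul_sq_le {f g : Ω → ℝ} (hf : Measurable f) (hg : Measurable g) {C : ℝ}
    (hfC : ∀ ω, |f ω| ≤ C) (hgC : ∀ ω, |g ω| ≤ C) :
    (∫ ω, f ω * g ω ∂P) ^ 2 ≤ (∫ ω, f ω ^ 2 ∂P) * ∫ ω, g ω ^ 2 ∂P := by
  have hC : ∀ ω, 0 ≤ C := fun ω => (abs_nonneg _).trans (hfC ω)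
  have bd : ∀ a b : ℝ, |a| ≤ C → |b| ≤ C → |a * b| ≤ C * C := fun a b ha hb => by
    rw [abs_mul]; exact mul_le_mul ha hb (abs_nonneg _) ((abs_nonneg _).trans ha)
  have hff : Integrable (fun ω => f ω ^ 2) P := integrable_of_abs_le (hf.pow_const 2) (C * C)
    fun ω => by rw [sq]; exact bd _ _ (hfC ω) (hfC ω)
  have hgg : Integrable (fun ω => g ω ^ 2) P := integrable_of_abs_le (hg.pow_const 2) (C * C)
    fun ω => by rw [sq]; exact bd _ _ (hgC ω) (hgC ω)
  have hfg : Integrable (fun ω => f ω * g ω) P := integrable_of_abs_le (hf.mul hg) (C * C)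
    fun ω => bd _ _ (hfC ω) (hgC ω)
  have key : ∀ t : ℝ, 0 ≤ (∫ ω, g ω ^ 2 ∂P) * (t * t) + (-2 * ∫ ω, f ω * g ω ∂P) * t +
      ∫ ω, f ω ^ 2 ∂P := by
    intro t
    have : (∫ ω, g ω ^ 2 ∂P) * (t * t) + (-2 * ∫ ω, f ω * g ω ∂P) * t + ∫ ω, f ω ^ 2 ∂P =
        ∫ ω, (f ω - t * g ω) ^ 2 ∂P := by
      have h1 : ∀ ω, (f ω - t * g ω) ^ 2 = (t * t) * g ω ^ 2 + (-2 * t) * (f ω * g ω) + f ω ^ 2 :=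
        fun ω => by ring
      simp_rw [h1]
      have h2 : Integrable (fun ω => (t * t) * g ω ^ 2 + (-2 * t) * (f ω * g ω)) P :=
        (hgg.const_mul _).add (hfg.const_mul _)
      rw [integral_add h2 hff, integral_add (hgg.const_mul _) (hfg.const_mul _),
        integral_const_mul, integral_const_mul]
      ring
    rw [this]
    exact integral_nonneg fun ω => sq_nonneg _
  have := discrim_le_zero key
  rw [discrim] at this
  nlinarith

theorem integrable_cos (hx : Measurable x) (u : ℝ) :
    Integrable (fun ω => Real.cos (u * x ω)) P :=
  integrable_of_abs_le (by fun_prop) 1 fun _ => Real.abs_cos_le_one _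

theorem integrable_sin (hx : Measurable x) (u : ℝ) :
    Integrable (fun ω => Real.sin (u * x ω)) P :=
  integrable_of_abs_le (by fun_prop) 1 fun _ => Real.abs_sin_le_one _

theorem integrable_one_sub_cos (hx : Measurable x) (u : ℝ) :
    Integrable (fun ω => 1 - Real.cos (u * x ω)) P :=
  (integrable_const _).sub (integrable_cos hx u)

theorem integrable_one_sub_cos_sq (hx : Measurable x) (u : ℝ) :
    Integrable (fun ω => (1 - Real.cos (u * x ω)) ^ 2) P :=
  integrable_of_abs_le (by fun_prop) 4 fun ω => by
    have := Real.neg_one_le_cos (u * x ω); have := Real.cos_le_one (u * x ω)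
    rw [abs_le]; constructor <;> nlinarith

theorem cosDefect_nonneg (u : ℝ) : 0 ≤ cosDefect P x u :=
  integral_nonneg fun _ => sub_nonneg.2 (Real.cos_le_one _)

theorem cosDefect_zero : cosDefect P x 0 = 0 := by simp [cosDefect]

/-- Integrated form of `1 - cos 2θ = 4(1 - cos θ) - 2(1 - cos θ)²`. The deviation of the defect from
exact quadratic scaling is a nonnegative quantity, which later detects the tail of `x`. -/
theorem cosDefect_two_mul (hx : Measurable x) (u : ℝ) :
    4 * cosDefect P x u - cosDefect P x (2 * u) = 2 * ∫ ω, (1 - Real.cos (u * x ω)) ^ 2 ∂P := by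
  have h : ∀ ω, 1 - Real.cos (2 * u * x ω) =
      4 * (1 - Real.cos (u * x ω)) - 2 * (1 - Real.cos (u * x ω)) ^ 2 := fun ω => by
    rw [mul_assoc, Real.cos_two_mul]; ring
  simp only [cosDefect]
  simp_rw [h]
  rw [integral_sub ((integrable_one_sub_cos hx u).const_mul _)
    ((integrable_one_sub_cos_sq hx u).const_mul _), integral_const_mul, integral_const_mul]
  ring

theorem cosDefect_two_mul_le (hx : Measurable x) (u : ℝ) :
    cosDefect P x (2 * u) ≤ 4 * cosDefect P x u := by
  have := cosDefect_two_mul (P := P) hx u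
  have h2 : 0 ≤ ∫ ω, (1 - Real.cos (u * x ω)) ^ 2 ∂P := integral_nonneg fun ω => sq_nonneg _
  linarith

theorem cosDefect_continuous (hx : Measurable x) : Continuous (cosDefect P x) := by
  refine continuous_of_dominated (bound := fun _ => 2) ?_ ?_ (integrable_const _) ?_
  · exact fun u => (integrable_one_sub_cos hx u).aestronglyMeasurable
  · refine fun u => ae_of_all _ fun ω => ?_
    rw [Real.norm_eq_abs, abs_le]
    constructor <;> linarith [Real.neg_one_le_cos (u * x ω), Real.cos_le_one (u * x ω)]
  · exact ae_of_all _ fun ω => by fun_prop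

theorem charFun_map_eq (hx : Measurable x) (u : ℝ) :
    charFun (P.map x) u = ((1 - cosDefect P x u : ℝ) : ℂ) + (sinMean P x u : ℂ) * Complex.I := by
  rw [charFun_apply_real, integral_map hx.aemeasurable (by fun_prop)]
  have h : ∀ ω, Complex.exp (u * x ω * Complex.I) =
      ((Real.cos (u * x ω) : ℝ) : ℂ) + ((Real.sin (u * x ω) : ℝ) : ℂ) * Complex.I := fun ω => by
    rw [Complex.exp_mul_I]; push_cast; rfl
  simp_rw [h]
  rw [integral_add (integrable_cos hx u).ofReal ((integrable_sin hx u).ofReal.mul_const _),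
    integral_mul_const, integral_complex_ofReal, integral_complex_ofReal]
  congr 3
  simp only [cosDefect]
  rw [integral_sub (integrable_const _) (integrable_cos hx u)]
  simp

theorem normSq_charFun_map (hx : Measurable x) (u : ℝ) :
    ‖charFun (P.map x) u‖ ^ 2 = (1 - cosDefect P x u) ^ 2 + sinMean P x u ^ 2 := by
  rw [charFun_map_eq hx, ← Complex.normSq_eq_norm_sq, Complex.normSq_add_mul_I]

/-- The quantity `1 - |φ(u)|²` for the characteristic function `φ` of `x`. -/
def charDefect (P : Measure Ω) (x : Ω → ℝ) (u : ℝ) : ℝ := 1 - ‖charFun (P.map x) u‖ ^ 2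

theorem charDefect_eq (hx : Measurable x) (u : ℝ) :
    charDefect P x u = 2 * cosDefect P x u - cosDefect P x u ^ 2 - sinMean P x u ^ 2 := by
  rw [charDefect, normSq_charFun_map hx]; ring

theorem charDefect_nonneg (hx : Measurable x) (u : ℝ) : 0 ≤ charDefect P x u := by
  have := Measure.isProbabilityMeasure_map (μ := P) hx.aemeasurable
  have h := norm_charFun_le_one (μ := P.map x) u
  rw [charDefect]
  nlinarith [norm_nonneg (charFun (P.map x) u)]

theorem integrable_trunc (hx : Measurable x) (t : ℝ) :
    Integrable ({ω | |x ω| ≤ t}.indicator (fun ω => x ω ^ 2)) P := by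
  refine integrable_of_abs_le ((hx.pow_const 2).indicator
    (measurableSet_le hx.abs measurable_const)) (t ^ 2) fun ω => ?_
  by_cases h : |x ω| ≤ t
  · rw [Set.indicator_of_mem (by exact h), abs_of_nonneg (sq_nonneg _), ← sq_abs]
    exact pow_le_pow_left₀ (abs_nonneg _) h 2
  · rw [Set.indicator_of_notMem (by exact h), abs_zero]; positivity

/-- Use `1 - cos θ ≤ θ²/2` where `|x| ≤ t` and `1 - cos θ ≤ 2` elsewhere. Read backwards, this
bounds the truncated moment from below. -/
theorem cosDefect_le (hx : Measurable x) (u t : ℝ) :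
    cosDefect P x u ≤ u ^ 2 / 2 * truncMoment P x t + 2 * P.real {ω | t < |x ω|} := by
  have hs' : MeasurableSet {ω | t < |x ω|} := measurableSet_lt measurable_const hx.abs
  have h1 := integrable_trunc (P := P) hx t
  have h2 : Integrable ({ω | t < |x ω|}.indicator (fun _ => (1 : ℝ))) P :=
    (integrable_const _).indicator hs'
  rw [truncMoment, ← integral_indicator_one hs', ← integral_const_mul, ← integral_const_mul,
    cosDefect]
  have h2' : Integrable ({ω | t < |x ω|}.indicator (1 : Ω → ℝ)) P := h2
  rw [← integral_add (h1.const_mul _) (h2'.const_mul _)]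
  refine integral_mono (integrable_one_sub_cos hx u) ((h1.const_mul _).add (h2'.const_mul _))
    fun ω => ?_
  by_cases h : |x ω| ≤ t
  · have h' : ¬ t < |x ω| := not_lt.2 h
    simp only [Set.indicator, Set.mem_ofPred_eq, h, h', if_true, if_false]
    have := Real.one_sub_sq_div_two_le_cos (x := u * x ω)
    nlinarith
  · have h' : t < |x ω| := not_le.1 h
    simp only [Set.indicator, Set.mem_ofPred_eq, h, h', if_true, if_false]
    have := Real.neg_one_le_cos (u * x ω)
    simp only [Pi.one_apply]; linarith

theorem truncMoment_nonneg (t : ℝ) : 0 ≤ truncMoment P x t :=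
  integral_nonneg fun _ => Set.indicator_nonneg (fun _ _ => sq_nonneg _) _

theorem truncMoment_mono (hx : Measurable x) : Monotone (truncMoment P x) := by
  intro s t hst
  refine integral_mono (integrable_trunc hx s) (integrable_trunc hx t) fun ω => ?_
  exact Set.indicator_le_indicator_of_subset (fun ω (h : |x ω| ≤ s) => h.trans hst)
    (fun _ => sq_nonneg _) ω

/-- Monotone convergence: bounded truncated moments would make the second moment finite. -/
theorem exists_lt_truncMoment (hx : Measurable x) (hinf : ∫⁻ ω, ENNReal.ofReal (x ω ^ 2) ∂P = ∞)
    (K : ℝ) : ∃ t, 0 < t ∧ K < truncMoment P x t := by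
  by_contra! hK
  have h1 : ∀ k : ℕ, ∫⁻ ω, ENNReal.ofReal ({ω | |x ω| ≤ (k : ℝ) + 1}.indicator
      (fun ω => x ω ^ 2) ω) ∂P ≤ ENNReal.ofReal K := fun k => by
    rw [← ofReal_integral_eq_lintegral_ofReal (integrable_trunc hx _)
      (ae_of_all _ fun ω => Set.indicator_nonneg (fun _ _ => sq_nonneg _) _)]
    exact ENNReal.ofReal_le_ofReal (hK _ (by positivity))
  have h2 : Tendsto (fun k : ℕ => ∫⁻ ω, ENNReal.ofReal ({ω | |x ω| ≤ (k : ℝ) + 1}.indicator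
      (fun ω => x ω ^ 2) ω) ∂P) atTop (𝓝 (∫⁻ ω, ENNReal.ofReal (x ω ^ 2) ∂P)) := by
    refine lintegral_tendsto_of_tendsto_of_monotone ?_ ?_ ?_
    · exact fun k => ((hx.pow_const 2).indicator
        (measurableSet_le hx.abs measurable_const)).ennreal_ofReal.aemeasurable
    · refine ae_of_all _ fun ω k m hkm => ENNReal.ofReal_le_ofReal ?_
      exact Set.indicator_le_indicator_of_subset
        (fun ω (h : |x ω| ≤ k + 1) => h.trans (by gcongr)) (fun _ => sq_nonneg _) ω
    · refine ae_of_all _ fun ω => tendsto_const_nhds.congr' ?_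
      filter_upwards [eventually_ge_atTop ⌈|x ω|⌉₊] with k hk
      rw [Set.indicator_of_mem]
      exact ((Nat.le_ceil _).trans (by exact_mod_cast hk : _ ≤ (k : ℝ))).trans (by linarith)
  rw [hinf] at h2
  exact absurd (le_of_tendsto' h2 h1) (by simp)

theorem tendsto_tail_zero (hx : Measurable x) :
    Tendsto (fun t : ℝ => P.real {ω | t < |x ω|}) atTop (𝓝 0) := by
  have h : Tendsto (fun t : ℝ => P {ω | t < |x ω|}) atTop (𝓝 (P (⋂ t : ℝ, {ω | t < |x ω|}))) := by
    refine tendsto_measure_iInter_atTop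
      (fun t => (measurableSet_lt measurable_const hx.abs).nullMeasurableSet) ?_
      ⟨0, measure_ne_top _ _⟩
    exact fun s t hst ω (h : t < |x ω|) => lt_of_le_of_lt hst h
  have h0 : (⋂ t : ℝ, {ω | t < |x ω|}) = ∅ := by
    ext ω; simp only [Set.mem_iInter, Set.mem_ofPred_eq, Set.mem_empty_iff_false, iff_false]
    exact fun h => lt_irrefl _ (h |x ω|)
  rw [h0, measure_empty] at h
  exact (ENNReal.tendsto_toReal ENNReal.zero_ne_top).comp h

/-- In other words `u² = o(V(u))`. Where `|x| ≤ M` and `|u| M ≤ 1`, the bound `1 - cos θ ≥ 2θ²/π² ≥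
θ²/5` applies, and the truncated moment at M can be made larger than 5K. -/
theorem eventually_mul_sq_le_cosDefect (hx : Measurable x)
    (hinf : ∫⁻ ω, ENNReal.ofReal (x ω ^ 2) ∂P = ∞) (K : ℝ) :
    ∀ᶠ u in 𝓝 (0 : ℝ), K * u ^ 2 ≤ cosDefect P x u := by
  obtain ⟨M, hM, hK⟩ := exists_lt_truncMoment hx hinf (5 * K)
  filter_upwards [Metric.ball_mem_nhds (0 : ℝ) (inv_pos.2 hM)] with u hu
  rw [Metric.mem_ball, dist_zero_right, Real.norm_eq_abs] at hu
  have huM : |u| * M ≤ 1 := by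
    have := mul_lt_mul_of_pos_right hu hM
    rw [inv_mul_cancel₀ hM.ne'] at this
    exact this.le
  have h1 : u ^ 2 / 5 * truncMoment P x M ≤ cosDefect P x u := by
    rw [truncMoment, ← integral_const_mul]
    refine integral_mono ((integrable_trunc hx M).const_mul _) (integrable_one_sub_cos hx u)
      fun ω => ?_
    by_cases h : |x ω| ≤ M
    · simp only [Set.indicator, Set.mem_ofPred_eq, h, if_true]
      have hux : |u * x ω| ≤ 1 := by
        rw [abs_mul]
        exact (mul_le_mul_of_nonneg_left h (abs_nonneg u)).trans huM
      have h3 := Real.cos_le_one_sub_mul_cos_sq (x := u * x ω)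
        (hux.trans (by linarith [Real.pi_gt_three]))
      have h4 : (1 : ℝ) / 5 ≤ 2 / Real.pi ^ 2 := by
        rw [div_le_div_iff₀ (by norm_num) (by positivity)]
        nlinarith [Real.pi_lt_d2, Real.pi_pos]
      nlinarith [mul_le_mul_of_nonneg_right h4 (sq_nonneg (u * x ω))]
    · simp only [Set.indicator, Set.mem_ofPred_eq, h, if_false, mul_zero]
      linarith [Real.cos_le_one (u * x ω)]
  nlinarith [mul_le_mul_of_nonneg_left hK.le (sq_nonneg u)]

/-- Split at `|x| = M`. The bounded part contributes at most `|u| M`, whose square is o(V). By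
Cauchy–Schwarz the square of the rest is at most `P(|x| > M) · 𝔼 sin²`, where `𝔼 sin² ≤ 2V` and the
probability is small. -/
theorem eventually_sinMean_sq_le (hx : Measurable x)
    (hinf : ∫⁻ ω, ENNReal.ofReal (x ω ^ 2) ∂P = ∞) {ε : ℝ} (hε : 0 < ε) :
    ∀ᶠ u in 𝓝 (0 : ℝ), sinMean P x u ^ 2 ≤ ε * cosDefect P x u := by
  obtain ⟨M, hM0, hM⟩ := ((eventually_ge_atTop (0 : ℝ)).and
    ((tendsto_tail_zero (P := P) hx).eventually (ge_mem_nhds (show 0 < ε / 8 by positivity)))).exists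
  filter_upwards [eventually_mul_sq_le_cosDefect hx hinf (4 * M ^ 2 / ε)] with u hu
  have hs' : MeasurableSet {ω | M < |x ω|} := measurableSet_lt measurable_const hx.abs
  set g : Ω → ℝ := {ω | M < |x ω|}.indicator 1 with hg
  have hgm : Measurable g := measurable_one.indicator hs'
  have hg1 : ∀ ω, |g ω| ≤ 1 := fun ω => by
    simp only [hg, Set.indicator]; split_ifs <;> simp
  have hsm : Measurable fun ω => Real.sin (u * x ω) := by fun_prop
  have hcs := integral_mul_sq_le (P := P) (f := g) hgm hsm hg1
    fun ω => Real.abs_sin_le_one (u * x ω)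
  have hgg : ∫ ω, g ω ^ 2 ∂P = P.real {ω | M < |x ω|} := by
    rw [← integral_indicator_one hs']
    refine integral_congr_ae (ae_of_all _ fun ω => ?_)
    simp only [hg, Set.indicator]; split_ifs <;> simp
  have hss : ∫ ω, Real.sin (u * x ω) ^ 2 ∂P ≤ 2 * cosDefect P x u := by
    rw [cosDefect, ← integral_const_mul]
    refine integral_mono (integrable_of_abs_le (hsm.pow_const 2) 1 fun ω => ?_)
      ((integrable_one_sub_cos hx u).const_mul _) fun ω => ?_
    · rw [abs_of_nonneg (sq_nonneg _)]; exact Real.sin_sq_le_one _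
    · have := Real.sin_sq_add_cos_sq (u * x ω)
      have := Real.cos_le_one (u * x ω)
      have := Real.neg_one_le_cos (u * x ω)
      simp only; nlinarith
  have hgs : Integrable (fun ω => g ω * Real.sin (u * x ω)) P :=
    integrable_of_abs_le (hgm.mul hsm) 1 fun ω => by
      rw [abs_mul]; exact mul_le_one₀ (hg1 ω) (abs_nonneg _) (Real.abs_sin_le_one _)
  have hdiff : |sinMean P x u - ∫ ω, g ω * Real.sin (u * x ω) ∂P| ≤ |u| * M := by
    rw [sinMean, ← integral_sub (integrable_sin hx u) hgs, ← Real.norm_eq_abs]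
    refine (norm_integral_le_of_norm_le_const (C := |u| * M) (ae_of_all _ fun ω => ?_)).trans
      (by simp)
    rw [Real.norm_eq_abs]
    by_cases h : M < |x ω|
    · simp only [hg, Set.indicator, Set.mem_ofPred_eq, h, if_true, Pi.one_apply, one_mul, sub_self,
        abs_zero]
      positivity
    · simp only [hg, Set.indicator, Set.mem_ofPred_eq, h, if_false, zero_mul, sub_zero]
      refine Real.abs_sin_le_abs.trans ?_
      rw [abs_mul]
      exact mul_le_mul_of_nonneg_left (not_lt.1 h) (abs_nonneg _)
  set A := ∫ ω, g ω * Real.sin (u * x ω) ∂P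
  have hV := cosDefect_nonneg (P := P) (x := x) u
  have hA : A ^ 2 ≤ ε / 8 * (2 * cosDefect P x u) := by
    refine hcs.trans ?_
    rw [hgg]
    exact mul_le_mul hM hss (integral_nonneg fun _ => sq_nonneg _) (by positivity)
  have hu' : 4 * M ^ 2 * u ^ 2 ≤ ε * cosDefect P x u := by
    have := mul_le_mul_of_nonneg_left hu hε.le
    have h2 : ε * (4 * M ^ 2 / ε * u ^ 2) = 4 * M ^ 2 * u ^ 2 := by field_simp
    linarith
  have hd2 : (sinMean P x u - A) ^ 2 ≤ u ^ 2 * M ^ 2 := by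
    rw [← sq_abs, ← sq_abs u, ← mul_pow]
    exact pow_le_pow_left₀ (abs_nonneg _) hdiff 2
  -- This is `S² ≤ 2A² + 2(S - A)²`; the constants ε/8 and 4M²/ε make each term at most εV/2.
  nlinarith [sq_nonneg (sinMean P x u - 2 * A)]

/-- The modulus of φ is what the limit theorem controls, V is what the tail estimate needs. They are
linked by `1 - |φ|² = 2V - V² - S²`, where S = 𝔼 sin ux, and both squares are o(V). -/
theorem eventually_charDefect (hx : Measurable x)
    (hinf : ∫⁻ ω, ENNReal.ofReal (x ω ^ 2) ∂P = ∞) {ε : ℝ} (hε : 0 < ε) :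
    ∀ᶠ u in 𝓝 (0 : ℝ), (2 - ε) * cosDefect P x u ≤ charDefect P x u ∧
      charDefect P x u ≤ 2 * cosDefect P x u := by
  have h0 : Tendsto (cosDefect P x) (𝓝 0) (𝓝 0) := by
    have := (cosDefect_continuous (P := P) hx).tendsto 0
    rwa [cosDefect_zero] at this
  filter_upwards [eventually_sinMean_sq_le hx hinf (half_pos hε),
    h0.eventually (ge_mem_nhds (half_pos hε))] with u h1 h2
  rw [charDefect_eq hx]
  have := cosDefect_nonneg (P := P) (x := x) u
  constructor <;> nlinarith [sq_nonneg (sinMean P x u)]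

end Charfun

/-! ### Tail against truncated moment in the Gaussian domain of attraction -/

section Domain

variable {Ω : Type*} [MeasurableSpace Ω] {P : Measure Ω} [IsProbabilityMeasure P] {x : Ω → ℝ}

theorem charFun_scaled_sum (hx : Measurable x) (c : ℝ) (n : ℕ) (u : ℝ) :
    charFun ((Measure.infinitePi fun _ : ℕ => P).map
      fun ω : ℕ → Ω => (∑ i ∈ Finset.range n, x (ω i)) / c) u =
      charFun (P.map x) (u / c) ^ n := by
  have hind : iIndepFun (fun (i : ℕ) (ω : ℕ → Ω) => x (ω i))
      (Measure.infinitePi fun _ : ℕ => P) :=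
    iIndepFun_infinitePi (X := fun _ => x) fun _ => hx
  have hm : ∀ i : ℕ, Measurable fun ω : ℕ → Ω => x (ω i) :=
    fun i => hx.comp (measurable_pi_apply i)
  have h1 : (fun ω : ℕ → Ω => (∑ i ∈ Finset.range n, x (ω i)) / c) =
      fun ω => c⁻¹ * ∑ i ∈ Finset.range n, x (ω i) := by
    funext ω; rw [div_eq_inv_mul]
  have h2 : ∀ i : ℕ, (Measure.infinitePi fun _ : ℕ => P).map (fun ω : ℕ → Ω => x (ω i)) =
      P.map x := fun i => by
    have := Measure.map_map (μ := Measure.infinitePi fun _ : ℕ => P) hx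
      (measurable_pi_apply (X := fun _ : ℕ => Ω) i)
    rw [show (Measure.infinitePi fun _ : ℕ => P).map (fun ω : ℕ → Ω => ω i) = P from
      Measure.infinitePi_map_eval _ i] at this
    exact this.symm
  rw [h1, charFun_map_mul_comp (Finset.measurable_fun_sum _ fun i _ => hm i).aemeasurable,
    (hind.restrict _).charFun_map_fun_finsetSum_eq_prod fun i _ => (hm i).aemeasurable]
  simp [h2, div_eq_inv_mul]

/-- Squaring gives `9/16 ≤ (1 - w)^n ≤ exp(-nw)`, and `1 + nw ≤ exp(nw) ≤ 16/9`. -/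
theorem nat_mul_le_of_le_pow {w q : ℝ} (hw : w = 1 - q ^ 2) {n : ℕ}
    (h : 3 / 4 ≤ q ^ n) : n * w ≤ 2 := by
  have h1 : (9 : ℝ) / 16 ≤ (1 - w) ^ n := by
    have : (1 - w) ^ n = (q ^ n) ^ 2 := by rw [hw]; ring
    rw [this]; nlinarith
  have h2 : (1 - w) ^ n ≤ Real.exp (-(n * w)) := by
    rw [show -(n * w) = n * (-w) by ring, Real.exp_nat_mul]
    refine pow_le_pow_left₀ (by rw [hw]; nlinarith) ?_ n
    linarith [Real.add_one_le_exp (-w)]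
  have h3 := Real.add_one_le_exp (n * w)
  have h4 : Real.exp (n * w) * Real.exp (-(n * w)) = 1 := by rw [← Real.exp_add]; simp
  have h5 := Real.exp_pos (n * w)
  nlinarith [h1.trans h2]

/-- The function `y ↦ min 2 (y² / 8)` as a bounded continuous function. -/
def sqCap : BoundedContinuousFunction ℝ ℝ :=
  BoundedContinuousFunction.ofNormedAddCommGroup (fun y : ℝ => min 2 (y ^ 2 / 8))
    (by fun_prop) 2 fun y => by
      rw [Real.norm_eq_abs, abs_of_nonneg (le_min (by norm_num) (by positivity))]
      exact min_le_left _ _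

theorem integral_sqCap_gaussian_le : ∫ y, sqCap y ∂(gaussianReal 0 1) ≤ 1 / 8 := by
  have hi : Integrable (fun y : ℝ => y ^ 2) (gaussianReal 0 1) := by
    have := (memLp_id_gaussianReal (μ := 0) (v := 1) 2).integrable_sq
    simpa using this
  have h2 : ∫ y, y ^ 2 ∂(gaussianReal 0 1) = 1 := by
    have h := variance_fun_id_gaussianReal (μ := 0) (v := 1)
    rw [variance_eq_integral (by fun_prop)] at h
    simpa using h
  calc ∫ y, sqCap y ∂(gaussianReal 0 1) ≤ ∫ y, y ^ 2 / 8 ∂(gaussianReal 0 1) :=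
        integral_mono (sqCap.integrable _) (hi.div_const 8) fun y => min_le_right _ _
    _ = 1 / 8 := by rw [integral_div, h2]

/-- One bounded continuous test function dominates `1 - cos(uy)` for all `|u| ≤ 1/2`, so weak
convergence yields a bound that is uniform in u. -/
theorem cosDefect_le_integral_sqCap {y : Ω → ℝ} (hy : Measurable y) {u : ℝ} (hu : |u| ≤ 1 / 2) :
    cosDefect P y u ≤ ∫ t, sqCap t ∂(P.map y) := by
  rw [integral_map hy.aemeasurable (by fun_prop), cosDefect]
  refine integral_mono (integrable_one_sub_cos hy u)
    (integrable_of_abs_le (sqCap.continuous.measurable.comp hy) ‖sqCap‖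
      fun ω => sqCap.norm_coe_le_norm _) fun ω => le_min ?_ ?_
  · linarith [Real.neg_one_le_cos (u * y ω)]
  · have h1 := Real.one_sub_sq_div_two_le_cos (x := u * y ω)
    have h2 : u ^ 2 ≤ 1 / 4 := by
      rw [← sq_abs]; nlinarith [abs_nonneg u]
    nlinarith [mul_le_mul_of_nonneg_right h2 (sq_nonneg (y ω))]

theorem InGaussianDomain.exists_norming (hx : Measurable x) (h : InGaussianDomain P x) :
    ∃ c : ℕ → ℝ, (∀ u : ℝ, Tendsto (fun n : ℕ => ‖charFun (P.map x) (u / c n)‖ ^ n) atTop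
        (𝓝 (Real.exp (-(u ^ 2) / 2)))) ∧
      ∀ᶠ n : ℕ in atTop, ∀ u : ℝ, |u| ≤ 1 / 2 → n * charDefect P x (u / c n) ≤ 2 := by
  obtain ⟨c, hc⟩ := h
  have ht := hc.tendsto
  refine ⟨c, fun u => ?_, ?_⟩
  · have h1 := ((ProbabilityMeasure.tendsto_iff_tendsto_charFun.1 ht) u).norm
    simp only [ProbabilityMeasure.coe_mk, charFun_scaled_sum hx, Measure.map_id, norm_pow] at h1
    rw [charFun_gaussianReal] at h1
    convert h1 using 2
    rw [Complex.norm_exp]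
    congr 1
    norm_cast
    simp [neg_div, -Complex.ofReal_pow]
  · have h1 := (ProbabilityMeasure.tendsto_iff_forall_integral_tendsto.1 ht) sqCap
    simp only [ProbabilityMeasure.coe_mk, Measure.map_id] at h1
    -- The Gaussian integral is at most 1/8, so the integrals at index n are eventually below 1/4
    -- and the real part of `φ(u/c_n)^n` is at least 3/4.
    have h2 := h1.eventually (gt_mem_nhds
      (show ∫ y, sqCap y ∂(gaussianReal 0 1) < 1 / 4 from
        integral_sqCap_gaussian_le.trans_lt (by norm_num)))
    filter_upwards [h2] with n hn u hu
    have hm : Measurable fun ω : ℕ → Ω => (∑ i ∈ Finset.range n, x (ω i)) / c n :=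
      (Finset.measurable_fun_sum _ fun i _ => hx.comp (measurable_pi_apply i)).div_const _
    have h3 := cosDefect_le_integral_sqCap (P := Measure.infinitePi fun _ : ℕ => P) hm hu
    have h4 := charFun_map_eq (P := Measure.infinitePi fun _ : ℕ => P) hm u
    rw [charFun_scaled_sum hx] at h4
    have h5 : 3 / 4 ≤ ‖charFun (P.map x) (u / c n)‖ ^ n := by
      rw [← norm_pow]
      refine le_trans ?_ ((le_abs_self _).trans (Complex.abs_re_le_norm _))
      rw [h4]
      simp only [Complex.add_re, Complex.ofReal_re, Complex.mul_re, Complex.I_re, Complex.I_im,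
        Complex.ofReal_im]
      linarith
    exact nat_mul_le_of_le_pow rfl h5

variable {c : ℕ → ℝ}

theorem eventually_norming_ne_zero
    (hc : ∀ u : ℝ, Tendsto (fun n : ℕ => ‖charFun (P.map x) (u / c n)‖ ^ n) atTop
      (𝓝 (Real.exp (-(u ^ 2) / 2)))) (hx : Measurable x) : ∀ᶠ n in atTop, c n ≠ 0 := by
  have := Measure.isProbabilityMeasure_map (μ := P) hx.aemeasurable
  have h := (hc 1).eventually (gt_mem_nhds (show Real.exp (-(1 ^ 2) / 2) < 1 by
    rw [Real.exp_lt_one_iff]; norm_num))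
  filter_upwards [h] with n hn h0
  -- If `c n = 0`, then `1 / c n = 0` by convention and the modulus is 1, against the limit
  -- `exp(-1/2)`.
  simp [h0] at hn

/-- Fix a small `v > 0` with `1 - |φ(v)|² > 0` and `v M ≤ 1/2`. Whenever `|c_n| < M`, the choice `u
= v c_n` in the uniform bound gives `n (1 - |φ(v)|²) ≤ 2`, which fails for large n. -/
theorem tendsto_norming_atTop (hx : Measurable x)
    (hinf : ∫⁻ ω, ENNReal.ofReal (x ω ^ 2) ∂P = ∞)
    (hc : ∀ u : ℝ, Tendsto (fun n : ℕ => ‖charFun (P.map x) (u / c n)‖ ^ n) atTop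
      (𝓝 (Real.exp (-(u ^ 2) / 2))))
    (hb : ∀ᶠ n : ℕ in atTop, ∀ u : ℝ, |u| ≤ 1 / 2 → n * charDefect P x (u / c n) ≤ 2) :
    Tendsto (fun n => |c n|) atTop atTop := by
  refine tendsto_atTop.2 fun M => ?_
  wlog hM : 0 < M generalizing M
  · exact (this 1 one_pos).mono fun n hn => by linarith
  have h1 := (eventually_charDefect (P := P) hx hinf one_pos).and
    (eventually_mul_sq_le_cosDefect (P := P) hx hinf 1)
  obtain ⟨r, hr, h1⟩ := Metric.eventually_nhds_iff.1 h1
  obtain ⟨v, hv0, hv1, hv2⟩ : ∃ v : ℝ, 0 < v ∧ v < r ∧ v * M ≤ 1 / 2 := by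
    refine ⟨min (r / 2) (1 / (2 * M)), by positivity, ?_, ?_⟩
    · exact (min_le_left _ _).trans_lt (by linarith)
    · refine (mul_le_mul_of_nonneg_right (min_le_right _ _) hM.le).trans ?_
      field_simp; rfl
  have hW : 0 < charDefect P x v := by
    obtain ⟨h2, h3⟩ := @h1 v (by rw [dist_zero_right, Real.norm_eq_abs, abs_of_pos hv0]; exact hv1)
    nlinarith [h2.1, pow_pos hv0 2]
  filter_upwards [hb, eventually_norming_ne_zero hc hx,
    eventually_gt_atTop ⌈2 / charDefect P x v⌉₊] with n hn hn0 hn1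
  by_contra! hlt
  have h4 := hn (v * c n) (by
    rw [abs_mul, abs_of_pos hv0]
    exact (mul_le_mul_of_nonneg_left hlt.le hv0.le).trans hv2)
  rw [mul_div_cancel_right₀ _ hn0] at h4
  have h5 : 2 / charDefect P x v < n := (Nat.le_ceil _).trans_lt (by exact_mod_cast hn1)
  rw [div_lt_iff₀ hW] at h5
  linarith

theorem tendsto_div_norming (hct : Tendsto (fun n => |c n|) atTop atTop) (u : ℝ) :
    Tendsto (fun n => u / c n) atTop (𝓝 0) := by
  rw [tendsto_zero_iff_abs_tendsto_zero]
  have : (abs ∘ fun n => u / c n) = fun n => |u| / |c n| := by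
    funext n; simp [abs_div]
  rw [this]
  exact hct.const_div_atTop _

/-- Write W = 1 - |φ|². Then `-n log(1 - W) = -2 log |φ|^n → u²`, and `(1 - W)(-log(1 - W)) ≤ W ≤
-log(1 - W)` with W → 0 removes the logarithm. -/
theorem tendsto_mul_charDefect (hx : Measurable x) (hct : Tendsto (fun n => |c n|) atTop atTop)
    (hc : ∀ u : ℝ, Tendsto (fun n : ℕ => ‖charFun (P.map x) (u / c n)‖ ^ n) atTop
      (𝓝 (Real.exp (-(u ^ 2) / 2)))) (u : ℝ) :
    Tendsto (fun n : ℕ => n * charDefect P x (u / c n)) atTop (𝓝 (u ^ 2)) := by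
  have hW0 : Tendsto (fun n => charDefect P x (u / c n)) atTop (𝓝 0) := by
    have h1 : Continuous (charDefect P x) := by
      have := Measure.isProbabilityMeasure_map (μ := P) hx.aemeasurable
      have : charDefect P x = fun u => 1 - ‖charFun (P.map x) u‖ ^ 2 := rfl
      rw [this]
      have h2 : Continuous (charFun (P.map x)) := continuous_charFun
      fun_prop
    have h2 : charDefect P x 0 = 0 := by simp [charDefect_eq hx, cosDefect_zero, sinMean]
    have := (h1.tendsto 0).comp (tendsto_div_norming hct u)
    rwa [h2] at this
  have hlog : Tendsto (fun n : ℕ => n * (-Real.log (1 - charDefect P x (u / c n)))) atTop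
      (𝓝 (u ^ 2)) := by
    have h1 := ((hc u).log (Real.exp_pos _).ne').const_mul (-2)
    rw [Real.log_exp] at h1
    have e : -2 * (-(u ^ 2) / 2) = u ^ 2 := by ring
    rw [e] at h1
    refine h1.congr fun n => ?_
    rw [charDefect, sub_sub_cancel, Real.log_pow, Real.log_pow]
    push_cast; ring
  have hlow : Tendsto (fun n : ℕ => (1 - charDefect P x (u / c n)) *
      (n * (-Real.log (1 - charDefect P x (u / c n))))) atTop (𝓝 (u ^ 2)) := by
    simpa using ((tendsto_const_nhds (x := (1 : ℝ))).sub hW0).mul hlog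
  refine tendsto_of_tendsto_of_tendsto_of_le_of_le' hlow hlog ?_ ?_
  · filter_upwards [hW0.eventually (gt_mem_nhds one_pos)] with n hn
    have h1 := Real.one_sub_inv_le_log_of_pos (sub_pos.2 hn)
    have h2 := mul_le_mul_of_nonneg_left h1 (sub_pos.2 hn).le
    rw [mul_sub, mul_inv_cancel₀ (sub_pos.2 hn).ne'] at h2
    nlinarith [(Nat.cast_nonneg n : (0 : ℝ) ≤ n)]
  · filter_upwards [hW0.eventually (gt_mem_nhds one_pos)] with n hn
    have h1 := Real.log_le_sub_one_of_pos (sub_pos.2 hn)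
    exact mul_le_mul_of_nonneg_left (by linarith) (Nat.cast_nonneg n)

theorem tendsto_mul_cosDefect (hx : Measurable x)
    (hinf : ∫⁻ ω, ENNReal.ofReal (x ω ^ 2) ∂P = ∞)
    (hct : Tendsto (fun n => |c n|) atTop atTop)
    (hc : ∀ u : ℝ, Tendsto (fun n : ℕ => ‖charFun (P.map x) (u / c n)‖ ^ n) atTop
      (𝓝 (Real.exp (-(u ^ 2) / 2)))) (u : ℝ) :
    Tendsto (fun n : ℕ => n * cosDefect P x (u / c n)) atTop (𝓝 (u ^ 2 / 2)) := by
  have hW := tendsto_mul_charDefect hx hct hc u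
  have hd : Tendsto (fun n : ℕ => n * (2 * cosDefect P x (u / c n) - charDefect P x (u / c n)))
      atTop (𝓝 0) := by
    rw [Metric.tendsto_atTop']
    intro ε hε
    -- With `η ≤ 1` one has `V ≤ W`, hence `2V - W ≤ ηV ≤ ηW`; moreover `nW < u² + 1` eventually.
    set η : ℝ := min 1 (ε / (2 * (u ^ 2 + 1))) with hη
    have hη0 : 0 < η := by positivity
    have h1 := (tendsto_div_norming hct u).eventually (eventually_charDefect (P := P) hx hinf hη0)
    have h2 := hW.eventually (gt_mem_nhds (lt_add_one (u ^ 2)))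
    obtain ⟨N, hN⟩ := eventually_atTop.1 (h1.and h2)
    refine ⟨N, fun n hn => ?_⟩
    obtain ⟨⟨h3, h4⟩, h5⟩ := hN n hn.le
    have hn0 : (0 : ℝ) ≤ n := Nat.cast_nonneg n
    rw [dist_zero_right, Real.norm_eq_abs, abs_of_nonneg (mul_nonneg hn0 (by linarith))]
    have hV := cosDefect_nonneg (P := P) (x := x) (u / c n)
    have h6 : cosDefect P x (u / c n) ≤ charDefect P x (u / c n) := by
      nlinarith [min_le_left 1 (ε / (2 * (u ^ 2 + 1)))]
    have h7 : 2 * cosDefect P x (u / c n) - charDefect P x (u / c n) ≤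
        η * charDefect P x (u / c n) := by nlinarith
    calc n * (2 * cosDefect P x (u / c n) - charDefect P x (u / c n))
        ≤ η * (n * charDefect P x (u / c n)) := by nlinarith
      _ ≤ η * (u ^ 2 + 1) := by gcongr
      _ ≤ ε / (2 * (u ^ 2 + 1)) * (u ^ 2 + 1) := by gcongr; exact min_le_right _ _
      _ = ε / 2 := by field_simp
      _ < ε := by linarith
  have := (hW.add hd).div_const 2
  rw [add_zero] at this
  refine this.congr fun n => ?_
  ring

/-- The majorant for dominated convergence. The bound 2 holds at u/8, and three doublings cost a
factor 4 each: 2 · 64 = 128. -/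
theorem eventually_mul_cosDefect_le (hx : Measurable x)
    (hinf : ∫⁻ ω, ENNReal.ofReal (x ω ^ 2) ∂P = ∞)
    (hct : Tendsto (fun n => |c n|) atTop atTop)
    (hb : ∀ᶠ n : ℕ in atTop, ∀ u : ℝ, |u| ≤ 1 / 2 → n * charDefect P x (u / c n) ≤ 2) :
    ∀ᶠ n : ℕ in atTop, ∀ u : ℝ, |u| ≤ 4 → n * cosDefect P x (u / c n) ≤ 128 := by
  obtain ⟨r, hr, h1⟩ :=
    Metric.eventually_nhds_iff.1 (eventually_charDefect (P := P) hx hinf one_pos)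
  filter_upwards [hb, hct.eventually_gt_atTop (1 / r)] with n hn hn1 u hu
  have hc0 : 0 < |c n| := lt_trans (by positivity) hn1
  have h2 : n * cosDefect P x (u / 8 / c n) ≤ 2 := by
    have hu' : |u / 8| ≤ 1 / 2 := by rw [abs_div, abs_of_pos (by norm_num : (0 : ℝ) < 8)]; linarith
    have h3 := @h1 (u / 8 / c n) (by
      rw [dist_zero_right, Real.norm_eq_abs, abs_div, div_lt_iff₀ hc0]
      rw [div_lt_iff₀ hr] at hn1
      linarith)
    refine le_trans (mul_le_mul_of_nonneg_left ?_ (Nat.cast_nonneg n)) (hn _ hu')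
    have := cosDefect_nonneg (P := P) (x := x) (u / 8 / c n)
    linarith [h3.1]
  have h4 := cosDefect_two_mul_le (P := P) hx (u / 8 / c n)
  have h5 := cosDefect_two_mul_le (P := P) hx (2 * (u / 8 / c n))
  have h6 := cosDefect_two_mul_le (P := P) hx (2 * (2 * (u / 8 / c n)))
  rw [show 2 * (2 * (2 * (u / 8 / c n))) = u / c n by ring] at h6
  have hn0 : (0 : ℝ) ≤ n := Nat.cast_nonneg n
  nlinarith

/-- Allows interpolation between consecutive norming constants. If the ratio exceeded 4, then `u = 2
c_n/c_{n+1}` would satisfy `|u| ≤ 1/2`, so `n W(2/c_{n+1}) ≤ 2`, while `(n+1) W(2/c_{n+1}) → 4`. -/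
theorem eventually_norming_succ_le (hx : Measurable x)
    (hct : Tendsto (fun n => |c n|) atTop atTop)
    (hc : ∀ u : ℝ, Tendsto (fun n : ℕ => ‖charFun (P.map x) (u / c n)‖ ^ n) atTop
      (𝓝 (Real.exp (-(u ^ 2) / 2))))
    (hb : ∀ᶠ n : ℕ in atTop, ∀ u : ℝ, |u| ≤ 1 / 2 → n * charDefect P x (u / c n) ≤ 2) :
    ∀ᶠ n : ℕ in atTop, |c (n + 1)| ≤ 4 * |c n| := by
  have h1 := (tendsto_add_atTop_iff_nat 1).2 (tendsto_mul_charDefect hx hct hc 2)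
  have h2 := h1.eventually (lt_mem_nhds (show (3 : ℝ) < 2 ^ 2 by norm_num))
  filter_upwards [h2, hb, eventually_ge_atTop 2, hct.eventually_gt_atTop 0,
    (tendsto_add_atTop_iff_nat 1).2 hct |>.eventually_gt_atTop 0] with n hn hbn hn2 hc0 hc1
  by_contra! hlt
  have h3 := hbn (2 / c (n + 1) * c n) (by
    rw [abs_mul, abs_div, abs_of_pos (by norm_num : (0 : ℝ) < 2), div_mul_eq_mul_div,
      div_le_iff₀ hc1]
    linarith)
  rw [mul_div_cancel_right₀ _ (abs_pos.1 hc0)] at h3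
  have hn2' : (2 : ℝ) ≤ n := by exact_mod_cast hn2
  push_cast at hn
  have := charDefect_nonneg (P := P) hx (2 / c (n + 1))
  nlinarith

/-- The integral is `3 - 2 sin(2y)/y + sin(4y)/(4y) ≥ 3 - 2 - 1/4`. -/
theorem integral_one_sub_cos_sq_ge {y : ℝ} (hy : 1 ≤ |y|) :
    3 / 4 ≤ ∫ u in (0 : ℝ)..2, (1 - Real.cos (u * y)) ^ 2 := by
  have hy0 : y ≠ 0 := fun h => by simp [h] at hy; linarith
  have hd : ∀ u ∈ Set.uIcc (0 : ℝ) 2, HasDerivAt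
      (fun u : ℝ => 3 / 2 * u - 2 * (Real.sin (u * y) / y) + Real.sin (2 * (u * y)) / (4 * y))
      ((1 - Real.cos (u * y)) ^ 2) u := fun u _ => by
    have h1 : HasDerivAt (fun u : ℝ => u * y) y u := by simpa using (hasDerivAt_id u).mul_const y
    have h2 := ((hasDerivAt_id u).const_mul (3 / 2 : ℝ)).sub (((h1.sin).div_const y).const_mul 2)
    have h3 := h2.add ((h1.const_mul 2).sin.div_const (4 * y))
    refine h3.congr_deriv ?_
    rw [Real.cos_two_mul]
    field_simp
    ring
  rw [intervalIntegral.integral_eq_sub_of_hasDerivAt hd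
    (Continuous.intervalIntegrable (by fun_prop) _ _)]
  have hb : ∀ θ : ℝ, |Real.sin θ / y| ≤ 1 := fun θ => by
    rw [abs_div, div_le_one (by linarith)]
    exact (Real.abs_sin_le_one θ).trans hy
  have h1 := abs_le.1 (hb (2 * y))
  have h2 := abs_le.1 (hb (2 * (2 * y)))
  have h3 : Real.sin (2 * (2 * y)) / (4 * y) = Real.sin (2 * (2 * y)) / y / 4 := by
    rw [div_div, mul_comm y]
  simp only [zero_mul, mul_zero, Real.sin_zero, zero_div]
  rw [h3]
  linarith [h1.2, h2.1]

/-- The duplication identity integrated over `u ∈ [0, 2]`. By Fubini the right side is `2 𝔼 ∫ (1 -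
cos(ux/r))² du`, and the inner integral is at least 3/4 on the event. -/
theorem measureReal_lt_abs_le (hx : Measurable x) {r : ℝ} (hr : r ≠ 0) :
    3 / 2 * P.real {ω | |r| < |x ω|} ≤
      ∫ u in (0 : ℝ)..2, (4 * cosDefect P x (u / r) - cosDefect P x (2 * u / r)) := by
  have hm : Measurable fun p : ℝ × Ω => (1 - Real.cos (p.1 * (x p.2 / r))) ^ 2 := by fun_prop
  have hint : Integrable (Function.uncurry fun (u : ℝ) (ω : Ω) =>
      (1 - Real.cos (u * (x ω / r))) ^ 2) ((volume.restrict (Set.Ioc (0 : ℝ) 2)).prod P) := by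
    refine Integrable.of_bound hm.aestronglyMeasurable 4 (ae_of_all _ fun p => ?_)
    have := Real.neg_one_le_cos (p.1 * (x p.2 / r))
    have := Real.cos_le_one (p.1 * (x p.2 / r))
    rw [Real.norm_eq_abs, abs_le]
    constructor <;> simp only [Function.uncurry] <;> nlinarith
  have h1 : ∫ u in (0 : ℝ)..2, (4 * cosDefect P x (u / r) - cosDefect P x (2 * u / r)) =
      2 * ∫ ω, (∫ u in (0 : ℝ)..2, (1 - Real.cos (u * (x ω / r))) ^ 2) ∂P := by
    simp only [intervalIntegral.integral_of_le (zero_le_two (α := ℝ))]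
    rw [← integral_integral_swap hint, ← integral_const_mul]
    refine integral_congr_ae (ae_of_all _ fun u => ?_)
    have := cosDefect_two_mul (P := P) hx (u / r)
    rw [← mul_div_assoc] at this
    simp only [this, mul_div_assoc']
    congr 2
    funext ω
    congr 3
    ring
  have hs : MeasurableSet {ω | |r| < |x ω|} := measurableSet_lt measurable_const hx.abs
  rw [h1, ← integral_indicator_one hs]
  have h2 : Integrable (fun ω => ∫ u in (0 : ℝ)..2, (1 - Real.cos (u * (x ω / r))) ^ 2) P := by
    simp only [intervalIntegral.integral_of_le (zero_le_two (α := ℝ))]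
    exact hint.integral_prod_right
  have h3 : Integrable ({ω | |r| < |x ω|}.indicator (1 : Ω → ℝ)) P :=
    (integrable_const (1 : ℝ)).indicator hs
  rw [← integral_const_mul, ← integral_const_mul]
  refine integral_mono (h3.const_mul _) (h2.const_mul _) fun ω => ?_
  by_cases h : |r| < |x ω|
  · simp only [Set.indicator, Set.mem_ofPred_eq, h, if_true, Pi.one_apply]
    have := integral_one_sub_cos_sq_ge (y := x ω / r) (by
      rw [abs_div, one_le_div (abs_pos.2 hr)]; exact h.le)
    linarith
  · simp only [Set.indicator, Set.mem_ofPred_eq, h, if_false, mul_zero]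
    exact mul_nonneg zero_le_two
      (intervalIntegral.integral_nonneg zero_le_two fun u _ => sq_nonneg _)

/-- The integrand `n (4V(u/c_n) - V(2u/c_n))` tends to `4 · u²/2 - (2u)²/2 = 0` and is at most 4 ·
128 = 512. -/
theorem tendsto_mul_tail_norming (hx : Measurable x)
    (hinf : ∫⁻ ω, ENNReal.ofReal (x ω ^ 2) ∂P = ∞)
    (hct : Tendsto (fun n => |c n|) atTop atTop)
    (hc : ∀ u : ℝ, Tendsto (fun n : ℕ => ‖charFun (P.map x) (u / c n)‖ ^ n) atTop
      (𝓝 (Real.exp (-(u ^ 2) / 2))))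
    (hb : ∀ᶠ n : ℕ in atTop, ∀ u : ℝ, |u| ≤ 1 / 2 → n * charDefect P x (u / c n) ≤ 2) :
    Tendsto (fun n : ℕ => n * P.real {ω | |c n| < |x ω|}) atTop (𝓝 0) := by
  have hV := cosDefect_continuous (P := P) hx
  have h1 : Tendsto (fun n : ℕ => ∫ u in (0 : ℝ)..2,
      n * (4 * cosDefect P x (u / c n) - cosDefect P x (2 * u / c n))) atTop
      (𝓝 (∫ u in (0 : ℝ)..2, (0 : ℝ))) := by
    refine intervalIntegral.tendsto_integral_filter_of_dominated_convergence (fun _ => 512)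
      (Eventually.of_forall fun n => ?_) ?_ (by simp) (ae_of_all _ fun u _ => ?_)
    · exact Continuous.aestronglyMeasurable (by fun_prop)
    · filter_upwards [eventually_mul_cosDefect_le hx hinf hct hb] with n hn
      refine ae_of_all _ fun u hu => ?_
      rw [Set.uIoc_of_le zero_le_two] at hu
      have h2 := hn u (by rw [abs_of_pos hu.1]; linarith [hu.2])
      have h3 := cosDefect_two_mul_le (P := P) hx (u / c n)
      rw [← mul_div_assoc] at h3
      have h4 := cosDefect_nonneg (P := P) (x := x) (2 * u / c n)
      have hn0 : (0 : ℝ) ≤ n := Nat.cast_nonneg n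
      rw [Real.norm_eq_abs, abs_of_nonneg (mul_nonneg hn0 (by linarith))]
      nlinarith
    · have h2 := ((tendsto_mul_cosDefect hx hinf hct hc u).const_mul 4).sub
        (tendsto_mul_cosDefect hx hinf hct hc (2 * u))
      rw [show 4 * (u ^ 2 / 2) - (2 * u) ^ 2 / 2 = 0 by ring] at h2
      exact h2.congr fun n => by ring
  rw [intervalIntegral.integral_zero] at h1
  refine squeeze_zero' (Eventually.of_forall fun n => by positivity) ?_ h1
  filter_upwards [hct.eventually_gt_atTop 0] with n hn
  rw [intervalIntegral.integral_const_mul]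
  refine mul_le_mul_of_nonneg_left ?_ (Nat.cast_nonneg n)
  have := measureReal_lt_abs_le (P := P) hx (abs_pos.1 hn)
  have h0 : 0 ≤ P.real {ω | |c n| < |x ω|} := measureReal_nonneg
  linarith

/-- In the Gaussian domain of attraction the tail is negligible with respect to the truncated
second moment. -/
theorem InGaussianDomain.eventually_sq_mul_tail_le (hx : Measurable x)
    (hinf : ∫⁻ ω, ENNReal.ofReal (x ω ^ 2) ∂P = ∞) (h : InGaussianDomain P x)
    {ε : ℝ} (hε : 0 < ε) :
    ∀ᶠ t in atTop, t ^ 2 * P.real {ω | t < |x ω|} ≤ ε * truncMoment P x t := by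
  obtain ⟨c, hc, hb⟩ := h.exists_norming hx
  have hct := tendsto_norming_atTop hx hinf hc hb
  have htail := tendsto_mul_tail_norming hx hinf hct hc hb
  have hone := tendsto_mul_cosDefect hx hinf hct hc 1
  -- From `nV(1/c_n) > 3/8` and `nP(|x| > |c_n|) < 1/32` follows `c_n² ≤ 2 n l(|c_n|)`; the
  -- threshold ε/64 absorbs the factor 32 = 16 · 2 of the final chain.
  obtain ⟨N, hN⟩ := eventually_atTop.1 ((htail.eventually
      (gt_mem_nhds (show 0 < min (ε / 64) (1 / 32) by positivity))).and
    ((hone.eventually (lt_mem_nhds (show (3 : ℝ) / 8 < 1 ^ 2 / 2 by norm_num))).and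
    ((eventually_norming_succ_le hx hct hc hb).and (hct.eventually_gt_atTop 0))))
  filter_upwards [eventually_ge_atTop |c N|] with t ht
  -- `|c n|` need not be monotone, but it cannot stay below t forever, so it crosses t at some index
  -- after N.
  obtain ⟨n, hn, hcn, hcn1⟩ : ∃ n, N ≤ n ∧ |c n| ≤ t ∧ t < |c (n + 1)| := by
    by_contra! hcon
    have hall : ∀ n, N ≤ n → |c n| ≤ t := fun n hn => by
      induction n, hn using Nat.le_induction with
      | base => exact ht
      | succ n hn ih => exact hcon n hn ih
    obtain ⟨n, hn, hn'⟩ := ((eventually_ge_atTop N).and (hct.eventually_gt_atTop t)).exists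
    exact absurd (hall n hn) (not_le.2 hn')
  obtain ⟨h1, h2, h3, h4⟩ := hN n hn
  have hle := cosDefect_le (P := P) hx (1 / c n) |c n|
  have hc2 : 0 < c n ^ 2 := by rw [← sq_abs]; positivity
  have hn0 : (0 : ℝ) ≤ n := Nat.cast_nonneg n
  have hn1 : n * P.real {ω | |c n| < |x ω|} < 1 / 32 := h1.trans_le (min_le_right _ _)
  have hn2 : n * P.real {ω | |c n| < |x ω|} < ε / 64 := h1.trans_le (min_le_left _ _)
  have h5 : c n ^ 2 ≤ 2 * (n * truncMoment P x |c n|) := by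
    have h6 := mul_le_mul_of_nonneg_left hle hn0
    have h7 : n * ((1 / c n) ^ 2 / 2 * truncMoment P x |c n| + 2 * P.real {ω | |c n| < |x ω|}) =
      (n * truncMoment P x |c n|) / (2 * c n ^ 2) + 2 * (n * P.real {ω | |c n| < |x ω|}) := by
      field_simp
    rw [h7] at h6
    have h8 : 1 / 4 ≤ (n * truncMoment P x |c n|) / (2 * c n ^ 2) := by linarith
    rw [le_div_iff₀ (by positivity)] at h8
    linarith
  have hmono := truncMoment_mono (P := P) hx hcn
  have htl : P.real {ω | t < |x ω|} ≤ P.real {ω | |c n| < |x ω|} :=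
    measureReal_mono fun ω (h : t < |x ω|) => lt_of_le_of_lt hcn h
  have ht2 : t ^ 2 ≤ 16 * c n ^ 2 := by
    rw [← sq_abs (c n)]
    nlinarith [abs_nonneg (c n)]
  have hp : 0 ≤ P.real {ω | |c n| < |x ω|} := measureReal_nonneg
  have hl := truncMoment_nonneg (P := P) (x := x) |c n|
  calc t ^ 2 * P.real {ω | t < |x ω|}
      ≤ 16 * c n ^ 2 * P.real {ω | |c n| < |x ω|} := by gcongr
    _ ≤ 16 * (2 * (n * truncMoment P x |c n|)) * P.real {ω | |c n| < |x ω|} := by gcongr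
    _ = 32 * truncMoment P x |c n| * (n * P.real {ω | |c n| < |x ω|}) := by ring
    _ ≤ 32 * truncMoment P x |c n| * (ε / 64) := by gcongr
    _ ≤ ε * truncMoment P x |c n| := by nlinarith
    _ ≤ ε * truncMoment P x t := by gcongr

end Domain

/-! ### The normalizing sequence `b_n` -/

section NormSeq

variable {Ω : Type*} [MeasurableSpace Ω] {P : Measure Ω} [IsProbabilityMeasure P] {x : Ω → ℝ}

theorem lowerEdge_nonneg : 0 ≤ lowerEdge P x := Real.sInf_nonneg fun _ ht => ht.1.le

theorem truncMoment_le_mul (hx : Measurable x) (hint : Integrable x P) {t : ℝ} (ht : 0 ≤ t) :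
    truncMoment P x t ≤ t * ∫ ω, |x ω| ∂P := by
  rw [truncMoment, ← integral_const_mul]
  refine integral_mono (integrable_trunc hx t) (hint.abs.const_mul t) fun ω => ?_
  by_cases h : |x ω| ≤ t
  · simp only [Set.indicator, Set.mem_ofPred_eq, h, if_true]
    rw [← sq_abs, sq]
    exact mul_le_mul_of_nonneg_right h (abs_nonneg _)
  · simp only [Set.indicator, Set.mem_ofPred_eq, h, if_false]
    positivity

/-- Since `l(t) ≤ t 𝔼|x|`, any t beyond `n 𝔼|x|` and the lower edge plus one qualifies, so the
infimum is a genuine one. -/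
theorem normSeq_set_nonempty (hx : Measurable x) (hint : Integrable x P) (n : ℕ) :
    {t : ℝ | lowerEdge P x + 1 < t ∧ n * truncMoment P x t ≤ t ^ 2}.Nonempty := by
  have hE : 0 ≤ ∫ ω, |x ω| ∂P := integral_nonneg fun _ => abs_nonneg _
  have hb := lowerEdge_nonneg (P := P) (x := x)
  refine ⟨lowerEdge P x + 2 + n * ∫ ω, |x ω| ∂P, ?_, ?_⟩
  · have : (0 : ℝ) ≤ n * ∫ ω, |x ω| ∂P := by positivity
    linarith
  · set t := lowerEdge P x + 2 + n * ∫ ω, |x ω| ∂P with ht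
    have ht1 : n * ∫ ω, |x ω| ∂P ≤ t := by linarith
    have ht0 : 0 ≤ t := by positivity
    have := mul_le_mul_of_nonneg_left (truncMoment_le_mul hx hint ht0) (Nat.cast_nonneg n)
    nlinarith

theorem lowerEdge_add_one_le_normSeq (hx : Measurable x) (hint : Integrable x P) (n : ℕ) :
    lowerEdge P x + 1 ≤ normSeq P x n :=
  le_csInf (normSeq_set_nonempty hx hint n) fun _ ht => ht.1.le

theorem one_le_normSeq (hx : Measurable x) (hint : Integrable x P) (n : ℕ) :
    1 ≤ normSeq P x n := by
  have := lowerEdge_add_one_le_normSeq hx hint n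
  linarith [lowerEdge_nonneg (P := P) (x := x)]

/-- Monotonicity of `l` replaces continuity. If the inequality failed, the set would contain some `t
≥ b_n` with `t² < n l(b_n) ≤ n l(t)`. -/
theorem mul_truncMoment_normSeq_le (hx : Measurable x) (hint : Integrable x P) (n : ℕ) :
    n * truncMoment P x (normSeq P x n) ≤ normSeq P x n ^ 2 := by
  by_contra! hlt
  have hb := one_le_normSeq hx hint n
  have h1 : normSeq P x n < √(n * truncMoment P x (normSeq P x n)) :=
    Real.lt_sqrt_of_sq_lt hlt
  obtain ⟨t, ht, htlt⟩ := exists_lt_of_csInf_lt (normSeq_set_nonempty hx hint n) h1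
  have hle : normSeq P x n ≤ t := csInf_le ⟨lowerEdge P x + 1, fun s hs => hs.1.le⟩ ht
  have h2 : t ^ 2 < n * truncMoment P x (normSeq P x n) := by
    rw [Real.lt_sqrt (by linarith)] at htlt
    exact htlt
  have h3 := mul_le_mul_of_nonneg_left (truncMoment_mono (P := P) hx hle) (Nat.cast_nonneg n)
  linarith [ht.2]

theorem truncMoment_lowerEdge_add_one_pos (hx : Measurable x)
    (hinf : ∫⁻ ω, ENNReal.ofReal (x ω ^ 2) ∂P = ∞) : 0 < truncMoment P x (lowerEdge P x + 1) := by
  obtain ⟨t, ht⟩ := exists_lt_truncMoment hx hinf 0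
  obtain ⟨s, hs, hlt⟩ := exists_lt_of_csInf_lt
    (s := {t : ℝ | 0 < t ∧ 0 < truncMoment P x t}) ⟨t, ht⟩
    (show lowerEdge P x < lowerEdge P x + 1 by linarith)
  exact hs.2.trans_le (truncMoment_mono hx hlt.le)

/-- `b_n² ≥ n l(b_n) ≥ n l(b + 1)`, and the last moment is positive because the threshold lies
beyond the lower edge b. -/
theorem tendsto_normSeq_atTop (hx : Measurable x) (hint : Integrable x P)
    (hinf : ∫⁻ ω, ENNReal.ofReal (x ω ^ 2) ∂P = ∞) :
    Tendsto (fun n => normSeq P x n) atTop atTop := by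
  refine tendsto_atTop.2 fun T => ?_
  have hpos := truncMoment_lowerEdge_add_one_pos hx hinf
  filter_upwards [eventually_gt_atTop ⌈T ^ 2 / truncMoment P x (lowerEdge P x + 1)⌉₊] with n hn
  by_contra! hlt
  have h1 : T ^ 2 / truncMoment P x (lowerEdge P x + 1) < n :=
    (Nat.le_ceil _).trans_lt (by exact_mod_cast hn)
  rw [div_lt_iff₀ hpos] at h1
  have h2 := mul_truncMoment_normSeq_le hx hint n
  have h3 := mul_le_mul_of_nonneg_left
    (truncMoment_mono (P := P) hx (lowerEdge_add_one_le_normSeq hx hint n))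
    (Nat.cast_nonneg n)
  have h4 := one_le_normSeq hx hint n
  nlinarith

/-- For `t = δ b_n` the tail relation gives `n P(|x| > t) ≤ η n l(b_n)/(δ b_n)² ≤ η/δ²`, with η
arbitrarily small. -/
theorem InGaussianDomain.tendsto_mul_tail_normSeq (hx : Measurable x) (hint : Integrable x P)
    (hinf : ∫⁻ ω, ENNReal.ofReal (x ω ^ 2) ∂P = ∞) (h : InGaussianDomain P x)
    {δ : ℝ} (hδ : 0 < δ) (hδ1 : δ ≤ 1) :
    Tendsto (fun n : ℕ => n * P.real {ω | δ * normSeq P x n < |x ω|}) atTop (𝓝 0) := by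
  rw [Metric.tendsto_atTop']
  intro ε hε
  have h1 := ((tendsto_normSeq_atTop hx hint hinf).const_mul_atTop hδ).eventually
    (h.eventually_sq_mul_tail_le hx hinf (show 0 < ε * δ ^ 2 / 2 by positivity))
  obtain ⟨N, hN⟩ := eventually_atTop.1 h1
  refine ⟨N, fun n hn => ?_⟩
  have h2 := hN n hn.le
  rw [dist_zero_right, Real.norm_eq_abs, abs_of_nonneg (by positivity)]
  have hb := one_le_normSeq hx hint n
  have h3 := truncMoment_mono (P := P) hx
    (show δ * normSeq P x n ≤ normSeq P x n by nlinarith)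
  have h4 := mul_truncMoment_normSeq_le hx hint n
  have h5 : δ ^ 2 * normSeq P x n ^ 2 * (n * P.real {ω | δ * normSeq P x n < |x ω|}) ≤
      δ ^ 2 * normSeq P x n ^ 2 * (ε / 2) := by
    calc δ ^ 2 * normSeq P x n ^ 2 * (n * P.real {ω | δ * normSeq P x n < |x ω|})
        = n * ((δ * normSeq P x n) ^ 2 * P.real {ω | δ * normSeq P x n < |x ω|}) := by ring
      _ ≤ n * (ε * δ ^ 2 / 2 * truncMoment P x (normSeq P x n)) := by
          refine mul_le_mul_of_nonneg_left (h2.trans ?_) (Nat.cast_nonneg n)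
          gcongr
      _ = ε * δ ^ 2 / 2 * (n * truncMoment P x (normSeq P x n)) := by ring
      _ ≤ ε * δ ^ 2 / 2 * normSeq P x n ^ 2 := by gcongr
      _ = δ ^ 2 * normSeq P x n ^ 2 * (ε / 2) := by ring
  have := le_of_mul_le_mul_left h5 (by positivity)
  linarith

end NormSeq

/-! ### One-sided Efron–Stein inequality -/

section EfronStein

variable {ι E : Type*} [Fintype ι] [DecidableEq ι] [MeasurableSpace E]
  (μ : ι → Measure E) [∀ i, IsProbabilityMeasure (μ i)]

/-- The law of two independent copies of a vector with independent coordinates, coordinatewise. -/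
abbrev pairLaw : Measure (ι → E × E) := Measure.pi fun i => (μ i).prod (μ i)

/-- The vector which takes the coordinates in `A` from the second copy. -/
def mix (A : Finset ι) (z : ι → E × E) (i : ι) : E := if i ∈ A then (z i).2 else (z i).1

/-- Exchange of the two copies of the coordinates in `A`. -/
def exchange (A : Finset ι) (z : ι → E × E) (i : ι) : E × E :=
  if i ∈ A then (z i).swap else z i

theorem mix_exchange (A B : Finset ι) (z : ι → E × E) :
    mix B (exchange A z) = mix (symmDiff B A) z := by
  funext i
  by_cases h1 : i ∈ A <;> by_cases h2 : i ∈ B <;>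
    simp [mix, exchange, Finset.mem_symmDiff, h1, h2]

theorem measurePreserving_mix (A : Finset ι) :
    MeasurePreserving (mix A) (pairLaw μ) (Measure.pi μ) := by
  have h := measurePreserving_pi (fun i => (μ i).prod (μ i)) μ
    (f := fun i z => if i ∈ A then z.2 else z.1) fun i => by
      by_cases h : i ∈ A
      · simpa only [h, if_true] using measurePreserving_snd (μ := μ i) (ν := μ i)
      · simpa only [h, if_false] using measurePreserving_fst (μ := μ i) (ν := μ i)
  exact h

theorem measurePreserving_exchange (A : Finset ι) :
    MeasurePreserving (exchange A) (pairLaw μ) (pairLaw μ) := by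
  have h := measurePreserving_pi (fun i => (μ i).prod (μ i)) (fun i => (μ i).prod (μ i))
    (f := fun i z => if i ∈ A then z.swap else z) fun i => by
      by_cases h : i ∈ A
      · simpa only [h, if_true] using Measure.measurePreserving_swap (μ := μ i) (ν := μ i)
      · simp only [h, if_false]; exact MeasurePreserving.id _
  exact h

theorem integral_comp_measurePreserving {α β : Type*} [MeasurableSpace α] [MeasurableSpace β]
    {ν : Measure α} {ν' : Measure β} {f : α → β} (hf : MeasurePreserving f ν ν') {g : β → ℝ}
    (hg : Measurable g) : ∫ a, g (f a) ∂ν = ∫ b, g b ∂ν' := by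
  rw [← hf.map_eq, integral_map hf.measurable.aemeasurable hg.aestronglyMeasurable]

theorem measurePreserving_mix_prod :
    MeasurePreserving (fun z : ι → E × E => (mix ∅ z, mix Finset.univ z)) (pairLaw μ)
      ((Measure.pi μ).prod (Measure.pi μ)) := by
  refine ⟨(measurePreserving_mix μ _).measurable.prodMk (measurePreserving_mix μ _).measurable, ?_⟩
  have hspan : (Measure.pi μ).FiniteSpanningSetsIn
      (Set.pi Set.univ '' Set.pi Set.univ fun _ : ι => {s : Set E | MeasurableSet s}) :=
    { set := fun _ => Set.univ
      set_mem := fun _ => ⟨fun _ => Set.univ, fun _ _ => MeasurableSet.univ, Set.pi_univ _⟩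
      finite := fun _ => measure_lt_top _ _
      spanning := Set.iUnion_const _ }
  refine (Measure.prod_eq_generateFrom generateFrom_pi generateFrom_pi isPiSystem_pi isPiSystem_pi
    hspan hspan ?_).symm
  rintro _ ⟨s, hs, rfl⟩ _ ⟨t, ht, rfl⟩
  have hs' : ∀ i, MeasurableSet (s i) := fun i => hs i trivial
  have ht' : ∀ i, MeasurableSet (t i) := fun i => ht i trivial
  rw [Measure.map_apply ((measurePreserving_mix μ _).measurable.prodMk
      (measurePreserving_mix μ _).measurable)
    ((MeasurableSet.univ_pi hs').prod (MeasurableSet.univ_pi ht'))]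
  have : (fun z : ι → E × E => (mix ∅ z, mix Finset.univ z)) ⁻¹'
      (Set.univ.pi s ×ˢ Set.univ.pi t) = Set.univ.pi fun i => s i ×ˢ t i := by
    ext z
    simp [mix, Set.mem_pi, forall_and]
  rw [this, Measure.pi_pi, Measure.pi_pi, Measure.pi_pi, ← Finset.prod_mul_distrib]
  simp [Measure.prod_prod]

variable {μ} {G : (ι → E) → ℝ} {C : ℝ}

/-- Exchanging the two copies on S preserves the law and toggles the membership of S in every mixing
set at once. -/
theorem integral_exchange {H : ℝ → ℝ → ℝ → ℝ} (hG : Measurable G)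
    (hH : Measurable fun p : ℝ × ℝ × ℝ => H p.1 p.2.1 p.2.2) (S A B D : Finset ι) :
    ∫ z, H (G (mix (symmDiff A S) z)) (G (mix (symmDiff B S) z)) (G (mix (symmDiff D S) z))
      ∂(pairLaw μ) =
    ∫ z, H (G (mix A z)) (G (mix B z)) (G (mix D z)) ∂(pairLaw μ) := by
  have hm : ∀ A : Finset ι, Measurable fun z : ι → E × E => G (mix A z) :=
    fun A => hG.comp (measurePreserving_mix μ A).measurable
  have := integral_comp_measurePreserving (measurePreserving_exchange μ S)
    (g := fun z => H (G (mix A z)) (G (mix B z)) (G (mix D z)))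
    (hH.comp ((hm A).prodMk ((hm B).prodMk (hm D))))
  simpa only [mix_exchange] using this

/-- Telescoping over the coordinates. Write `G_B` for `G ∘ mix B` and a for the increment `𝔼 G_∅
(G_A - G_{A∪i})`. Exchanging coordinate i gives `2a = 𝔼 (G_∅ - G_i)(G_A - G_{A∪i})`; both factors
have the same second moment, by exchanging A, so `a ≤ ½ 𝔼 (G_∅ - G_i)²`. -/
theorem integral_mul_sub_mix_le (hG : Measurable G) (hC : ∀ z, |G z| ≤ C) (A : Finset ι) :
    ∫ z, G (mix ∅ z) * (G (mix ∅ z) - G (mix A z)) ∂(pairLaw μ) ≤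
      ∑ i ∈ A, 1 / 2 * ∫ z, (G (mix ∅ z) - G (mix {i} z)) ^ 2 ∂(pairLaw μ) := by
  have hm : ∀ A : Finset ι, Measurable fun z : ι → E × E => G (mix A z) :=
    fun A => hG.comp (measurePreserving_mix μ A).measurable
  have hint : ∀ {f : (ι → E × E) → ℝ} (K : ℝ), Measurable f → (∀ z, |f z| ≤ K) →
      Integrable f (pairLaw μ) := fun K hf h =>
    Integrable.of_bound hf.aestronglyMeasurable K (ae_of_all _ h)
  have hbd : ∀ a b c d : ℝ, |a| ≤ C → |b| ≤ C → |c| ≤ C → |d| ≤ C →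
      |(a - b) * (c - d)| ≤ (C + C) * (C + C) := fun a b c d ha hb hc hd => by
    rw [abs_mul]
    exact mul_le_mul ((abs_sub _ _).trans (add_le_add ha hb))
      ((abs_sub _ _).trans (add_le_add hc hd)) (abs_nonneg _)
      (by linarith [abs_nonneg a])
  have hbd' : ∀ a c d : ℝ, |a| ≤ C → |c| ≤ C → |d| ≤ C →
      |a * (c - d)| ≤ C * (C + C) := fun a c d ha hc hd => by
    rw [abs_mul]
    exact mul_le_mul ha ((abs_sub _ _).trans (add_le_add hc hd)) (abs_nonneg _)
      ((abs_nonneg a).trans ha)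
  induction A using Finset.induction_on with
  | empty => simp
  | insert i A hi ih =>
    rw [Finset.sum_insert hi]
    have e1 : symmDiff (∅ : Finset ι) {i} = {i} := by simp
    have e2 : symmDiff A {i} = insert i A := by
      ext j; simp only [Finset.mem_symmDiff, Finset.mem_singleton, Finset.mem_insert]
      grind
    have e3 : symmDiff (insert i A) {i} = A := by
      rw [← e2, symmDiff_assoc, symmDiff_self]; simp
    have e4 : symmDiff (∅ : Finset ι) A = A := by simp
    have e5 : symmDiff ({i} : Finset ι) A = insert i A := by rw [symmDiff_comm, e2]
    have s1 := integral_exchange (μ := μ) (H := fun a b c => a * (b - c)) hG (by fun_prop)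
      {i} ∅ A (insert i A)
    have s2 := integral_exchange (μ := μ) (H := fun a b _ => (a - b) ^ 2) hG (by fun_prop)
      A ∅ {i} ∅
    simp only [e1, e2, e3, e4, e5] at s1 s2
    have hstep : ∫ z, G (mix ∅ z) * (G (mix A z) - G (mix (insert i A) z)) ∂(pairLaw μ) ≤
        1 / 2 * ∫ z, (G (mix ∅ z) - G (mix {i} z)) ^ 2 ∂(pairLaw μ) := by
      set a := ∫ z, G (mix ∅ z) * (G (mix A z) - G (mix (insert i A) z)) ∂(pairLaw μ)
      have i1 : ∀ B : Finset ι, Integrable (fun z => G (mix B z) *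
          (G (mix A z) - G (mix (insert i A) z))) (pairLaw μ) := fun B =>
        hint (C * (C + C)) ((hm _).mul ((hm _).sub (hm _))) fun z => hbd' _ _ _ (hC _) (hC _) (hC _)
      have i2 : ∀ A B : Finset ι, Integrable (fun z => (G (mix A z) - G (mix B z)) ^ 2)
          (pairLaw μ) := fun A B =>
        hint ((C + C) * (C + C)) (((hm _).sub (hm _)).pow_const 2) fun z => by
          rw [sq]; exact hbd _ _ _ _ (hC _) (hC _) (hC _) (hC _)
      have h2 : ∫ z, G (mix {i} z) * (G (mix A z) - G (mix (insert i A) z)) ∂(pairLaw μ) = -a := by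
        rw [← s1, ← integral_neg]
        congr 1; funext z; ring
      have h3 : 2 * a = ∫ z, (G (mix ∅ z) - G (mix {i} z)) *
          (G (mix A z) - G (mix (insert i A) z)) ∂(pairLaw μ) := by
        simp_rw [sub_mul]
        rw [integral_sub (i1 _) (i1 _), h2]
        ring
      have h4 : ∫ z, (G (mix ∅ z) - G (mix {i} z)) *
          (G (mix A z) - G (mix (insert i A) z)) ∂(pairLaw μ) ≤
          ∫ z, (1 / 2 * (G (mix ∅ z) - G (mix {i} z)) ^ 2 +
            1 / 2 * (G (mix A z) - G (mix (insert i A) z)) ^ 2) ∂(pairLaw μ) := by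
        refine integral_mono (hint ((C + C) * (C + C)) (((hm _).sub (hm _)).mul
          ((hm _).sub (hm _))) fun z => hbd _ _ _ _ (hC _) (hC _) (hC _) (hC _))
          (((i2 _ _).const_mul _).add ((i2 _ _).const_mul _)) fun z => ?_
        nlinarith [sq_nonneg ((G (mix ∅ z) - G (mix {i} z)) -
          (G (mix A z) - G (mix (insert i A) z)))]
      rw [integral_add ((i2 _ _).const_mul _) ((i2 _ _).const_mul _), integral_const_mul,
        integral_const_mul, s2] at h4
      linarith
    have hsplit : ∫ z, G (mix ∅ z) * (G (mix ∅ z) - G (mix (insert i A) z)) ∂(pairLaw μ) =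
        ∫ z, G (mix ∅ z) * (G (mix A z) - G (mix (insert i A) z)) ∂(pairLaw μ) +
        ∫ z, G (mix ∅ z) * (G (mix ∅ z) - G (mix A z)) ∂(pairLaw μ) := by
      have i3 : ∀ A B : Finset ι, Integrable (fun z => G (mix ∅ z) * (G (mix A z) - G (mix B z)))
          (pairLaw μ) := fun A B => hint (C * (C + C)) ((hm _).mul ((hm _).sub (hm _)))
        fun z => hbd' _ _ _ (hC _) (hC _) (hC _)
      rw [← integral_add (i3 _ _) (i3 _ _)]
      congr 1; funext z; ring
    rw [hsplit]
    exact add_le_add hstep ih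

/-- The one-sided **Efron–Stein inequality** for a bounded function with a pointwise bound on the
sum of the squared decrements under the replacement of one coordinate. -/
theorem efronStein (hG : Measurable G) (hC : ∀ z, |G z| ≤ C) {K : ℝ}
    (hK : ∀ z w : ι → E, ∑ i, max 0 (G z - G (Function.update z i (w i))) ^ 2 ≤ K) :
    ∫ z, (G z - ∫ y, G y ∂(Measure.pi μ)) ^ 2 ∂(Measure.pi μ) ≤ K := by
  have hm : ∀ A : Finset ι, Measurable fun z : ι → E × E => G (mix A z) :=
    fun A => hG.comp (measurePreserving_mix μ A).measurable
  have hint : ∀ {f : (ι → E × E) → ℝ} (K : ℝ), Measurable f → (∀ z, |f z| ≤ K) →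
      Integrable f (pairLaw μ) := fun K hf h =>
    Integrable.of_bound hf.aestronglyMeasurable K (ae_of_all _ h)
  have hsq : ∀ a b : ℝ, |a| ≤ C → |b| ≤ C → |a * b| ≤ C * C := fun a b ha hb => by
    rw [abs_mul]; exact mul_le_mul ha hb (abs_nonneg _) ((abs_nonneg _).trans ha)
  set m := ∫ y, G y ∂(Measure.pi μ) with hm_def
  -- The variance is `𝔼 G(X)(G(X) - G(X'))` for an independent copy X', the two extreme mixtures
  -- being independent.
  have hvar : ∫ z, (G z - m) ^ 2 ∂(Measure.pi μ) =
      ∫ z, G (mix ∅ z) * (G (mix ∅ z) - G (mix Finset.univ z)) ∂(pairLaw μ) := by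
    have j1 : Integrable G (Measure.pi μ) :=
      Integrable.of_bound hG.aestronglyMeasurable C (ae_of_all _ hC)
    have j2 : Integrable (fun z => G z * G z) (Measure.pi μ) :=
      Integrable.of_bound (hG.mul hG).aestronglyMeasurable (C * C)
        (ae_of_all _ fun z => hsq _ _ (hC z) (hC z))
    have h1 : ∫ z, (G z - m) ^ 2 ∂(Measure.pi μ) = ∫ z, G z * G z ∂(Measure.pi μ) - m * m := by
      have e : ∀ z, (G z - m) ^ 2 = G z * G z - ((2 * m) * G z - m * m) := fun z => by ring
      simp_rw [e]
      have j3 : Integrable (fun z => (2 * m) * G z - m * m) (Measure.pi μ) :=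
        (j1.const_mul _).sub (integrable_const _)
      rw [integral_sub j2 j3, integral_sub (j1.const_mul _) (integrable_const _),
        integral_const_mul, ← hm_def]
      simp
      ring
    have h2 : ∫ z, G (mix ∅ z) * G (mix ∅ z) ∂(pairLaw μ) = ∫ z, G z * G z ∂(Measure.pi μ) :=
      integral_comp_measurePreserving (measurePreserving_mix μ ∅) (hG.mul hG)
    have h3 : ∫ z, G (mix ∅ z) * G (mix Finset.univ z) ∂(pairLaw μ) = m * m := by
      have := integral_comp_measurePreserving (measurePreserving_mix_prod μ)
        (g := fun p => G p.1 * G p.2) ((hG.comp measurable_fst).mul (hG.comp measurable_snd))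
      rw [this, integral_prod_mul]
    simp_rw [mul_sub]
    rw [integral_sub, h2, h3, h1]
    · exact hint (C * C) ((hm _).mul (hm _)) fun z => hsq _ _ (hC _) (hC _)
    · exact hint (C * C) ((hm _).mul (hm _)) fun z => hsq _ _ (hC _) (hC _)
  rw [hvar]
  refine (integral_mul_sub_mix_le hG hC Finset.univ).trans ?_
  have hpos : ∀ i, Integrable (fun z => max 0 (G (mix ∅ z) - G (mix {i} z)) ^ 2) (pairLaw μ) :=
    fun i => hint ((C + C) ^ 2) ((measurable_const.max ((hm _).sub (hm _))).pow_const 2) fun z => by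
      rw [abs_of_nonneg (sq_nonneg _)]
      refine pow_le_pow_left₀ (le_max_left _ _) (max_le ?_ ?_) 2
      · linarith [(abs_nonneg _).trans (hC (mix ∅ z))]
      · linarith [(abs_le.1 (hC (mix ∅ z))).2, (abs_le.1 (hC (mix {i} z))).1]
  have hneg : ∀ i, Integrable (fun z => max 0 (G (mix {i} z) - G (mix ∅ z)) ^ 2) (pairLaw μ) :=
    fun i => hint ((C + C) ^ 2) ((measurable_const.max ((hm _).sub (hm _))).pow_const 2) fun z => by
      rw [abs_of_nonneg (sq_nonneg _)]
      refine pow_le_pow_left₀ (le_max_left _ _) (max_le ?_ ?_) 2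
      · linarith [(abs_nonneg _).trans (hC (mix ∅ z))]
      · linarith [(abs_le.1 (hC (mix {i} z))).2, (abs_le.1 (hC (mix ∅ z))).1]
  -- Exchanging coordinate i swaps the positive and negative parts of the difference, so only
  -- decrements from the base point need a bound. This is where a subgradient at a single point
  -- becomes sufficient.
  have hhalf : ∀ i, 1 / 2 * ∫ z, (G (mix ∅ z) - G (mix {i} z)) ^ 2 ∂(pairLaw μ) =
      ∫ z, max 0 (G (mix ∅ z) - G (mix {i} z)) ^ 2 ∂(pairLaw μ) := fun i => by
    have s1 := integral_exchange (μ := μ) (H := fun a b _ => max 0 (a - b) ^ 2) hG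
      (by fun_prop) {i} ∅ {i} ∅
    simp only [symmDiff_self, Finset.bot_eq_empty,
      show symmDiff (∅ : Finset ι) {i} = {i} by simp] at s1
    have e : ∀ z : ι → E × E, (G (mix ∅ z) - G (mix {i} z)) ^ 2 =
        max 0 (G (mix ∅ z) - G (mix {i} z)) ^ 2 + max 0 (G (mix {i} z) - G (mix ∅ z)) ^ 2 :=
      fun z => by
        rcases le_total (G (mix ∅ z)) (G (mix {i} z)) with h | h
        · rw [max_eq_left (by linarith), max_eq_right (by linarith)]; ring
        · rw [max_eq_right (by linarith), max_eq_left (by linarith)]; ring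
    simp_rw [e]
    rw [integral_add (hpos i) (hneg i), s1]
    ring
  simp_rw [hhalf]
  rw [← integral_finsetSum _ fun i _ => hpos i]
  refine (integral_mono (integrable_finsetSum _ fun i _ => hpos i) (integrable_const K)
    fun z => ?_).trans (by simp)
  have := hK (mix ∅ z) (mix Finset.univ z)
  have e : ∀ i, Function.update (mix ∅ z) i (mix Finset.univ z i) = mix {i} z := fun i => by
    funext j
    by_cases h : j = i
    · subst h; simp [mix]
    · simp [mix, h]
  simpa only [e] using this

end EfronStein

/-! ### Trace subgradients and eigenvalue interlacing -/

section Spectral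

open Matrix

variable {n : ℕ}

theorem exists_unitary_eq (A : Herm n) : ∃ U : Matrix (Fin n) (Fin n) ℂ, U * Uᴴ = 1 ∧ Uᴴ * U = 1 ∧
    (A : Matrix (Fin n) (Fin n) ℂ) = U * diagonal (fun i => (eigs A i : ℂ)) * Uᴴ := by
  refine ⟨A.isHermitian.eigenvectorUnitary, ?_, ?_, ?_⟩
  · exact Unitary.coe_mul_star_self A.isHermitian.eigenvectorUnitary
  · exact Unitary.coe_star_mul_self A.isHermitian.eigenvectorUnitary
  · conv_lhs => rw [A.isHermitian.spectral_theorem, Unitary.conjStarAlgAut_apply]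
    rfl

theorem trace_diagonal_mul_conj (a b : Fin n → ℝ) (Q : Matrix (Fin n) (Fin n) ℂ) :
    trace (diagonal (fun i => (a i : ℂ)) * (Q * diagonal (fun i => (b i : ℂ)) * Qᴴ)) =
      ((∑ i, ∑ j, a i * b j * ‖Q i j‖ ^ 2 : ℝ) : ℂ) := by
  simp only [trace, diag_apply, diagonal_mul, mul_apply (M := Q * _), mul_diagonal,
    conjTranspose_apply, Finset.mul_sum]
  push_cast
  refine Finset.sum_congr rfl fun i _ => Finset.sum_congr rfl fun j _ => ?_
  have : Q i j * star (Q i j) = ((‖Q i j‖ ^ 2 : ℝ) : ℂ) := by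
    rw [Complex.star_def, Complex.mul_conj, Complex.normSq_eq_norm_sq]
  push_cast at this
  rw [← this]
  ring

theorem sum_norm_sq_row {Q : Matrix (Fin n) (Fin n) ℂ} (hQ : Q * Qᴴ = 1) (i : Fin n) :
    ∑ j, ‖Q i j‖ ^ 2 = 1 := by
  have h := congrFun (congrFun hQ i) i
  simp only [mul_apply, conjTranspose_apply, one_apply_eq] at h
  have h2 : ∀ j, Q i j * star (Q i j) = ((‖Q i j‖ ^ 2 : ℝ) : ℂ) := fun j => by
    rw [Complex.star_def, Complex.mul_conj, Complex.normSq_eq_norm_sq]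
  simp_rw [h2] at h
  exact_mod_cast h

theorem sum_norm_sq_col {Q : Matrix (Fin n) (Fin n) ℂ} (hQ : Qᴴ * Q = 1) (j : Fin n) :
    ∑ i, ‖Q i j‖ ^ 2 = 1 := by
  have := sum_norm_sq_row (Q := Qᴴ) (by simpa using hQ) j
  simpa using this

theorem trace_sq_eq (A : Herm n) : ((A : Matrix (Fin n) (Fin n) ℂ) ^ 2).trace =
    ((∑ i, ∑ j, ‖(A : Matrix (Fin n) (Fin n) ℂ) i j‖ ^ 2 : ℝ) : ℂ) := by
  rw [sq]
  simp only [trace, diag_apply, mul_apply]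
  push_cast
  refine Finset.sum_congr rfl fun i _ => Finset.sum_congr rfl fun j _ => ?_
  rw [← A.isHermitian.apply j i, Complex.star_def, Complex.mul_conj, Complex.normSq_eq_norm_sq]
  push_cast; rfl

theorem sum_eigs_sq (A : Herm n) :
    ∑ i, eigs A i ^ 2 = ∑ i, ∑ j, ‖(A : Matrix (Fin n) (Fin n) ℂ) i j‖ ^ 2 := by
  have h := trace_sq_eq A
  rw [trace_pow_eq] at h
  exact_mod_cast h

/-- **Klein's inequality**: a trace function `∑ f(λᵢ)` with `f` convex, of subgradient `g` with
`|g| ≤ 1`, has at every Hermitian matrix a subgradient of Frobenius norm at most `√n`. -/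
theorem exists_trace_subgradient {f g : ℝ → ℝ} (hfg : ∀ s t, f s - f t ≤ g s * (s - t))
    (hg : ∀ s, |g s| ≤ 1) (A : Herm n) :
    ∃ H : Matrix (Fin n) (Fin n) ℂ, ∑ i, ∑ j, ‖H i j‖ ^ 2 ≤ n ∧ ∀ B : Herm n,
      ∑ i, f (eigs A i) - ∑ i, f (eigs B i) ≤ ((H * ((A : Matrix (Fin n) (Fin n) ℂ) - B)).trace).re := by
  obtain ⟨U, hU1, hU2, hA⟩ := exists_unitary_eq A
  have hHsa : (U * diagonal (fun i => (g (eigs A i) : ℂ)) * Uᴴ).IsHermitian := by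
    rw [IsHermitian, conjTranspose_mul, conjTranspose_mul, conjTranspose_conjTranspose,
      diagonal_conjTranspose, ← mul_assoc]
    congr 3
    funext i
    simp
  -- The subgradient is `g(A)`; its squared Frobenius norm is `∑ g(λᵢ)² ≤ n`.
  refine ⟨U * diagonal (fun i => (g (eigs A i) : ℂ)) * Uᴴ, ?_, fun B => ?_⟩
  · have h1 := trace_sq_eq ⟨_, hHsa⟩
    have h2 : (U * diagonal (fun i => (g (eigs A i) : ℂ)) * Uᴴ) ^ 2 =
        U * diagonal (fun i => ((g (eigs A i) ^ 2 : ℝ) : ℂ)) * Uᴴ := by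
      rw [sq]
      calc _ = U * diagonal (fun i => (g (eigs A i) : ℂ)) * (Uᴴ * U) *
            diagonal (fun i => (g (eigs A i) : ℂ)) * Uᴴ := by simp only [mul_assoc]
        _ = _ := by
          rw [hU2, mul_one, mul_assoc U, diagonal_mul_diagonal]
          simp [sq]
    have h3 : ∑ i, ∑ j, ‖(U * diagonal (fun i => (g (eigs A i) : ℂ)) * Uᴴ) i j‖ ^ 2 =
        ∑ i, g (eigs A i) ^ 2 := by
      have h4 : ((U * diagonal (fun i => (g (eigs A i) : ℂ)) * Uᴴ) ^ 2).trace =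
          ((∑ i, g (eigs A i) ^ 2 : ℝ) : ℂ) := by
        rw [h2, trace_mul_comm, ← mul_assoc, hU2, one_mul, trace_diagonal]
        push_cast; rfl
      rw [h4] at h1
      exact_mod_cast h1.symm
    rw [h3]
    calc ∑ i, g (eigs A i) ^ 2 ≤ ∑ _i : Fin n, (1 : ℝ) := Finset.sum_le_sum fun i _ => by
          rw [← sq_abs]; exact pow_le_one₀ (abs_nonneg _) (hg _)
      _ = n := by simp
  · obtain ⟨V, hV1, hV2, hB⟩ := exists_unitary_eq B
    -- The weights `‖Q i j‖²` between the two eigenbases are doubly stochastic, so the claim becomes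
    -- a weighted sum of the scalar subgradient inequality over pairs of eigenvalues.
    set Q := Uᴴ * V with hQ
    have hQ1 : Q * Qᴴ = 1 := by
      rw [hQ, conjTranspose_mul, conjTranspose_conjTranspose, mul_assoc, ← mul_assoc V, hV1,
        one_mul, hU2]
    have hQ2 : Qᴴ * Q = 1 := by
      rw [hQ, conjTranspose_mul, conjTranspose_conjTranspose, mul_assoc, ← mul_assoc U, hU1,
        one_mul, hV2]
    have tA : (U * diagonal (fun i => (g (eigs A i) : ℂ)) * Uᴴ * (A : Matrix _ _ ℂ)).trace =
        ((∑ i, g (eigs A i) * eigs A i : ℝ) : ℂ) := by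
      conv_lhs => rw [hA]
      calc _ = (U * (diagonal (fun i => (g (eigs A i) : ℂ)) * (Uᴴ * U) *
            diagonal (fun i => (eigs A i : ℂ)) * Uᴴ)).trace := by simp only [mul_assoc]
        _ = _ := by
          rw [hU2, mul_one, trace_mul_comm, mul_assoc, hU2, mul_one, diagonal_mul_diagonal,
            trace_diagonal]
          push_cast; rfl
    have tB : (U * diagonal (fun i => (g (eigs A i) : ℂ)) * Uᴴ * (B : Matrix _ _ ℂ)).trace =
        ((∑ i, ∑ j, g (eigs A i) * eigs B j * ‖Q i j‖ ^ 2 : ℝ) : ℂ) := by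
      rw [← trace_diagonal_mul_conj]
      conv_lhs => rw [hB]
      calc _ = (U * (diagonal (fun i => (g (eigs A i) : ℂ)) * Uᴴ * V *
            diagonal (fun i => (eigs B i : ℂ)) * Vᴴ)).trace := by simp only [mul_assoc]
        _ = _ := by
          rw [trace_mul_comm, hQ, conjTranspose_mul, conjTranspose_conjTranspose]
          simp only [mul_assoc]
    rw [mul_sub, trace_sub, tA, tB, Complex.sub_re, Complex.ofReal_re, Complex.ofReal_re]
    have e1 : ∀ F : ℝ → ℝ, ∑ i, F (eigs A i) = ∑ i, ∑ j, F (eigs A i) * ‖Q i j‖ ^ 2 := fun F => by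
      simp_rw [← Finset.mul_sum, sum_norm_sq_row hQ1, mul_one]
    have e2 : ∑ j, f (eigs B j) = ∑ i, ∑ j, f (eigs B j) * ‖Q i j‖ ^ 2 := by
      rw [Finset.sum_comm]
      simp_rw [← Finset.mul_sum, sum_norm_sq_col hQ2, mul_one]
    rw [e1 f, e2, e1 fun s => g s * s, ← Finset.sum_sub_distrib, ← Finset.sum_sub_distrib]
    refine Finset.sum_le_sum fun i _ => ?_
    rw [← Finset.sum_sub_distrib, ← Finset.sum_sub_distrib]
    refine Finset.sum_le_sum fun j _ => ?_
    have := mul_le_mul_of_nonneg_right (hfg (eigs A i) (eigs B j)) (sq_nonneg ‖Q i j‖)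
    linarith

theorem exists_quadratic_form (A : Herm n) : ∃ U : Matrix (Fin n) (Fin n) ℂ,
    (∀ v : Fin n → ℂ, ∑ i, ‖(U *ᵥ v) i‖ ^ 2 = ∑ i, ‖v i‖ ^ 2) ∧
    ∀ v : Fin n → ℂ, star v ⬝ᵥ ((A : Matrix (Fin n) (Fin n) ℂ) *ᵥ v) =
      ((∑ i, eigs A i * ‖(U *ᵥ v) i‖ ^ 2 : ℝ) : ℂ) := by
  obtain ⟨U, hU1, hU2, hA⟩ := exists_unitary_eq A
  have hself : ∀ w : Fin n → ℂ, star w ⬝ᵥ w = ((∑ i, ‖w i‖ ^ 2 : ℝ) : ℂ) := fun w => by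
    simp only [dotProduct, Pi.star_apply]
    push_cast
    refine Finset.sum_congr rfl fun i _ => ?_
    rw [mul_comm, Complex.star_def, Complex.mul_conj, Complex.normSq_eq_norm_sq]
    push_cast; rfl
  refine ⟨Uᴴ, fun v => ?_, fun v => ?_⟩
  · have h1 : star (Uᴴ *ᵥ v) ⬝ᵥ (Uᴴ *ᵥ v) = star v ⬝ᵥ v := by
      rw [star_mulVec, conjTranspose_conjTranspose, dotProduct_mulVec, vecMul_vecMul, hU1,
        vecMul_one]
    rw [hself, hself] at h1
    exact_mod_cast h1
  · conv_lhs => rw [hA]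
    rw [← mulVec_mulVec, ← mulVec_mulVec, dotProduct_mulVec]
    have : star v ᵥ* U = star (Uᴴ *ᵥ v) := by rw [star_mulVec, conjTranspose_conjTranspose]
    rw [this]
    simp only [dotProduct, Pi.star_apply, mulVec_diagonal]
    push_cast
    refine Finset.sum_congr rfl fun i _ => ?_
    have : (Uᴴ *ᵥ v) i * star ((Uᴴ *ᵥ v) i) = ((‖(Uᴴ *ᵥ v) i‖ ^ 2 : ℝ) : ℂ) := by
      rw [Complex.star_def, Complex.mul_conj, Complex.normSq_eq_norm_sq]
    push_cast at this
    rw [← this]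
    ring

open scoped Classical in
/-- The number of entries in which two matrices differ. -/
def diffCount (A B : Matrix (Fin n) (Fin n) ℂ) : ℕ :=
  (Finset.univ.filter fun p : Fin n × Fin n => A p.1 p.2 ≠ B p.1 p.2).card

open scoped Classical in
-- Interlacing by a dimension count. Let v lie in the span of the eigenvectors of A above t, be
-- orthogonal to those of B above t, and vanish on the columns where A and B differ. Then `Av = Bv`,
-- and the common quadratic form is at least `t‖v‖²`, strictly unless v = 0, and at most `t‖v‖²`. So
-- these linear conditions, whose number is `n - N_A + N_B + |J|`, define an injective map on ℂⁿ.
theorem card_eigs_gt_le (A B : Herm n) (t : ℝ) :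
    (Finset.univ.filter fun i => t < eigs A i).card ≤
      (Finset.univ.filter fun i => t < eigs B i).card +
        diffCount (A : Matrix (Fin n) (Fin n) ℂ) B := by
  obtain ⟨U, hU, hUA⟩ := exists_quadratic_form A
  obtain ⟨V, hV, hVB⟩ := exists_quadratic_form B
  set J := {j : Fin n // ∃ i, (A : Matrix (Fin n) (Fin n) ℂ) i j ≠ (B : Matrix (Fin n) (Fin n) ℂ) i j}
  set S := {i : Fin n // ¬ t < eigs A i}
  set T := {i : Fin n // t < eigs B i}
  let L : (Fin n → ℂ) →ₗ[ℂ] (S → ℂ) × (T → ℂ) × (J → ℂ) :=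
    (LinearMap.pi fun i : S => LinearMap.proj i.1 ∘ₗ U.mulVecLin).prod
      ((LinearMap.pi fun i : T => LinearMap.proj i.1 ∘ₗ V.mulVecLin).prod
        (LinearMap.pi fun j : J => LinearMap.proj j.1))
  have hL : Function.Injective L := by
    rw [← LinearMap.ker_eq_bot, LinearMap.ker_eq_bot']
    intro v hv
    have h1 : ∀ i : Fin n, ¬ t < eigs A i → (U *ᵥ v) i = 0 := fun i hi =>
      congrFun (congrArg Prod.fst hv) (⟨i, hi⟩ : S)
    have h2 : ∀ i : Fin n, t < eigs B i → (V *ᵥ v) i = 0 := fun i hi =>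
      congrFun (congrArg (fun p => p.2.1) hv) (⟨i, hi⟩ : T)
    have h3 : ∀ j : Fin n, (∃ i, (A : Matrix (Fin n) (Fin n) ℂ) i j ≠
        (B : Matrix (Fin n) (Fin n) ℂ) i j) → v j = 0 := fun j hj =>
      congrFun (congrArg (fun p => p.2.2) hv) (⟨j, hj⟩ : J)
    have h4 : (A : Matrix (Fin n) (Fin n) ℂ) *ᵥ v = (B : Matrix (Fin n) (Fin n) ℂ) *ᵥ v := by
      funext i
      simp only [mulVec, dotProduct]
      refine Finset.sum_congr rfl fun j _ => ?_
      by_cases h : (A : Matrix (Fin n) (Fin n) ℂ) i j = (B : Matrix (Fin n) (Fin n) ℂ) i j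
      · rw [h]
      · rw [h3 j ⟨i, h⟩, mul_zero, mul_zero]
    have h5 : ∑ i, eigs A i * ‖(U *ᵥ v) i‖ ^ 2 = ∑ i, eigs B i * ‖(V *ᵥ v) i‖ ^ 2 := by
      have := hUA v
      rw [h4, hVB v] at this
      exact_mod_cast this.symm
    have h6 : ∑ i, eigs B i * ‖(V *ᵥ v) i‖ ^ 2 ≤ ∑ i, t * ‖(V *ᵥ v) i‖ ^ 2 :=
      Finset.sum_le_sum fun i _ => by
        by_cases h : t < eigs B i
        · simp [h2 i h]
        · exact mul_le_mul_of_nonneg_right (not_lt.1 h) (sq_nonneg _)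
    have h7 : ∀ i, t * ‖(U *ᵥ v) i‖ ^ 2 ≤ eigs A i * ‖(U *ᵥ v) i‖ ^ 2 := fun i => by
      by_cases h : t < eigs A i
      · exact mul_le_mul_of_nonneg_right h.le (sq_nonneg _)
      · simp [h1 i h]
    have h8 : ∑ i, t * ‖(U *ᵥ v) i‖ ^ 2 = ∑ i, t * ‖(V *ᵥ v) i‖ ^ 2 := by
      rw [← Finset.mul_sum, ← Finset.mul_sum, hU, hV]
    -- The chain of inequalities closes on itself, which forces equality in every term.
    have h9 : ∀ i, t * ‖(U *ᵥ v) i‖ ^ 2 = eigs A i * ‖(U *ᵥ v) i‖ ^ 2 := fun i =>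
      (Finset.sum_eq_sum_iff_of_le fun i _ => h7 i).1
        (le_antisymm (Finset.sum_le_sum fun i _ => h7 i) (by rw [h5, h8]; exact h6)) i
        (Finset.mem_univ i)
    have h10 : ∀ i, ‖(U *ᵥ v) i‖ ^ 2 = 0 := fun i => by
      by_cases h : t < eigs A i
      · by_contra hne
        exact absurd (mul_right_cancel₀ hne (h9 i)) h.ne
      · simp [h1 i h]
    have h11 := hU v
    simp only [h10, Finset.sum_const_zero] at h11
    funext j
    have := (Finset.sum_eq_zero_iff_of_nonneg fun i _ => sq_nonneg ‖v i‖).1 h11.symm j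
      (Finset.mem_univ j)
    simpa using this
  have hrank := LinearMap.finrank_le_finrank_of_injective hL
  rw [Module.finrank_prod, Module.finrank_prod, Module.finrank_fintype_fun_eq_card,
    Module.finrank_fintype_fun_eq_card, Module.finrank_fintype_fun_eq_card,
    Module.finrank_fintype_fun_eq_card, Fintype.card_fin] at hrank
  have hS : Fintype.card S + (Finset.univ.filter fun i => t < eigs A i).card = n := by
    have := Finset.card_filter_add_card_filter_not (s := (Finset.univ : Finset (Fin n)))
      (fun i => t < eigs A i)
    rw [Fintype.card_subtype, add_comm]
    simpa using this
  have hT : Fintype.card T = (Finset.univ.filter fun i => t < eigs B i).card :=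
    Fintype.card_subtype _
  have hJ : Fintype.card J ≤ diffCount (A : Matrix (Fin n) (Fin n) ℂ) B := by
    rw [Fintype.card_subtype, diffCount]
    have : (Finset.univ.filter fun j : Fin n => ∃ i, (A : Matrix (Fin n) (Fin n) ℂ) i j ≠
        (B : Matrix (Fin n) (Fin n) ℂ) i j) ⊆ (Finset.univ.filter fun p : Fin n × Fin n =>
        (A : Matrix (Fin n) (Fin n) ℂ) p.1 p.2 ≠ (B : Matrix (Fin n) (Fin n) ℂ) p.1 p.2).image
          Prod.snd := by
      intro j hj
      obtain ⟨i, hi⟩ := (Finset.mem_filter.1 hj).2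
      exact Finset.mem_image.2 ⟨(i, j), Finset.mem_filter.2 ⟨Finset.mem_univ _, hi⟩, rfl⟩
    exact (Finset.card_le_card this).trans Finset.card_image_le
  omega

end Spectral

/-! ### Truncated matrices and block decrements -/

section Truncation

variable {n : ℕ}

/-- Truncation of a complex number at level `T`. -/
def cut (T : ℝ) (z : ℂ) : ℂ := if ‖z‖ ≤ T then z else 0

theorem measurable_cut (T : ℝ) : Measurable (cut T) :=
  Measurable.ite (measurableSet_le measurable_norm measurable_const) measurable_id measurable_const

theorem norm_cut_le {T : ℝ} (hT : 0 ≤ T) (z : ℂ) : ‖cut T z‖ ≤ T := by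
  rw [cut]; split_ifs with h <;> simp [h, hT]

theorem star_cut (T : ℝ) (z : ℂ) : star (cut T z) = cut T (star z) := by
  rw [cut, cut, norm_star]; split_ifs <;> simp

/-- The Hermitian part of an array of complex numbers. -/
def hermPart (M : Fin n × Fin n → ℂ) : Herm n :=
  ⟨Matrix.of fun i j => (M (i, j) + star (M (j, i))) / 2, by
    ext i j
    simp [add_comm]⟩

theorem hermPart_apply (M : Fin n × Fin n → ℂ) (i j : Fin n) :
    (hermPart M : Matrix (Fin n) (Fin n) ℂ) i j = (M (i, j) + star (M (j, i))) / 2 := rfl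

/-- The entrywise truncation of a Hermitian matrix at level `T`. -/
def truncHerm (T : ℝ) (A : Herm n) : Herm n :=
  hermPart fun p => cut T ((A : Matrix (Fin n) (Fin n) ℂ) p.1 p.2)

theorem truncHerm_apply (T : ℝ) (A : Herm n) (i j : Fin n) :
    (truncHerm T A : Matrix (Fin n) (Fin n) ℂ) i j =
      cut T ((A : Matrix (Fin n) (Fin n) ℂ) i j) := by
  rw [truncHerm, hermPart_apply]
  simp only [star_cut, A.isHermitian.apply]
  ring

theorem isRandomHerm_hermPart {Ω : Type*} [MeasurableSpace Ω] {M : Ω → Fin n × Fin n → ℂ}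
    (hM : Measurable M) : IsRandomHerm fun ω => hermPart (M ω) := fun i j => by
  have h : ∀ p, Measurable fun ω => M ω p := fun p => (measurable_pi_apply p).comp hM
  simp only [hermPart_apply]
  exact ((h _).add (continuous_star.measurable.comp (h _))).div_const _

theorem IsRandomHerm.truncHerm {Ω : Type*} [MeasurableSpace Ω] {X : Ω → Herm n}
    (hX : IsRandomHerm X) (T : ℝ) : IsRandomHerm fun ω => truncHerm T (X ω) :=
  isRandomHerm_hermPart (measurable_pi_lambda _ fun p => (measurable_cut T).comp (hX p.1 p.2))

/-- The positive part `(s - a)⁺`. -/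
def hinge (a s : ℝ) : ℝ := max 0 (s - a)

theorem continuous_hinge (a : ℝ) : Continuous (hinge a) := by unfold hinge; fun_prop

theorem hinge_nonneg (a s : ℝ) : 0 ≤ hinge a s := le_max_left _ _

theorem hinge_sub_le (a s t : ℝ) :
    hinge a s - hinge a t ≤ (if a < s then 1 else 0) * (s - t) := by
  unfold hinge
  split_ifs with h
  · rw [max_eq_right (by linarith)]
    linarith [le_max_right 0 (t - a)]
  · rw [max_eq_left (by linarith)]
    linarith [le_max_left 0 (t - a)]

/-- The normalized trace of `(A - a)⁺`. -/
def hingeTrace (a : ℝ) (A : Herm n) : ℝ := (n : ℝ)⁻¹ * ∑ i, hinge a (eigs A i)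

theorem hingeTrace_nonneg (a : ℝ) (A : Herm n) : 0 ≤ hingeTrace a A :=
  mul_nonneg (by positivity) (Finset.sum_nonneg fun _ _ => hinge_nonneg _ _)

theorem IsRandomHerm.measurable_hingeTrace {Ω : Type*} [MeasurableSpace Ω] {X : Ω → Herm n}
    (hX : IsRandomHerm X) (a : ℝ) : Measurable fun ω => hingeTrace a (X ω) :=
  (hX.measurable_sum_continuous (continuous_hinge a)).const_mul _

/-- The coordinates resampled in Efron–Stein are unconstrained arrays, so the subgradient is pulled
back along the Hermitian part. The adjoint symmetrizes H, which does not increase its Frobenius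
norm. -/
theorem exists_hingeTrace_subgradient (a : ℝ) (M : Fin n × Fin n → ℂ) :
    ∃ c : Fin n × Fin n → ℂ, ∑ p, ‖c p‖ ^ 2 ≤ n ∧ ∀ M' : Fin n × Fin n → ℂ,
      hingeTrace a (hermPart M) - hingeTrace a (hermPart M') ≤
        (n : ℝ)⁻¹ * ∑ p, ‖c p‖ * ‖M p - M' p‖ := by
  obtain ⟨H, hH, hle⟩ := exists_trace_subgradient (hinge_sub_le a)
    (fun s => by split_ifs <;> simp) (hermPart M)
  refine ⟨fun p => (H p.2 p.1 + star (H p.1 p.2)) / 2, ?_, fun M' => ?_⟩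
  · have h1 : ∀ p : Fin n × Fin n, ‖(H p.2 p.1 + star (H p.1 p.2)) / 2‖ ^ 2 ≤
        (‖H p.2 p.1‖ ^ 2 + ‖H p.1 p.2‖ ^ 2) / 2 := fun p => by
      have h2 : ‖(H p.2 p.1 + star (H p.1 p.2)) / 2‖ ≤ (‖H p.2 p.1‖ + ‖H p.1 p.2‖) / 2 := by
        rw [norm_div, Complex.norm_ofNat]
        gcongr
        exact (norm_add_le _ _).trans (by rw [norm_star])
      refine (pow_le_pow_left₀ (norm_nonneg _) h2 2).trans ?_
      nlinarith [sq_nonneg (‖H p.2 p.1‖ - ‖H p.1 p.2‖)]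
    refine (Finset.sum_le_sum fun p _ => h1 p).trans ?_
    rw [← Finset.sum_div, Finset.sum_add_distrib, Fintype.sum_prod_type, Fintype.sum_prod_type,
      Finset.sum_comm]
    simp only
    linarith
  · rw [hingeTrace, hingeTrace, ← mul_sub]
    refine mul_le_mul_of_nonneg_left ((hle (hermPart M')).trans ?_) (by positivity)
    have h1 : ((H * ((hermPart M : Matrix (Fin n) (Fin n) ℂ) - hermPart M')).trace).re =
        ∑ p : Fin n × Fin n, (((H p.2 p.1 + star (H p.1 p.2)) / 2) * (M p - M' p)).re := by
      have e1 : ∀ i j, (H i j * ((hermPart M : Matrix (Fin n) (Fin n) ℂ) - hermPart M') j i).re =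
          (H i j / 2 * (M (j, i) - M' (j, i))).re +
            (star (H i j) / 2 * (M (i, j) - M' (i, j))).re := fun i j => by
        rw [Matrix.sub_apply, hermPart_apply, hermPart_apply]
        simp only [Complex.star_def, Complex.mul_re, Complex.sub_re, Complex.sub_im,
          Complex.add_re, Complex.add_im, Complex.div_ofNat_re, Complex.div_ofNat_im,
          Complex.conj_re, Complex.conj_im]
        ring
      simp only [Matrix.trace, Matrix.diag_apply, Matrix.mul_apply, Complex.re_sum, e1,
        Finset.sum_add_distrib]
      rw [Finset.sum_comm, Fintype.sum_prod_type]
      simp only [← Finset.sum_add_distrib]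
      refine Finset.sum_congr rfl fun i _ => Finset.sum_congr rfl fun j _ => ?_
      rw [← Complex.add_re]
      congr 1
      ring
    rw [h1]
    refine Finset.sum_le_sum fun p _ => ?_
    exact (Complex.re_le_norm _).trans (norm_mul_le _ _)

/-- The truncated array whose entry `p` is read off from the vector of the block `κ p`. -/
def assemble {β : Type*} (κ : Fin n × Fin n → β) (T : ℝ) (z : β → Fin n × Fin n → ℂ)
    (p : Fin n × Fin n) : ℂ := cut T (z (κ p) p)

/-- Only the entries of block b change, each by at most 2T; Cauchy–Schwarz on the block gives `4T²d
∑ ‖c p‖²` over it. As the same subgradient c at z serves every block, these sums add up to at most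
n. -/
theorem sum_sq_decrement_le {β : Type*} [Fintype β] [DecidableEq β] (κ : Fin n × Fin n → β)
    {T : ℝ} (hT : 0 ≤ T) {d : ℕ} (hd : ∀ b, (Finset.univ.filter fun p => κ p = b).card ≤ d) (a : ℝ)
    (z w : β → Fin n × Fin n → ℂ) :
    ∑ b, max 0 (hingeTrace a (hermPart (assemble κ T z)) -
      hingeTrace a (hermPart (assemble κ T (Function.update z b (w b))))) ^ 2 ≤
      4 * T ^ 2 * d / n := by
  obtain ⟨c, hc, hle⟩ := exists_hingeTrace_subgradient a (assemble κ T z)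
  have hb : ∀ b, max 0 (hingeTrace a (hermPart (assemble κ T z)) -
      hingeTrace a (hermPart (assemble κ T (Function.update z b (w b))))) ^ 2 ≤
      ((n : ℝ)⁻¹) ^ 2 * (4 * T ^ 2 * d) * ∑ p with κ p = b, ‖c p‖ ^ 2 := fun b => by
    have h1 : hingeTrace a (hermPart (assemble κ T z)) -
        hingeTrace a (hermPart (assemble κ T (Function.update z b (w b)))) ≤
        (n : ℝ)⁻¹ * ∑ p with κ p = b, ‖c p‖ * (2 * T) := by
      refine (hle _).trans (mul_le_mul_of_nonneg_left ?_ (by positivity))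
      rw [Finset.sum_filter]
      refine Finset.sum_le_sum fun p _ => ?_
      split_ifs with h
      · refine mul_le_mul_of_nonneg_left ?_ (norm_nonneg _)
        refine (norm_sub_le _ _).trans ?_
        have h2 := norm_cut_le hT (z (κ p) p)
        have h3 := norm_cut_le hT (Function.update z b (w b) (κ p) p)
        simp only [assemble]
        linarith
      · simp [assemble, Function.update_of_ne h]
    have h4 : (∑ p with κ p = b, ‖c p‖ * (2 * T)) ^ 2 ≤
        (∑ p with κ p = b, ‖c p‖ ^ 2) * ∑ p with κ p = b, (2 * T) ^ 2 :=
      Finset.sum_mul_sq_le_sq_mul_sq _ _ _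
    have h5 : ∑ p with κ p = b, (2 * T) ^ 2 ≤ 4 * T ^ 2 * d := by
      rw [Finset.sum_const, nsmul_eq_mul]
      have : ((Finset.univ.filter fun p => κ p = b).card : ℝ) ≤ d := by exact_mod_cast hd b
      nlinarith [sq_nonneg T]
    have h6 : 0 ≤ (n : ℝ)⁻¹ * ∑ p with κ p = b, ‖c p‖ * (2 * T) := by positivity
    calc _ ≤ ((n : ℝ)⁻¹ * ∑ p with κ p = b, ‖c p‖ * (2 * T)) ^ 2 :=
          pow_le_pow_left₀ (le_max_left _ _) (max_le h6 h1) 2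
      _ = ((n : ℝ)⁻¹) ^ 2 * (∑ p with κ p = b, ‖c p‖ * (2 * T)) ^ 2 := by rw [mul_pow]
      _ ≤ ((n : ℝ)⁻¹) ^ 2 * ((∑ p with κ p = b, ‖c p‖ ^ 2) * (4 * T ^ 2 * d)) := by
          refine mul_le_mul_of_nonneg_left (h4.trans ?_) (by positivity)
          exact mul_le_mul_of_nonneg_left h5 (Finset.sum_nonneg fun _ _ => sq_nonneg _)
      _ = _ := by ring
  refine (Finset.sum_le_sum fun b _ => hb b).trans ?_
  rw [← Finset.mul_sum, Finset.sum_fiberwise]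
  rcases Nat.eq_zero_or_pos n with h0 | h0
  · subst h0; simp
  · have hn : (0 : ℝ) < n := by exact_mod_cast h0
    calc _ ≤ ((n : ℝ)⁻¹) ^ 2 * (4 * T ^ 2 * d) * n := by gcongr
      _ = _ := by field_simp

/-- A crude bound, from `‖c‖ ≤ 1 + ‖c‖²`, serving only the boundedness requirement of Efron–Stein
and integrability. -/
theorem hingeTrace_hermPart_le {T : ℝ} (a : ℝ) {M : Fin n × Fin n → ℂ}
    (hM : ∀ p, ‖M p‖ ≤ T) :
    hingeTrace a (hermPart M) ≤ hingeTrace a (hermPart (0 : Fin n × Fin n → ℂ)) +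
      (n : ℝ)⁻¹ * (((n : ℝ) ^ 2 + n) * T) := by
  obtain ⟨c, hc, hle⟩ := exists_hingeTrace_subgradient a M
  have h1 := hle 0
  have h2 : ∑ p, ‖c p‖ * ‖M p - (0 : Fin n × Fin n → ℂ) p‖ ≤ ((n : ℝ) ^ 2 + n) * T := by
    calc _ ≤ ∑ p, (1 + ‖c p‖ ^ 2) * T := Finset.sum_le_sum fun p _ => by
          rw [Pi.zero_apply, sub_zero]
          refine mul_le_mul ?_ (hM p) (norm_nonneg _) (by positivity)
          nlinarith [sq_nonneg (‖c p‖ - 1), norm_nonneg (c p)]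
      _ = ((n : ℝ) ^ 2 + ∑ p, ‖c p‖ ^ 2) * T := by
          rw [← Finset.sum_mul, Finset.sum_add_distrib]
          simp [sq]
      _ ≤ _ := by
          rcases isEmpty_or_nonempty (Fin n × Fin n) with h | ⟨⟨p⟩⟩
          · have : n = 0 := by
              rcases n with _ | n
              · rfl
              · exact (h.false (0, 0)).elim
            subst this; simp
          · have hT := (norm_nonneg _).trans (hM p)
            gcongr
  have := mul_le_mul_of_nonneg_left h2 (show 0 ≤ (n : ℝ)⁻¹ by positivity)
  linarith

theorem exists_abs_hingeTrace_truncHerm_le {T : ℝ} (hT : 0 ≤ T) (a : ℝ) :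
    ∃ C, ∀ A : Herm n, |hingeTrace a (truncHerm T A)| ≤ C :=
  ⟨hingeTrace a (hermPart (0 : Fin n × Fin n → ℂ)) + (n : ℝ)⁻¹ * (((n : ℝ) ^ 2 + n) * T),
    fun A => by
      rw [abs_of_nonneg (hingeTrace_nonneg _ _)]
      exact hingeTrace_hermPart_le a fun p => norm_cut_le hT _⟩

end Truncation

/-! ### Variance of hinge traces under block independence -/

section Concentration

variable {n : ℕ} {Ω : Type*} [MeasurableSpace Ω] {P : Measure Ω} [IsProbabilityMeasure P]

/-- The variance of the normalized trace of `(A - a)⁺` for a matrix with independent blocks of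
bounded size, truncated at a small level. -/
theorem BlockIndep.variance_hingeTrace_le {Z : Ω → Herm n} (hZ : IsRandomHerm Z) {d : ℕ}
    (hd : BlockIndep P (fun ω => (Z ω : Matrix (Fin n) (Fin n) ℂ)) d) {T : ℝ} (hT : 0 ≤ T)
    (a : ℝ) :
    ∫ ω, (hingeTrace a (truncHerm T (Z ω)) - ∫ ω', hingeTrace a (truncHerm T (Z ω')) ∂P) ^ 2 ∂P ≤
      4 * T ^ 2 * d / n := by
  obtain ⟨Q, hcard, hind⟩ := hd
  classical
  let κ : Fin n × Fin n → Q.parts := fun p => ⟨Q.part p, Q.part_mem.2 (Finset.mem_univ p)⟩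
  -- Block vectors live in different spaces; extension by zero puts them all in the space of full
  -- arrays.
  let ext : ∀ B : Q.parts, (B.1 → ℂ) → Fin n × Fin n → ℂ := fun B v p =>
    if h : p ∈ B.1 then v ⟨p, h⟩ else 0
  have hext : ∀ B, Measurable (ext B) := fun B => measurable_pi_lambda _ fun p => by
    by_cases h : p ∈ B.1
    · simpa only [ext, h, dif_pos] using measurable_pi_apply _
    · simp only [ext, h, dif_neg, not_false_iff]; exact measurable_const
  let ξ : Q.parts → Ω → Fin n × Fin n → ℂ := fun B ω =>
    ext B fun p => (Z ω : Matrix (Fin n) (Fin n) ℂ) p.1.1 p.1.2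
  have hξm : ∀ B, Measurable (ξ B) := fun B =>
    (hext B).comp (measurable_pi_lambda _ fun p => hZ p.1.1 p.1.2)
  have hξ : iIndepFun ξ P := hind.comp ext hext
  have hlaw := (iIndepFun_iff_map_fun_eq_pi_map fun B => (hξm B).aemeasurable).1 hξ
  have hprob : ∀ B, IsProbabilityMeasure (P.map (ξ B)) := fun B =>
    Measure.isProbabilityMeasure_map (hξm B).aemeasurable
  let G : (Q.parts → Fin n × Fin n → ℂ) → ℝ := fun z => hingeTrace a (hermPart (assemble κ T z))
  have hGm : Measurable G := (isRandomHerm_hermPart (measurable_pi_lambda _ fun p =>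
    (measurable_cut T).comp ((measurable_pi_apply p).comp
      (measurable_pi_apply (κ p))))).measurable_hingeTrace a
  have hGC : ∀ z, |G z| ≤ hingeTrace a (hermPart (0 : Fin n × Fin n → ℂ)) +
      (n : ℝ)⁻¹ * (((n : ℝ) ^ 2 + n) * T) := fun z => by
    rw [abs_of_nonneg (hingeTrace_nonneg _ _)]
    exact hingeTrace_hermPart_le a fun p => norm_cut_le hT _
  have hκ : ∀ b, (Finset.univ.filter fun p => κ p = b).card ≤ d := fun b => by
    refine le_trans (Finset.card_le_card fun p hp => ?_) (hcard b.1 b.2)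
    have h1 := (Finset.mem_filter.1 hp).2
    rw [← h1]
    exact Q.mem_part (Finset.mem_univ p)
  have hES := efronStein (μ := fun B => P.map (ξ B)) hGm hGC
    fun z w => sum_sq_decrement_le κ hT hκ a z w
  have hmξ : Measurable fun ω B => ξ B ω := measurable_pi_lambda _ hξm
  have hGξ : ∀ ω, G (fun B => ξ B ω) = hingeTrace a (truncHerm T (Z ω)) := fun ω => by
    simp only [G, truncHerm]
    congr 2
    funext p
    have : p ∈ (κ p).1 := Q.mem_part (Finset.mem_univ p)
    simp [assemble, ξ, ext, this]
  rw [← hlaw, integral_map hmξ.aemeasurable (by fun_prop),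
    integral_map hmξ.aemeasurable (by fun_prop)] at hES
  simpa only [hGξ] using hES

end Concentration

/-! ### Ramps and low-rank perturbations -/

section Ramp

/-- The continuous function which vanishes on `(-∞, a]`, is `1` on `[b, ∞)` and is affine on
`[a, b]`. -/
def ramp (a b s : ℝ) : ℝ := (hinge a s - hinge b s) / (b - a)

theorem continuous_ramp (a b : ℝ) : Continuous (ramp a b) :=
  ((continuous_hinge a).sub (continuous_hinge b)).div_const _

theorem ramp_of_le {a b s : ℝ} (hab : a < b) (hs : s ≤ a) : ramp a b s = 0 := by
  rw [ramp, hinge, hinge, max_eq_left (by linarith), max_eq_left (by linarith)]; simp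

theorem ramp_of_ge {a b s : ℝ} (hab : a < b) (hs : b ≤ s) : ramp a b s = 1 := by
  rw [ramp, hinge, hinge, max_eq_right (by linarith), max_eq_right (by linarith)]
  rw [div_eq_one_iff_eq (by linarith)]; ring

theorem ramp_nonneg {a b : ℝ} (hab : a < b) (s : ℝ) : 0 ≤ ramp a b s := by
  refine div_nonneg (sub_nonneg.2 ?_) (by linarith)
  exact max_le_max le_rfl (by linarith)

theorem ramp_le_one {a b : ℝ} (hab : a < b) (s : ℝ) : ramp a b s ≤ 1 := by
  rw [ramp, div_le_one (by linarith), hinge, hinge]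
  have h1 := le_max_left 0 (s - b)
  have h2 := le_max_right 0 (s - b)
  rcases max_choice 0 (s - a) with h | h <;> rw [h] <;> linarith

theorem abs_ramp_le_one {a b : ℝ} (hab : a < b) (s : ℝ) : |ramp a b s| ≤ 1 := by
  rw [abs_of_nonneg (ramp_nonneg hab s)]; exact ramp_le_one hab s

theorem integrable_ramp {a b : ℝ} (hab : a < b) (μ : Measure ℝ) [IsFiniteMeasure μ] :
    Integrable (ramp a b) μ :=
  Integrable.of_bound (continuous_ramp a b).aestronglyMeasurable 1
    (ae_of_all _ fun s => abs_ramp_le_one hab s)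

/-- A ramp is an average of step functions over thresholds in `(a, b]`, which transfers eigenvalue
counts to ramps. -/
theorem integral_step {a b : ℝ} (hab : a < b) (s : ℝ) :
    ∫ t in Set.Ioc a b, (Set.Iio s).indicator (fun _ => (1 : ℝ)) t = hinge a s - hinge b s := by
  rw [integral_indicator measurableSet_Iio, setIntegral_const, smul_eq_mul, mul_one,
    measureReal_restrict_apply measurableSet_Iio, hinge, hinge]
  rcases le_or_gt s a with h | h
  · rw [max_eq_left (by linarith), max_eq_left (by linarith)]
    have : Set.Iio s ∩ Set.Ioc a b = ∅ := by
      ext t; simp only [Set.mem_inter_iff, Set.mem_Iio, Set.mem_Ioc, Set.mem_empty_iff_false,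
        iff_false]; rintro ⟨h1, h2, _⟩; linarith
    simp [this]
  · rcases le_or_gt s b with h' | h'
    · rw [max_eq_right (by linarith), max_eq_left (by linarith)]
      have : Set.Iio s ∩ Set.Ioc a b = Set.Ioo a s := by
        ext t; simp only [Set.mem_inter_iff, Set.mem_Iio, Set.mem_Ioc, Set.mem_Ioo]
        constructor
        · rintro ⟨h1, h2, _⟩; exact ⟨h2, h1⟩
        · rintro ⟨h1, h2⟩; exact ⟨h2, h1, by linarith⟩
      rw [this, Real.volume_real_Ioo_of_le h.le]; ring
    · rw [max_eq_right (by linarith), max_eq_right (by linarith)]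
      have : Set.Iio s ∩ Set.Ioc a b = Set.Ioc a b := by
        ext t; simp only [Set.mem_inter_iff, Set.mem_Iio, Set.mem_Ioc]
        constructor
        · rintro ⟨_, h2⟩; exact h2
        · rintro ⟨h1, h2⟩; exact ⟨by linarith, h1, h2⟩
      rw [this, Real.volume_real_Ioc_of_le hab.le]; ring

variable {n : ℕ}

/-- The integral of a ramp with respect to the empirical spectral distribution. -/
def rampMean (a b : ℝ) (A : Herm n) : ℝ := (n : ℝ)⁻¹ * ∑ i, ramp a b (eigs A i)

theorem rampMean_eq (a b : ℝ) (A : Herm n) :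
    rampMean a b A = (hingeTrace a A - hingeTrace b A) / (b - a) := by
  simp only [rampMean, hingeTrace, ramp]
  rw [← Finset.sum_div, Finset.sum_sub_distrib]
  ring

theorem rampMean_nonneg {a b : ℝ} (hab : a < b) (A : Herm n) : 0 ≤ rampMean a b A :=
  mul_nonneg (by positivity) (Finset.sum_nonneg fun _ _ => ramp_nonneg hab _)

theorem rampMean_le_one {a b : ℝ} (hab : a < b) (A : Herm n) : rampMean a b A ≤ 1 := by
  have h : ∑ i, ramp a b (eigs A i) ≤ n := by
    calc _ ≤ ∑ _i : Fin n, (1 : ℝ) := Finset.sum_le_sum fun i _ => ramp_le_one hab _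
      _ = n := by simp
  rw [rampMean]
  rcases Nat.eq_zero_or_pos n with h0 | h0
  · subst h0; simp
  · rw [inv_mul_le_iff₀ (by exact_mod_cast h0)]; linarith

/-- The interlacing inequality averaged over the threshold `t ∈ (a, b]`; no dependence on `b - a`
remains. -/
theorem rampMean_le_add {a b : ℝ} (hab : a < b) (A B : Herm n) :
    rampMean a b A ≤ rampMean a b B +
      (n : ℝ)⁻¹ * diffCount (A : Matrix (Fin n) (Fin n) ℂ) B := by
  have hint : ∀ s : ℝ, Integrable ((Set.Iio s).indicator fun _ => (1 : ℝ))
      (volume.restrict (Set.Ioc a b)) := fun s =>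
    (integrable_const _).indicator measurableSet_Iio
  have hsum : ∀ A : Herm n, ∑ i, ramp a b (eigs A i) = (b - a)⁻¹ *
      ∫ t in Set.Ioc a b, ∑ i, (Set.Iio (eigs A i)).indicator (fun _ => (1 : ℝ)) t := fun A => by
    rw [integral_finsetSum _ fun i _ => hint _]
    simp only [integral_step hab, ramp, Finset.mul_sum, div_eq_inv_mul]
  have hcount : ∀ (A : Herm n) (t : ℝ),
      ∑ i, (Set.Iio (eigs A i)).indicator (fun _ => (1 : ℝ)) t =
        ((Finset.univ.filter fun i => t < eigs A i).card : ℝ) := fun A t => by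
    simp [Set.indicator, Finset.sum_boole]
  have hle : ∑ i, ramp a b (eigs A i) ≤ ∑ i, ramp a b (eigs B i) +
      diffCount (A : Matrix (Fin n) (Fin n) ℂ) B := by
    rw [hsum, hsum]
    have h1 : ∫ t in Set.Ioc a b, ∑ i, (Set.Iio (eigs A i)).indicator (fun _ => (1 : ℝ)) t ≤
        ∫ t in Set.Ioc a b, (∑ i, (Set.Iio (eigs B i)).indicator (fun _ => (1 : ℝ)) t +
          (diffCount (A : Matrix (Fin n) (Fin n) ℂ) B : ℝ)) := by
      refine integral_mono (integrable_finsetSum _ fun i _ => hint _)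
        ((integrable_finsetSum _ fun i _ => hint _).add (integrable_const _)) fun t => ?_
      simp only [hcount]
      have := card_eigs_gt_le A B t
      norm_cast
    rw [integral_add (integrable_finsetSum _ fun i _ => hint _) (integrable_const _),
      setIntegral_const, Real.volume_real_Ioc_of_le hab.le, smul_eq_mul] at h1
    have h2 : 0 < b - a := by linarith
    calc _ ≤ (b - a)⁻¹ * (_ + (b - a) * (diffCount (A : Matrix (Fin n) (Fin n) ℂ) B : ℝ)) :=
          mul_le_mul_of_nonneg_left h1 (by positivity)
      _ = _ := by rw [mul_add, inv_mul_cancel_left₀ h2.ne']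
  rw [rampMean, rampMean, ← mul_add]
  exact mul_le_mul_of_nonneg_left hle (by positivity)

theorem diffCount_comm (A B : Matrix (Fin n) (Fin n) ℂ) : diffCount A B = diffCount B A := by
  simp only [diffCount, ne_comm]

theorem abs_rampMean_sub_le {a b : ℝ} (hab : a < b) (A B : Herm n) :
    |rampMean a b A - rampMean a b B| ≤
      (n : ℝ)⁻¹ * diffCount (A : Matrix (Fin n) (Fin n) ℂ) B := by
  have h1 := rampMean_le_add hab A B
  have h2 := rampMean_le_add hab B A
  rw [diffCount_comm] at h2
  rw [abs_le]; constructor <;> linarith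

theorem diffCount_truncHerm_le (A : Herm n) (T : ℝ) :
    (diffCount (A : Matrix (Fin n) (Fin n) ℂ) (truncHerm T A) : ℝ) ≤
      ∑ p : Fin n × Fin n, (Set.Ioi T).indicator (fun _ => (1 : ℝ))
        ‖(A : Matrix (Fin n) (Fin n) ℂ) p.1 p.2‖ := by
  classical
  have h : ∑ p : Fin n × Fin n, (Set.Ioi T).indicator (fun _ => (1 : ℝ))
      ‖(A : Matrix (Fin n) (Fin n) ℂ) p.1 p.2‖ =
      ((Finset.univ.filter fun p : Fin n × Fin n =>
        T < ‖(A : Matrix (Fin n) (Fin n) ℂ) p.1 p.2‖).card : ℝ) := by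
    simp [Set.indicator, Finset.sum_boole]
  rw [h, diffCount]
  norm_cast
  refine Finset.card_le_card fun p hp => Finset.mem_filter.2 ⟨Finset.mem_univ _, ?_⟩
  by_contra hlt
  refine (Finset.mem_filter.1 hp).2 ?_
  rw [truncHerm_apply, cut, if_pos (not_lt.1 hlt)]

theorem esd_apply [NeZero n] (A : Herm n) {S : Set ℝ} (hS : MeasurableSet S) :
    (esd A : Measure ℝ) S = ENNReal.ofReal ((n : ℝ)⁻¹ * ∑ i, S.indicator (fun _ => 1) (eigs A i)) := by
  have hn : (0 : ℝ) < n := by exact_mod_cast Nat.pos_of_ne_zero (NeZero.ne n)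
  simp only [esd, ProbabilityMeasure.coe_mk, Measure.smul_apply, Measure.finsetSum_apply,
    smul_eq_mul]
  rw [ENNReal.ofReal_mul (by positivity), ENNReal.ofReal_inv_of_pos hn, ENNReal.ofReal_natCast,
    ENNReal.ofReal_sum_of_nonneg fun i _ => Set.indicator_nonneg (fun _ _ => zero_le_one) _]
  congr 1
  refine Finset.sum_congr rfl fun i _ => ?_
  rw [Measure.dirac_apply' _ hS]
  by_cases hx : eigs A i ∈ S <;> simp [Set.indicator, hx]

theorem integral_ramp_esd [NeZero n] {a b : ℝ} (hab : a < b) (A : Herm n) :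
    ∫ s, ramp a b s ∂(esd A : Measure ℝ) = rampMean a b A := by
  simp only [esd, ProbabilityMeasure.coe_mk]
  rw [integral_smul_measure, integral_finsetSum_measure fun i _ => integrable_ramp hab _]
  simp [rampMean, integral_dirac]

/-- Chebyshev for B, whose squared eigenvalues sum to its squared Frobenius norm. Passing from A to
B costs one interlacing error at M and one at -M, hence the factor 2. -/
theorem esd_tail_le [NeZero n] (A B : Herm n) {M : ℝ} (hM : 0 < M) :
    (esd A : Measure ℝ) {s | M < ‖s‖} ≤ ENNReal.ofReal ((n : ℝ)⁻¹ *
      ((∑ i, ∑ j, ‖(B : Matrix (Fin n) (Fin n) ℂ) i j‖ ^ 2) / M ^ 2 +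
        2 * diffCount (A : Matrix (Fin n) (Fin n) ℂ) B)) := by
  rw [esd_apply A (measurableSet_lt measurable_const measurable_norm)]
  refine ENNReal.ofReal_le_ofReal (mul_le_mul_of_nonneg_left ?_ (by positivity))
  have hsplit : ∀ A : Herm n, ((Finset.univ.filter fun i => ¬ -M < eigs A i).card : ℝ) =
      n - ((Finset.univ.filter fun i => -M < eigs A i).card : ℝ) := fun A => by
    have := Finset.card_filter_add_card_filter_not (s := (Finset.univ : Finset (Fin n)))
      (fun i => -M < eigs A i)
    rw [Finset.card_univ, Fintype.card_fin] at this
    have h : ((Finset.univ.filter fun i => -M < eigs A i).card : ℝ) +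
        ((Finset.univ.filter fun i => ¬ -M < eigs A i).card : ℝ) = n := by exact_mod_cast this
    linarith
  have hA : ∑ i, {s : ℝ | M < ‖s‖}.indicator (fun _ => (1 : ℝ)) (eigs A i) ≤
      ((Finset.univ.filter fun i => M < eigs A i).card : ℝ) +
        ((Finset.univ.filter fun i => ¬ -M < eigs A i).card : ℝ) := by
    rw [Finset.natCast_card_filter, Finset.natCast_card_filter, ← Finset.sum_add_distrib]
    refine Finset.sum_le_sum fun i _ => ?_
    simp only [Set.indicator, Set.mem_ofPred_eq, Real.norm_eq_abs, lt_abs]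
    split_ifs <;> grind
  have hB : ((Finset.univ.filter fun i => M < eigs B i).card : ℝ) +
        ((Finset.univ.filter fun i => ¬ -M < eigs B i).card : ℝ) ≤ (∑ i, eigs B i ^ 2) / M ^ 2 := by
    rw [Finset.natCast_card_filter, Finset.natCast_card_filter, ← Finset.sum_add_distrib,
      Finset.sum_div]
    refine Finset.sum_le_sum fun i _ => ?_
    rw [le_div_iff₀ (by positivity)]
    split_ifs <;> nlinarith [sq_nonneg (eigs B i)]
  have h1 := card_eigs_gt_le A B M
  have h2 := card_eigs_gt_le B A (-M)
  rw [diffCount_comm] at h2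
  have h1' : ((Finset.univ.filter fun i => M < eigs A i).card : ℝ) ≤
      ((Finset.univ.filter fun i => M < eigs B i).card : ℝ) +
        diffCount (A : Matrix (Fin n) (Fin n) ℂ) B := by
    norm_cast
  have h2' : ((Finset.univ.filter fun i => -M < eigs B i).card : ℝ) ≤
      ((Finset.univ.filter fun i => -M < eigs A i).card : ℝ) +
        diffCount (A : Matrix (Fin n) (Fin n) ℂ) B := by
    norm_cast
  rw [hsplit] at hA hB
  rw [sum_eigs_sq] at hB
  linarith

end Ramp

/-! ### Deviation and tails of the mean spectral distribution -/

section Mean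

variable {n : ℕ} {Ω : Type*} [MeasurableSpace Ω] {P : Measure Ω} [IsProbabilityMeasure P]

theorem IsRandomHerm.measurable_rampMean {Z : Ω → Herm n} (hZ : IsRandomHerm Z) (a b : ℝ) :
    Measurable fun ω => rampMean a b (Z ω) :=
  (hZ.measurable_sum_continuous (continuous_ramp a b)).const_mul _

theorem IsRandomHerm.integrable_rampMean {Z : Ω → Herm n} (hZ : IsRandomHerm Z) {a b : ℝ}
    (hab : a < b) : Integrable (fun ω => rampMean a b (Z ω)) P :=
  integrable_of_abs_le (hZ.measurable_rampMean a b) 1 fun ω => by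
    rw [abs_of_nonneg (rampMean_nonneg hab _)]; exact rampMean_le_one hab _

theorem integral_ramp_meanEsd [NeZero n] {Z : Ω → Herm n} (hZ : IsRandomHerm Z) {a b : ℝ}
    (hab : a < b) :
    ∫ s, ramp a b s ∂(meanEsd P Z hZ : Measure ℝ) = ∫ ω, rampMean a b (Z ω) ∂P := by
  rw [integral_eq_lintegral_of_nonneg_ae (ae_of_all _ (ramp_nonneg hab))
      (continuous_ramp a b).aestronglyMeasurable,
    integral_eq_lintegral_of_nonneg_ae (ae_of_all _ fun ω => rampMean_nonneg hab _)
      (hZ.measurable_rampMean a b).aestronglyMeasurable]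
  congr 1
  rw [show (meanEsd P Z hZ : Measure ℝ) = P.bind fun ω => (esd (Z ω) : Measure ℝ) from rfl,
    Measure.lintegral_bind hZ.measurable_esd.aemeasurable
      (continuous_ramp a b).measurable.ennreal_ofReal.aemeasurable]
  refine lintegral_congr fun ω => ?_
  rw [← integral_ramp_esd hab, ofReal_integral_eq_lintegral_ofReal (integrable_ramp hab _)
    (ae_of_all _ (ramp_nonneg hab))]

/-- The expected number of entries above the level `T`, divided by the dimension. -/
def exceedance (P : Measure Ω) (Z : Ω → Herm n) (T : ℝ) : ℝ :=
  (n : ℝ)⁻¹ * ∑ p : Fin n × Fin n,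
    P.real {ω | T < ‖(Z ω : Matrix (Fin n) (Fin n) ℂ) p.1 p.2‖}

theorem IsRandomHerm.measurable_norm_apply {Z : Ω → Herm n} (hZ : IsRandomHerm Z) (i j : Fin n) :
    Measurable fun ω => ‖(Z ω : Matrix (Fin n) (Fin n) ℂ) i j‖ := (hZ i j).norm

theorem IsRandomHerm.integrable_exceedance {Z : Ω → Herm n} (hZ : IsRandomHerm Z) (T : ℝ) :
    Integrable (fun ω => (n : ℝ)⁻¹ * ∑ p : Fin n × Fin n, (Set.Ioi T).indicator (fun _ => (1 : ℝ))
      ‖(Z ω : Matrix (Fin n) (Fin n) ℂ) p.1 p.2‖) P ∧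
    ∫ ω, ((n : ℝ)⁻¹ * ∑ p : Fin n × Fin n, (Set.Ioi T).indicator (fun _ => (1 : ℝ))
      ‖(Z ω : Matrix (Fin n) (Fin n) ℂ) p.1 p.2‖) ∂P = exceedance P Z T := by
  have hs : ∀ p : Fin n × Fin n,
      MeasurableSet {ω | T < ‖(Z ω : Matrix (Fin n) (Fin n) ℂ) p.1 p.2‖} := fun p =>
    measurableSet_lt measurable_const (hZ.measurable_norm_apply _ _)
  have he : ∀ p : Fin n × Fin n, (fun ω => (Set.Ioi T).indicator (fun _ => (1 : ℝ))
      ‖(Z ω : Matrix (Fin n) (Fin n) ℂ) p.1 p.2‖) =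
      {ω | T < ‖(Z ω : Matrix (Fin n) (Fin n) ℂ) p.1 p.2‖}.indicator 1 := fun p => rfl
  have hi : ∀ p : Fin n × Fin n, Integrable (fun ω => (Set.Ioi T).indicator (fun _ => (1 : ℝ))
      ‖(Z ω : Matrix (Fin n) (Fin n) ℂ) p.1 p.2‖) P := fun p => by
    rw [he]; exact (integrable_const (1 : ℝ)).indicator (hs p)
  refine ⟨(integrable_finsetSum _ fun p _ => hi p).const_mul _, ?_⟩
  rw [integral_const_mul, integral_finsetSum _ fun p _ => hi p, exceedance]
  congr 1
  refine Finset.sum_congr rfl fun p _ => ?_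
  rw [he, integral_indicator_one (hs p)]

theorem BlockIndep.integral_abs_hingeTrace_le {Z : Ω → Herm n} (hZ : IsRandomHerm Z) {d : ℕ}
    (hd : BlockIndep P (fun ω => (Z ω : Matrix (Fin n) (Fin n) ℂ)) d) {T : ℝ} (hT : 0 ≤ T)
    (a : ℝ) :
    Integrable (fun ω => |hingeTrace a (truncHerm T (Z ω)) -
      ∫ ω', hingeTrace a (truncHerm T (Z ω')) ∂P|) P ∧
    ∫ ω, |hingeTrace a (truncHerm T (Z ω)) - ∫ ω', hingeTrace a (truncHerm T (Z ω')) ∂P| ∂P ≤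
      2 * T * √(d / n) := by
  obtain ⟨C, hC⟩ := exists_abs_hingeTrace_truncHerm_le (n := n) hT a
  set m := ∫ ω', hingeTrace a (truncHerm T (Z ω')) ∂P
  have hm : Measurable fun ω => |hingeTrace a (truncHerm T (Z ω)) - m| :=
    (((hZ.truncHerm T).measurable_hingeTrace a).sub_const m).abs
  -- The maximum with 1 lets the same constant bound the second Cauchy–Schwarz factor, the function
  -- 1.
  have hb : ∀ ω, |(|hingeTrace a (truncHerm T (Z ω)) - m|)| ≤ max (C + |m|) 1 := fun ω => by
    rw [abs_abs]
    exact ((abs_sub _ _).trans (add_le_add_left (hC _) _)).trans (le_max_left _ _)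
  refine ⟨integrable_of_abs_le hm _ hb, ?_⟩
  have hcs := integral_mul_sq_le (P := P) hm (measurable_const (a := (1 : ℝ))) hb
    (fun _ => by simp)
  have hvar := hd.variance_hingeTrace_le hZ hT a
  simp only [mul_one, sq_abs, one_pow, integral_const, probReal_univ, smul_eq_mul] at hcs
  have h2 : 2 * T * √(d / n) = √(4 * T ^ 2 * d / n) := by
    rw [show 4 * T ^ 2 * (d : ℝ) / n = (2 * T) ^ 2 * (d / n) by ring,
      Real.sqrt_mul (sq_nonneg _), Real.sqrt_sq (by positivity)]
  rw [h2]
  exact Real.le_sqrt_of_sq_le (hcs.trans hvar)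

/-- The mean absolute deviation of the integral of a ramp with respect to the empirical spectral
distribution of a matrix with independent blocks of bounded size. -/
theorem BlockIndep.integral_abs_rampMean_sub_le {Z : Ω → Herm n} (hZ : IsRandomHerm Z) {d : ℕ}
    (hd : BlockIndep P (fun ω => (Z ω : Matrix (Fin n) (Fin n) ℂ)) d) {T : ℝ} (hT : 0 ≤ T)
    {a b : ℝ} (hab : a < b) :
    ∫ ω, |rampMean a b (Z ω) - ∫ ω', rampMean a b (Z ω') ∂P| ∂P ≤
      2 * exceedance P Z T + 4 * T * √(d / n) / (b - a) := by
  obtain ⟨hDi, hDe⟩ := hZ.integrable_exceedance (P := P) T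
  set D : Ω → ℝ := fun ω => (n : ℝ)⁻¹ * ∑ p : Fin n × Fin n,
    (Set.Ioi T).indicator (fun _ => (1 : ℝ)) ‖(Z ω : Matrix (Fin n) (Fin n) ℂ) p.1 p.2‖ with hD
  obtain ⟨hai, hae⟩ := hd.integral_abs_hingeTrace_le hZ hT a
  obtain ⟨hbi, hbe⟩ := hd.integral_abs_hingeTrace_le hZ hT b
  have hSi : ∀ a, Integrable (fun ω => hingeTrace a (truncHerm T (Z ω))) P := fun a => by
    obtain ⟨C, hC⟩ := exists_abs_hingeTrace_truncHerm_le (n := n) hT a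
    exact integrable_of_abs_le ((hZ.truncHerm T).measurable_hingeTrace a) C fun ω => hC _
  set A : Ω → ℝ := fun ω => hingeTrace a (truncHerm T (Z ω))
  set B : Ω → ℝ := fun ω => hingeTrace b (truncHerm T (Z ω))
  have hRi := hZ.integrable_rampMean (P := P) hab
  have hSr := (hZ.truncHerm T).integrable_rampMean (P := P) hab
  have hRS : ∀ ω, |rampMean a b (Z ω) - rampMean a b (truncHerm T (Z ω))| ≤ D ω := fun ω =>
    (abs_rampMean_sub_le hab _ _).trans
      (mul_le_mul_of_nonneg_left (diffCount_truncHerm_le _ _) (by positivity))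
  have hES : ∫ ω, rampMean a b (truncHerm T (Z ω)) ∂P = (∫ ω, A ω ∂P - ∫ ω, B ω ∂P) / (b - a) := by
    simp only [rampMean_eq]
    rw [integral_div, integral_sub (hSi a) (hSi b)]
  have hEE : |∫ ω, rampMean a b (truncHerm T (Z ω)) ∂P - ∫ ω, rampMean a b (Z ω) ∂P| ≤
      exceedance P Z T := by
    rw [← integral_sub hSr hRi, ← hDe]
    refine (abs_integral_le_integral_abs).trans (integral_mono (hSr.sub hRi).abs hDi fun ω => ?_)
    simp only
    rw [abs_sub_comm]
    exact hRS ω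
  have hba : 0 < b - a := by linarith
  -- Truncation is paid for twice, pathwise and in the mean; the middle term is the fluctuation of
  -- the two hinge traces forming the ramp.
  have hpt : ∀ ω, |rampMean a b (Z ω) - ∫ ω', rampMean a b (Z ω') ∂P| ≤ D ω + exceedance P Z T +
      (|A ω - ∫ ω', A ω' ∂P| + |B ω - ∫ ω', B ω' ∂P|) / (b - a) := fun ω => by
    have h1 : |rampMean a b (truncHerm T (Z ω)) - ∫ ω', rampMean a b (truncHerm T (Z ω')) ∂P| ≤
        (|A ω - ∫ ω', A ω' ∂P| + |B ω - ∫ ω', B ω' ∂P|) / (b - a) := by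
      rw [hES, rampMean_eq, ← sub_div, abs_div, abs_of_pos hba]
      gcongr
      have : A ω - B ω - (∫ ω', A ω' ∂P - ∫ ω', B ω' ∂P) =
          (A ω - ∫ ω', A ω' ∂P) - (B ω - ∫ ω', B ω' ∂P) := by ring
      exact (congrArg abs this).trans_le (abs_sub _ _)
    have h2 := hRS ω
    have h3 : rampMean a b (Z ω) - ∫ ω', rampMean a b (Z ω') ∂P =
        (rampMean a b (Z ω) - rampMean a b (truncHerm T (Z ω))) +
        (rampMean a b (truncHerm T (Z ω)) - ∫ ω', rampMean a b (truncHerm T (Z ω')) ∂P) +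
        (∫ ω', rampMean a b (truncHerm T (Z ω')) ∂P - ∫ ω', rampMean a b (Z ω') ∂P) := by ring
    rw [h3]
    refine (abs_add_three _ _ _).trans ?_
    linarith
  have hsum : Integrable (fun ω => (|A ω - ∫ ω', A ω' ∂P| + |B ω - ∫ ω', B ω' ∂P|) / (b - a)) P :=
    (hai.add hbi).div_const _
  have hDc : Integrable (fun ω => D ω + exceedance P Z T) P := hDi.add (integrable_const _)
  refine (integral_mono (hRi.sub (integrable_const _)).abs (hDc.add hsum) hpt).trans ?_
  simp only [Pi.add_apply]
  rw [integral_add hDc hsum, integral_add hDi (integrable_const _), integral_div,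
    integral_add hai hbi, hDe]
  simp only [integral_const, probReal_univ, smul_eq_mul, one_mul]
  have h4 : (∫ ω, |A ω - ∫ ω', A ω' ∂P| ∂P + ∫ ω, |B ω - ∫ ω', B ω' ∂P| ∂P) / (b - a) ≤
      4 * T * √(d / n) / (b - a) := by
    gcongr; linarith
  linarith

/-- Each realization is compared with its truncation at level 1, so that no second moment of the
entries themselves is needed. -/
theorem meanEsd_tail_le [NeZero n] {Z : Ω → Herm n} (hZ : IsRandomHerm Z) {M : ℝ} (hM : 0 < M) :
    (meanEsd P Z hZ : Measure ℝ) {s | M < ‖s‖} ≤ ENNReal.ofReal (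
      (n : ℝ)⁻¹ * (∑ i, ∑ j, ∫ ω, ‖cut 1 ((Z ω : Matrix (Fin n) (Fin n) ℂ) i j)‖ ^ 2 ∂P) / M ^ 2 +
        2 * exceedance P Z 1) := by
  obtain ⟨hDi, hDe⟩ := hZ.integrable_exceedance (P := P) 1
  have hci : ∀ i j, Integrable (fun ω => ‖cut 1 ((Z ω : Matrix (Fin n) (Fin n) ℂ) i j)‖ ^ 2) P :=
    fun i j => integrable_of_abs_le (((measurable_cut 1).comp (hZ i j)).norm.pow_const 2) 1
      fun ω => by
        rw [abs_of_nonneg (sq_nonneg _)]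
        exact pow_le_one₀ (norm_nonneg _) (norm_cut_le zero_le_one _)
  have hsi : Integrable (fun ω => ∑ i, ∑ j,
      ‖cut 1 ((Z ω : Matrix (Fin n) (Fin n) ℂ) i j)‖ ^ 2) P :=
    integrable_finsetSum _ fun i _ => integrable_finsetSum _ fun j _ => hci i j
  have hsum : ∫ ω, (∑ i, ∑ j, ‖cut 1 ((Z ω : Matrix (Fin n) (Fin n) ℂ) i j)‖ ^ 2) ∂P =
      ∑ i, ∑ j, ∫ ω, ‖cut 1 ((Z ω : Matrix (Fin n) (Fin n) ℂ) i j)‖ ^ 2 ∂P := by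
    rw [integral_finsetSum _ fun i _ => integrable_finsetSum _ fun j _ => hci i j]
    exact Finset.sum_congr rfl fun i _ => integral_finsetSum _ fun j _ => hci i j
  rw [meanEsd_apply P Z hZ (measurableSet_lt measurable_const measurable_norm)]
  have h1 : ∀ ω, (esd (Z ω) : Measure ℝ) {s | M < ‖s‖} ≤ ENNReal.ofReal ((n : ℝ)⁻¹ *
      (∑ i, ∑ j, ‖cut 1 ((Z ω : Matrix (Fin n) (Fin n) ℂ) i j)‖ ^ 2) / M ^ 2 +
      2 * ((n : ℝ)⁻¹ * ∑ p : Fin n × Fin n, (Set.Ioi 1).indicator (fun _ => (1 : ℝ))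
        ‖(Z ω : Matrix (Fin n) (Fin n) ℂ) p.1 p.2‖)) := fun ω => by
    refine (esd_tail_le (Z ω) (truncHerm 1 (Z ω)) hM).trans (ENNReal.ofReal_le_ofReal ?_)
    have h2 := mul_le_mul_of_nonneg_left (diffCount_truncHerm_le (Z ω) 1)
      (show 0 ≤ (n : ℝ)⁻¹ by positivity)
    simp only [truncHerm_apply]
    rw [mul_add, mul_div_assoc]
    linarith
  refine (lintegral_mono h1).trans ?_
  rw [← ofReal_integral_eq_lintegral_ofReal]
  · refine ENNReal.ofReal_le_ofReal (le_of_eq ?_)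
    rw [integral_add ((hsi.const_mul _).div_const _) (hDi.const_mul _), integral_div,
      integral_const_mul, integral_const_mul, hDe, hsum]
  · exact ((hsi.const_mul _).div_const _).add (hDi.const_mul _)
  · refine ae_of_all _ fun ω => ?_
    have : 0 ≤ ∑ p : Fin n × Fin n, (Set.Ioi (1 : ℝ)).indicator (fun _ => (1 : ℝ))
        ‖(Z ω : Matrix (Fin n) (Fin n) ℂ) p.1 p.2‖ :=
      Finset.sum_nonneg fun p _ => Set.indicator_nonneg (fun _ _ => zero_le_one) _
    simp only [Pi.zero_apply]
    positivity

end Mean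

/-! ### Weak convergence through rational ramps -/

section WeakConvergence

theorem measureReal_Ioi_le_integral_ramp (μ : ProbabilityMeasure ℝ) {a b : ℝ} (hab : a < b) :
    (μ : Measure ℝ).real (Set.Ioi b) ≤ ∫ s, ramp a b s ∂(μ : Measure ℝ) := by
  rw [← integral_indicator_one measurableSet_Ioi]
  refine integral_mono ((integrable_const (1 : ℝ)).indicator measurableSet_Ioi)
    (integrable_ramp hab _) fun s => ?_
  by_cases h : b < s
  · simp [Set.indicator, h, ramp_of_ge hab h.le]
  · simpa [Set.indicator, h] using ramp_nonneg hab s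

theorem integral_ramp_le_measureReal_Ioi (μ : ProbabilityMeasure ℝ) {a b : ℝ} (hab : a < b) :
    ∫ s, ramp a b s ∂(μ : Measure ℝ) ≤ (μ : Measure ℝ).real (Set.Ioi a) := by
  rw [← integral_indicator_one measurableSet_Ioi]
  refine integral_mono (integrable_ramp hab _)
    ((integrable_const (1 : ℝ)).indicator measurableSet_Ioi) fun s => ?_
  by_cases h : a < s
  · simpa [Set.indicator, h] using ramp_le_one hab s
  · simp [Set.indicator, h, ramp_of_le hab (not_lt.1 h)]

/-- The tail is one minus the distribution function, whose jump at t is the mass of the atom there.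
-/
theorem continuousAt_measureReal_Ioi (ν : ProbabilityMeasure ℝ) {t : ℝ}
    (ht : (ν : Measure ℝ) {t} = 0) : ContinuousAt (fun s => (ν : Measure ℝ).real (Set.Ioi s)) t := by
  have h1 : ∀ s, (ν : Measure ℝ).real (Set.Ioi s) = 1 - cdf (ν : Measure ℝ) s := fun s => by
    rw [cdf_eq_real, ← Set.compl_Iic, probReal_compl_eq_one_sub measurableSet_Iic]
  simp_rw [h1]
  refine continuousAt_const.sub ?_
  have h2 := (cdf (ν : Measure ℝ)).measure_singleton t
  rw [measure_cdf, ht, eq_comm, ENNReal.ofReal_eq_zero] at h2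
  have hmono := monotone_cdf (ν : Measure ℝ)
  rw [hmono.continuousAt_iff_leftLim_eq_rightLim, (cdf (ν : Measure ℝ)).rightLim_eq]
  exact le_antisymm (hmono.leftLim_le le_rfl) (by linarith)

theorem tendsto_measureReal_Ioi {μ : ℕ → ProbabilityMeasure ℝ} {ν : ProbabilityMeasure ℝ}
    (h : ∀ p q : ℚ, p < q → Tendsto (fun k => ∫ s, ramp p q s ∂(μ k : Measure ℝ)) atTop
      (𝓝 (∫ s, ramp p q s ∂(ν : Measure ℝ)))) {t : ℝ} (ht : (ν : Measure ℝ) {t} = 0) :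
    Tendsto (fun k => (μ k : Measure ℝ).real (Set.Ioi t)) atTop
      (𝓝 ((ν : Measure ℝ).real (Set.Ioi t))) := by
  have hc := continuousAt_measureReal_Ioi ν ht
  rw [Metric.tendsto_atTop']
  intro ε hε
  obtain ⟨r, hr, hclose⟩ := Metric.continuousAt_iff.1 hc (ε / 2) (half_pos hε)
  -- Rationals `t - r < p < q < t < p' < q' < t + r`: the ramp on `[p, q]` dominates the indicator
  -- of `(t, ∞)` and the ramp on `[p', q']` lies below it.
  obtain ⟨p, hp1, hp2⟩ := exists_rat_btwn (show t - r < t by linarith)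
  obtain ⟨q, hq1, hq2⟩ := exists_rat_btwn hp2
  obtain ⟨q', hq1', hq2'⟩ := exists_rat_btwn (show t < t + r by linarith)
  obtain ⟨p', hp1', hp2'⟩ := exists_rat_btwn hq1'
  have h1 := (h p q (by exact_mod_cast hq1)).eventually
    (gt_mem_nhds (show _ < ∫ s, ramp p q s ∂(ν : Measure ℝ) + ε / 2 by linarith))
  have h2 := (h p' q' (by exact_mod_cast hp2')).eventually
    (lt_mem_nhds (show ∫ s, ramp p' q' s ∂(ν : Measure ℝ) - ε / 2 < _ by linarith))
  obtain ⟨N, hN⟩ := eventually_atTop.1 (h1.and h2)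
  refine ⟨N, fun k hk => ?_⟩
  obtain ⟨hk1, hk2⟩ := hN k hk.le
  have c1 := abs_lt.1 (hclose (x := (p : ℝ)) (by rw [Real.dist_eq, abs_lt]; constructor <;> linarith))
  have c2 := abs_lt.1 (hclose (x := (q' : ℝ)) (by rw [Real.dist_eq, abs_lt]; constructor <;> linarith))
  have u1 : (μ k : Measure ℝ).real (Set.Ioi t) ≤ ∫ s, ramp p q s ∂(μ k : Measure ℝ) :=
    (measureReal_mono (Set.Ioi_subset_Ioi hq2.le)).trans (measureReal_Ioi_le_integral_ramp _ hq1)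
  have u2 := integral_ramp_le_measureReal_Ioi ν hq1
  have l1 : ∫ s, ramp p' q' s ∂(μ k : Measure ℝ) ≤ (μ k : Measure ℝ).real (Set.Ioi t) :=
    (integral_ramp_le_measureReal_Ioi _ hp2').trans (measureReal_mono (Set.Ioi_subset_Ioi hp1'.le))
  have l2 := measureReal_Ioi_le_integral_ramp ν hp2'
  rw [Real.dist_eq, abs_lt]
  constructor <;> linarith [c1.1, c1.2, c2.1, c2.2]

/-- Weak convergence of probability measures on `ℝ` is determined by ramps with rational ends. -/
theorem tendsto_of_tendsto_integral_ramp {μ : ℕ → ProbabilityMeasure ℝ} {ν : ProbabilityMeasure ℝ}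
    (h : ∀ p q : ℚ, p < q → Tendsto (fun k => ∫ s, ramp p q s ∂(μ k : Measure ℝ)) atTop
      (𝓝 (∫ s, ramp p q s ∂(ν : Measure ℝ)))) : Tendsto μ atTop (𝓝 ν) := by
  set D : Set ℝ := {t | (ν : Measure ℝ) {t} = 0} with hD
  have hdense : Dense D := by
    have hcount : (Dᶜ).Countable := by
      have := Measure.countable_meas_pos_of_disjoint_iUnion (μ := (ν : Measure ℝ))
        (As := fun t : ℝ => {t}) (fun t => measurableSet_singleton t)
        (fun s t hst => Set.disjoint_singleton.2 hst)
      refine this.mono fun t ht => ?_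
      exact pos_iff_ne_zero.2 ht
    simpa using hcount.dense_compl ℝ
  -- Intervals whose ends are not atoms of ν: a π-system containing arbitrarily small neighbourhoods
  -- of each point, since there are only countably many atoms.
  have hS : IsPiSystem {s : Set ℝ | ∃ a ∈ D, ∃ b ∈ D, s = Set.Ioc a b} := by
    rintro _ ⟨a, ha, b, hb, rfl⟩ _ ⟨a', ha', b', hb', rfl⟩ _
    refine ⟨max a a', ?_, min b b', ?_, Set.Ioc_inter_Ioc⟩
    · rcases max_choice a a' with h | h <;> rw [h] <;> assumption
    · rcases min_choice b b' with h | h <;> rw [h] <;> assumption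
  refine hS.tendsto_probabilityMeasure_of_tendsto_of_mem ?_ ?_ ?_
  · rintro _ ⟨a, -, b, -, rfl⟩; exact measurableSet_Ioc
  · intro u hu x hx
    obtain ⟨r, hr, hball⟩ := Metric.isOpen_iff.1 hu x hx
    obtain ⟨a, ha, ha1, ha2⟩ := hdense.exists_between (show x - r < x by linarith)
    obtain ⟨b, hb, hb1, hb2⟩ := hdense.exists_between (show x < x + r by linarith)
    refine ⟨Set.Ioc a b, ⟨a, ha, b, hb, rfl⟩, Ioc_mem_nhds ha2 hb1, fun y hy => hball ?_⟩
    rw [Metric.mem_ball, Real.dist_eq, abs_lt]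
    constructor <;> linarith [hy.1, hy.2]
  · rintro _ ⟨a, ha, b, hb, rfl⟩
    rcases le_or_gt b a with hba | hab
    · simp [Set.Ioc_eq_empty (not_lt.2 hba)]
    have hIoc : ∀ μ : ProbabilityMeasure ℝ, (μ : Measure ℝ).real (Set.Ioc a b) =
        (μ : Measure ℝ).real (Set.Ioi a) - (μ : Measure ℝ).real (Set.Ioi b) := fun μ => by
      rw [← Set.Ioi_sdiff_Ioi, measureReal_sdiff (Set.Ioi_subset_Ioi hab.le) measurableSet_Ioi]
    rw [← NNReal.tendsto_coe]
    have h3 := (tendsto_measureReal_Ioi h ha).sub (tendsto_measureReal_Ioi h hb)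
    simp only [← hIoc] at h3
    exact h3

/-- On a tight set of probability measures, a metric for weak convergence is controlled by finitely
many ramps. -/
theorem MetrizesWeakConvergence.exists_ramp_control
    {ρ : ProbabilityMeasure ℝ → ProbabilityMeasure ℝ → ℝ} (hρ : MetrizesWeakConvergence ρ)
    {S : Set (ProbabilityMeasure ℝ)}
    (hS : IsTightMeasureSet {((μ : ProbabilityMeasure ℝ) : Measure ℝ) | μ ∈ S})
    {ε : ℝ} (hε : 0 < ε) :
    ∃ (J : Finset (ℚ × ℚ)) (δ : ℝ), 0 < δ ∧ (∀ p ∈ J, p.1 < p.2) ∧ ∀ ν ∈ S, ∀ μ : ProbabilityMeasure ℝ,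
      (∀ p ∈ J, |∫ s, ramp p.1 p.2 s ∂(μ : Measure ℝ) - ∫ s, ramp p.1 p.2 s ∂(ν : Measure ℝ)| < δ) →
      ρ μ ν ≤ ε := by
  by_contra! hcon
  have : Nonempty {p : ℚ × ℚ // p.1 < p.2} := ⟨⟨(0, 1), zero_lt_one⟩⟩
  obtain ⟨e, he⟩ := exists_surjective_nat {p : ℚ × ℚ // p.1 < p.2}
  -- Failure for the first k + 1 ramps at tolerance 1/(k+1), for every k. By Prokhorov a subsequence
  -- of the ν's converges, possibly outside S; the μ's follow it along every rational ramp, and the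
  -- triangle inequality contradicts the gap ε.
  have hex : ∀ k : ℕ, ∃ ν ∈ S, ∃ μ : ProbabilityMeasure ℝ, (∀ j ≤ k,
      |∫ s, ramp (e j).1.1 (e j).1.2 s ∂(μ : Measure ℝ) -
        ∫ s, ramp (e j).1.1 (e j).1.2 s ∂(ν : Measure ℝ)| < 1 / ((k : ℝ) + 1)) ∧ ε < ρ μ ν := by
    intro k
    obtain ⟨ν, hν, μ, hμ, hlt⟩ := hcon ((Finset.range (k + 1)).image fun j => (e j).1)
      (1 / ((k : ℝ) + 1)) (by positivity) (fun p hp => by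
        obtain ⟨j, -, rfl⟩ := Finset.mem_image.1 hp
        exact (e j).2)
    exact ⟨ν, hν, μ, fun j hj => hμ _ (Finset.mem_image.2
      ⟨j, Finset.mem_range.2 (Nat.lt_succ_of_le hj), rfl⟩), hlt⟩
  choose ν hνS μ hμ hlt using hex
  obtain ⟨ν₀, -, φ, hφ, hlim⟩ := (isCompact_closure_of_isTightMeasureSet hS).tendsto_subseq
    fun k => subset_closure (hνS k)
  have hμlim : Tendsto (fun k => μ (φ k)) atTop (𝓝 ν₀) := by
    refine tendsto_of_tendsto_integral_ramp fun p q hpq => ?_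
    have hpq' : (p : ℝ) < q := by exact_mod_cast hpq
    obtain ⟨j, hj⟩ := he ⟨(p, q), hpq⟩
    have h1 : Tendsto (fun k => ∫ s, ramp p q s ∂(ν (φ k) : Measure ℝ)) atTop
        (𝓝 (∫ s, ramp p q s ∂(ν₀ : Measure ℝ))) :=
      (ProbabilityMeasure.tendsto_iff_forall_integral_tendsto.1 hlim)
        (BoundedContinuousFunction.ofNormedAddCommGroup (ramp p q) (continuous_ramp _ _) 1
          fun s => abs_ramp_le_one hpq' s)
    have h2 : Tendsto (fun k => ∫ s, ramp p q s ∂(μ (φ k) : Measure ℝ) -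
        ∫ s, ramp p q s ∂(ν (φ k) : Measure ℝ)) atTop (𝓝 0) := by
      refine squeeze_zero_norm' ?_
        (tendsto_one_div_add_atTop_nhds_zero_nat.comp hφ.tendsto_atTop)
      filter_upwards [hφ.tendsto_atTop.eventually_ge_atTop j] with k hk
      have h3 := hμ (φ k) j hk
      rw [hj] at h3
      exact h3.le
    simpa using h2.add h1
  have h1 := (hρ.tendsto_iff (fun k => μ (φ k)) ν₀).2 hμlim
  have h2 := (hρ.tendsto_iff (fun k => ν (φ k)) ν₀).2 hlim
  have h3 := h1.add h2
  rw [add_zero] at h3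
  obtain ⟨k, hk⟩ := (h3.eventually (gt_mem_nhds hε)).exists
  have h4 := hρ.triangle (μ (φ k)) ν₀ (ν (φ k))
  rw [hρ.symm ν₀] at h4
  linarith [hlt (φ k)]

end WeakConvergence

/-! ### Entry statistics of the normalized matrix -/

section Scaling

variable {Ω₀ : Type*} [MeasurableSpace Ω₀] {P₀ : Measure Ω₀} [IsProbabilityMeasure P₀] {x : Ω₀ → ℝ}
  {n : ℕ} {Ω : Type*} [MeasurableSpace Ω] {P : Measure Ω} [IsProbabilityMeasure P]
  {X : Ω → Herm n}

theorem lintegral_sq_eq_top (hx_mean : ∫ ω, x ω ∂P₀ = 0) (hx_var : evariance x P₀ = ∞) :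
    ∫⁻ ω, ENNReal.ofReal (x ω ^ 2) ∂P₀ = ∞ := by
  rw [← hx_var, evariance, hx_mean]
  refine lintegral_congr fun ω => ?_
  rw [sub_zero, ← ofReal_norm, ← ENNReal.ofReal_pow (norm_nonneg _), Real.norm_eq_abs,
    sq_abs]

theorem BlockIndep.const_smul {d : ℕ}
    (h : BlockIndep P (fun ω => (X ω : Matrix (Fin n) (Fin n) ℂ)) d) (r : ℝ) :
    BlockIndep P (fun ω => ((r • X ω : Herm n) : Matrix (Fin n) (Fin n) ℂ)) d := by
  obtain ⟨Q, hcard, hind⟩ := h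
  refine ⟨Q, hcard, ?_⟩
  exact hind.comp (fun B v p => r • v p) fun B => by fun_prop

theorem smul_herm_apply (r : ℝ) (A : Herm n) (i j : Fin n) :
    ((r • A : Herm n) : Matrix (Fin n) (Fin n) ℂ) i j = r • (A : Matrix (Fin n) (Fin n) ℂ) i j :=
  rfl

theorem exceedance_smul (hlaw : ∀ i j : Fin n,
      IdentDistrib (fun ω => (X ω : Matrix (Fin n) (Fin n) ℂ) i j) (fun ω => (x ω : ℂ)) P P₀)
    {b : ℝ} (hb : 0 < b) (T : ℝ) :
    exceedance P (fun ω => b⁻¹ • X ω) T = n * P₀.real {ω | T * b < |x ω|} := by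
  have h : ∀ i j, P.real {ω | T < ‖((b⁻¹ • X ω : Herm n) : Matrix (Fin n) (Fin n) ℂ) i j‖} =
      P₀.real {ω | T * b < |x ω|} := fun i j => by
    have h1 := (hlaw i j).measure_mem_eq
      (measurableSet_lt measurable_const measurable_norm : MeasurableSet {z : ℂ | T * b < ‖z‖})
    have h2 : {ω | T < ‖((b⁻¹ • X ω : Herm n) : Matrix (Fin n) (Fin n) ℂ) i j‖} =
        (fun ω => (X ω : Matrix (Fin n) (Fin n) ℂ) i j) ⁻¹' {z : ℂ | T * b < ‖z‖} := by
      ext ω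
      simp only [smul_herm_apply, norm_smul, norm_inv, Real.norm_eq_abs, abs_of_pos hb,
        Set.mem_ofPred_eq, Set.mem_preimage]
      rw [inv_mul_eq_div, lt_div_iff₀ hb]
    have h3 : {ω | T * b < |x ω|} = (fun ω => (x ω : ℂ)) ⁻¹' {z : ℂ | T * b < ‖z‖} := by
      ext ω; simp
    rw [Measure.real, Measure.real, h2, h3, h1]
  rw [exceedance]
  simp only [h, Finset.sum_const, Finset.card_univ, Fintype.card_prod, Fintype.card_fin,
    nsmul_eq_mul]
  push_cast
  rcases Nat.eq_zero_or_pos n with h0 | h0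
  · subst h0; simp
  · have hn : (n : ℝ) ≠ 0 := by positivity
    field_simp

/-- Cutting `x/b` at level 1 is cutting `x` at level b, so the truncated second moment defining
`b_n` appears. -/
theorem integral_cut_smul (hlaw : ∀ i j : Fin n,
      IdentDistrib (fun ω => (X ω : Matrix (Fin n) (Fin n) ℂ) i j) (fun ω => (x ω : ℂ)) P P₀)
    {b : ℝ} (hb : 0 < b) (i j : Fin n) :
    ∫ ω, ‖cut 1 (((b⁻¹ • X ω : Herm n) : Matrix (Fin n) (Fin n) ℂ) i j)‖ ^ 2 ∂P =
      truncMoment P₀ x b / b ^ 2 := by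
  have hm : Measurable fun z : ℂ => ‖cut 1 (b⁻¹ • z)‖ ^ 2 :=
    (((measurable_cut 1).comp (measurable_id.const_smul b⁻¹)).norm).pow_const 2
  have h := ((hlaw i j).comp hm).integral_eq
  simp only [Function.comp_def] at h
  simp only [smul_herm_apply]
  rw [h, truncMoment, ← integral_div]
  refine integral_congr_ae (ae_of_all _ fun ω => ?_)
  have h1 : ‖b⁻¹ • (x ω : ℂ)‖ = |x ω| / b := by
    rw [norm_smul, norm_inv, Real.norm_eq_abs, abs_of_pos hb, Complex.norm_real, Real.norm_eq_abs,
      inv_mul_eq_div]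
  simp only [cut, h1, div_le_one hb, Set.indicator, Set.mem_ofPred_eq]
  split_ifs with h2
  · rw [h1, div_pow, sq_abs]
  · simp

end Scaling

/-! ### Vanishing ramp fluctuations, tightness and the conclusion -/

section Main

variable {Ω₀ : Type*} [MeasurableSpace Ω₀] {P₀ : Measure Ω₀} [IsProbabilityMeasure P₀] {x : Ω₀ → ℝ}
  {Ω : ℕ+ → Type*} [∀ n, MeasurableSpace (Ω n)] {P : ∀ n, Measure (Ω n)}
  [∀ n, IsProbabilityMeasure (P n)] {X : ∀ n : ℕ+, Ω n → Herm n}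

theorem tendsto_pnat_coe : Tendsto (fun n : ℕ+ => (n : ℕ)) atTop atTop :=
  tendsto_atTop.2 fun k => (eventually_ge_atTop (Nat.succPNat k)).mono fun n hn => by
    have : (Nat.succPNat k : ℕ) ≤ n := hn
    rw [Nat.succPNat_coe] at this
    omega

/-- At truncation level δ the fluctuation term is at most `4δ√C/(b - a)` uniformly in large n, where
`d n ≤ C n`. So δ is fixed first, and then n makes `2n P(|x| > δ b_n)` small. -/
theorem tendsto_integral_abs_rampMean (hx : Measurable x) (hx_int : Integrable x P₀)
    (hinf : ∫⁻ ω, ENNReal.ofReal (x ω ^ 2) ∂P₀ = ∞) (hx_dom : InGaussianDomain P₀ x)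
    (hX : ∀ n, IsRandomHerm (X n)) (d : ℕ+ → ℕ)
    (hd : (fun n : ℕ+ => (d n : ℝ)) =O[atTop] (fun n : ℕ+ => ((n : ℕ) : ℝ)))
    (hX_block : ∀ n, BlockIndep (P n) (fun ω => (X n ω : Matrix (Fin n) (Fin n) ℂ)) (d n))
    (hX_law : ∀ (n : ℕ+) (i j : Fin n),
      IdentDistrib (fun ω => (X n ω : Matrix (Fin n) (Fin n) ℂ) i j)
        (fun ω => (x ω : ℂ)) (P n) P₀) {a b : ℝ} (hab : a < b) :
    Tendsto (fun n : ℕ+ => ∫ ω, |rampMean a b ((normSeq P₀ x n)⁻¹ • X n ω) -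
      ∫ ω', rampMean a b ((normSeq P₀ x n)⁻¹ • X n ω') ∂(P n)| ∂(P n)) atTop (𝓝 0) := by
  obtain ⟨C, hC, hdC⟩ := hd.exists_pos
  rw [Asymptotics.isBigOWith_iff] at hdC
  rw [Metric.tendsto_nhds]
  intro ε hε
  have hba : 0 < b - a := by linarith
  obtain ⟨δ, hδ, hδ1, hδε⟩ : ∃ δ : ℝ, 0 < δ ∧ δ ≤ 1 ∧ 4 * δ * √C / (b - a) ≤ ε / 2 := by
    refine ⟨min 1 (ε * (b - a) / (8 * √C)), by positivity, min_le_left _ _, ?_⟩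
    have h1 := min_le_right 1 (ε * (b - a) / (8 * √C))
    have h2 : 0 < √C := Real.sqrt_pos.2 hC
    rw [div_le_iff₀ hba]
    calc 4 * min 1 (ε * (b - a) / (8 * √C)) * √C ≤ 4 * (ε * (b - a) / (8 * √C)) * √C := by gcongr
      _ = ε / 2 * (b - a) := by field_simp; ring
  have htail := (hx_dom.tendsto_mul_tail_normSeq hx hx_int hinf hδ hδ1).comp tendsto_pnat_coe
  filter_upwards [hdC, htail.eventually (gt_mem_nhds (show 0 < ε / 4 by positivity))]
    with n hn1 hn2
  have hb := one_le_normSeq (P := P₀) hx hx_int n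
  have h1 := ((hX_block n).const_smul (normSeq P₀ x n)⁻¹).integral_abs_rampMean_sub_le
    ((hX n).const_smul _) hδ.le hab
  rw [exceedance_smul (hX_law n) (by linarith) δ] at h1
  rw [dist_zero_right, Real.norm_eq_abs, abs_of_nonneg (integral_nonneg fun _ => abs_nonneg _)]
  have hn0 : (0 : ℝ) < (n : ℕ) := by exact_mod_cast n.pos
  rw [Real.norm_of_nonneg (Nat.cast_nonneg _), Real.norm_of_nonneg (Nat.cast_nonneg _)] at hn1
  have h2 : √((d n : ℝ) / (n : ℕ)) ≤ √C := Real.sqrt_le_sqrt (by rwa [div_le_iff₀ hn0])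
  have h3 : 4 * δ * √((d n : ℝ) / (n : ℕ)) / (b - a) ≤ 4 * δ * √C / (b - a) := by gcongr
  simp only [Function.comp_apply] at hn2
  linarith

/-- By `n l(b_n) ≤ b_n²` the Chebyshev term beyond r is at most `1/r²`, and the truncation error at
level 1 vanishes, so the limsup of the tails is at most `2/r²`. -/
theorem isTightMeasureSet_meanEsd (hx : Measurable x) (hx_int : Integrable x P₀)
    (hinf : ∫⁻ ω, ENNReal.ofReal (x ω ^ 2) ∂P₀ = ∞) (hx_dom : InGaussianDomain P₀ x)
    (hX : ∀ n, IsRandomHerm (X n))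
    (hX_law : ∀ (n : ℕ+) (i j : Fin n),
      IdentDistrib (fun ω => (X n ω : Matrix (Fin n) (Fin n) ℂ) i j)
        (fun ω => (x ω : ℂ)) (P n) P₀) :
    IsTightMeasureSet (Set.range fun n : ℕ+ => (meanEsd (P n)
      (fun ω => (normSeq P₀ x n)⁻¹ • X n ω) ((hX n).const_smul _) : Measure ℝ)) := by
  -- Reindexing by ℕ makes the limsup criterion for sequences available; tails then need control
  -- only for large n.
  have hsurj : Function.Surjective Nat.succPNat := fun n => ⟨n.natPred, n.succPNat_natPred⟩
  rw [← hsurj.range_comp]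
  change IsTightMeasureSet (Set.range fun k : ℕ => (meanEsd (P k.succPNat)
    (fun ω => (normSeq P₀ x k.succPNat)⁻¹ • X k.succPNat ω)
    ((hX k.succPNat).const_smul _) : Measure ℝ))
  refine isTightMeasureSet_range_of_tendsto_limsup_measure_norm_gt ?_
  have hlim : Tendsto (fun r : ℝ => ENNReal.ofReal (2 / r ^ 2)) atTop (𝓝 0) := by
    rw [← ENNReal.ofReal_zero]
    exact ENNReal.tendsto_ofReal ((tendsto_pow_atTop two_ne_zero).const_div_atTop 2)
  refine tendsto_of_tendsto_of_tendsto_of_le_of_le' tendsto_const_nhds hlim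
    (Eventually.of_forall fun _ => zero_le) ?_
  filter_upwards [eventually_gt_atTop 0] with r hr
  refine limsup_le_of_le (by isBoundedDefault) ?_
  have htail := (hx_dom.tendsto_mul_tail_normSeq hx hx_int hinf one_pos le_rfl).comp
    (tendsto_add_atTop_nat 1)
  filter_upwards [htail.eventually (gt_mem_nhds (show 0 < 1 / (2 * r ^ 2) by positivity))]
    with k hk
  set n : ℕ+ := k.succPNat with hn
  have hnk : (n : ℕ) = k + 1 := rfl
  have hb := one_le_normSeq (P := P₀) hx hx_int n
  have hb0 : 0 < normSeq P₀ x n := by linarith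
  refine (meanEsd_tail_le ((hX n).const_smul _) hr).trans (ENNReal.ofReal_le_ofReal ?_)
  simp only [Function.comp_apply] at hk
  rw [exceedance_smul (hX_law n) hb0 1]
  simp only [integral_cut_smul (hX_law n) hb0, Finset.sum_const, Finset.card_univ,
    Fintype.card_fin, nsmul_eq_mul]
  have hn0 : (0 : ℝ) < (n : ℕ) := by exact_mod_cast n.pos
  have h1 := mul_truncMoment_normSeq_le (P := P₀) hx hx_int n
  have h2 : ((n : ℕ) : ℝ)⁻¹ * (((n : ℕ) : ℝ) * (((n : ℕ) : ℝ) *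
      (truncMoment P₀ x (normSeq P₀ x n) / normSeq P₀ x n ^ 2))) ≤ 1 := by
    rw [inv_mul_cancel_left₀ hn0.ne', ← mul_div_assoc, div_le_one (by positivity)]
    exact h1
  have h3 : ((n : ℕ) : ℝ)⁻¹ * (((n : ℕ) : ℝ) * (((n : ℕ) : ℝ) *
      (truncMoment P₀ x (normSeq P₀ x n) / normSeq P₀ x n ^ 2))) / r ^ 2 ≤ 1 / r ^ 2 := by gcongr
  have h4 : 2 / r ^ 2 = 1 / r ^ 2 + 2 * (1 / (2 * r ^ 2)) := by field_simp; ring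
  rw [h4]
  exact add_le_add h3 (mul_le_mul_of_nonneg_left hk.le zero_le_two)

end Main

end HeavyTails

end

theorem mainTheorem4
    -- a mean zero, infinite variance random variable in the Gaussian domain of attraction
    {Ω₀ : Type*} [MeasurableSpace Ω₀] (P₀ : Measure Ω₀) [IsProbabilityMeasure P₀]
    (x : Ω₀ → ℝ) (hx : Measurable x)
    (hx_int : Integrable x P₀) (hx_mean : ∫ ω, x ω ∂P₀ = 0)
    (hx_var : evariance x P₀ = ∞)
    (hx_dom : HeavyTails.InGaussianDomain P₀ x)
    -- for each `n ≥ 1`, a random `n × n` Hermitian matrix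
    {Ω : ℕ+ → Type*} [∀ n, MeasurableSpace (Ω n)] (P : ∀ n, Measure (Ω n))
    [∀ n, IsProbabilityMeasure (P n)]
    (X : ∀ n : ℕ+, Ω n → HeavyTails.Herm n) (hX : ∀ n, HeavyTails.IsRandomHerm (X n))
    -- independent blocks of size at most `d n = O(n)`
    (d : ℕ+ → ℕ)
    (hd : (fun n : ℕ+ => (d n : ℝ)) =O[atTop] (fun n : ℕ+ => ((n : ℕ) : ℝ)))
    (hX_block : ∀ n, HeavyTails.BlockIndep (P n)
      (fun ω => (X n ω : Matrix (Fin n) (Fin n) ℂ)) (d n))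
    -- every entry has the distribution of `x`
    (hX_law : ∀ (n : ℕ+) (i j : Fin n),
      IdentDistrib (fun ω => (X n ω : Matrix (Fin n) (Fin n) ℂ) i j)
        (fun ω => (x ω : ℂ)) (P n) P₀)
    -- any metric metrizing weak convergence of probability measures
    (ρ : ProbabilityMeasure ℝ → ProbabilityMeasure ℝ → ℝ)
    (hρ : HeavyTails.MetrizesWeakConvergence ρ) :
    ∀ ε : ℝ, 0 < ε →
      Tendsto (fun n : ℕ+ => P n {ω | ε < ρ
          (HeavyTails.esd ((HeavyTails.normSeq P₀ x n)⁻¹ • X n ω))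
          (HeavyTails.meanEsd (P n) (fun ω => (HeavyTails.normSeq P₀ x n)⁻¹ • X n ω)
            ((hX n).const_smul _))})
        atTop (𝓝 0) := by
  intro ε hε
  have hinf := HeavyTails.lintegral_sq_eq_top hx_mean hx_var
  have htight := HeavyTails.isTightMeasureSet_meanEsd hx hx_int hinf hx_dom hX hX_law
  obtain ⟨J, δ, hδ, hJ, hcontrol⟩ := hρ.exists_ramp_control (S := Set.range fun n : ℕ+ =>
    HeavyTails.meanEsd (P n) (fun ω => (HeavyTails.normSeq P₀ x n)⁻¹ • X n ω)
      ((hX n).const_smul _)) (by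
    convert htight using 1
    ext μ
    simp) hε
  -- The Markov bounds for the finitely many controlling ramps, summed.
  have hlim : Tendsto (fun n : ℕ+ => ∑ p ∈ J, ENNReal.ofReal (δ⁻¹ *
      ∫ ω, |HeavyTails.rampMean p.1 p.2 ((HeavyTails.normSeq P₀ x n)⁻¹ • X n ω) -
        ∫ ω', HeavyTails.rampMean p.1 p.2 ((HeavyTails.normSeq P₀ x n)⁻¹ • X n ω') ∂(P n)| ∂(P n)))
      atTop (𝓝 0) := by
    rw [← Finset.sum_const_zero (s := J)]
    refine tendsto_finsetSum _ fun p hp => ?_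
    have h := (HeavyTails.tendsto_integral_abs_rampMean hx hx_int hinf hx_dom hX d hd hX_block
      hX_law (a := p.1) (b := p.2) (by exact_mod_cast hJ p hp)).const_mul δ⁻¹
    rw [mul_zero] at h
    simpa using ENNReal.tendsto_ofReal h
  refine tendsto_of_tendsto_of_tendsto_of_le_of_le tendsto_const_nhds hlim (fun _ => zero_le)
    fun n => ?_
  -- Monotonicity of measure needs only the inclusion, so measurability of the distance is never at
  -- issue.
  have hsub : {ω | ε < ρ (HeavyTails.esd ((HeavyTails.normSeq P₀ x n)⁻¹ • X n ω))
      (HeavyTails.meanEsd (P n) (fun ω => (HeavyTails.normSeq P₀ x n)⁻¹ • X n ω)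
        ((hX n).const_smul _))} ⊆ ⋃ p ∈ J, {ω | δ ≤
      |HeavyTails.rampMean p.1 p.2 ((HeavyTails.normSeq P₀ x n)⁻¹ • X n ω) -
        ∫ ω', HeavyTails.rampMean p.1 p.2 ((HeavyTails.normSeq P₀ x n)⁻¹ • X n ω') ∂(P n)|} := by
    intro ω hω
    by_contra hcon
    simp only [Set.mem_iUnion, Set.mem_ofPred_eq, not_exists, not_le] at hcon
    refine absurd (hcontrol _ ⟨n, rfl⟩ (HeavyTails.esd ((HeavyTails.normSeq P₀ x n)⁻¹ • X n ω))
      fun p hp => ?_) (not_le.2 hω)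
    have hpq : (p.1 : ℝ) < p.2 := by exact_mod_cast hJ p hp
    rw [HeavyTails.integral_ramp_esd hpq, HeavyTails.integral_ramp_meanEsd _ hpq]
    exact hcon p hp
  refine (measure_mono hsub).trans ((measure_biUnion_finset_le _ _).trans
    (Finset.sum_le_sum fun p hp => ?_))
  have hpq : (p.1 : ℝ) < p.2 := by exact_mod_cast hJ p hp
  have hint := ((hX n).const_smul (HeavyTails.normSeq P₀ x n)⁻¹).integrable_rampMean (P := P n) hpq
  have hmark := mul_meas_ge_le_integral_of_nonneg (μ := P n)
    (ae_of_all _ fun ω => abs_nonneg (HeavyTails.rampMean p.1 p.2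
      ((HeavyTails.normSeq P₀ x n)⁻¹ • X n ω) - ∫ ω', HeavyTails.rampMean p.1 p.2
        ((HeavyTails.normSeq P₀ x n)⁻¹ • X n ω') ∂(P n)))
    (hint.sub (integrable_const _)).abs δ
  rw [← ofReal_measureReal]
  refine ENNReal.ofReal_le_ofReal ?_
  rw [le_inv_mul_iff₀ hδ]
  exact hmark
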